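/- **Setting.** Let $\mathbb F$ be a field of characteristic $0$, let $I=\{1,\dots,n\}$, let $A=(a_{ij})_{i,j\in I}$ be a symmetrizable generalized Cartan matrix (integral, $a_{ii}=2$, $a_{ij}\le 0$ for $i\ne j$, and $a_{ij}=0\Rightarrow a_{ji}=0$), and fix positive integers $d_i$ ($i\in I$) with $d_ia_{ij}=d_ja_{ji}$ for all $i,j$. A *multiparameter* is a matrix $\mathbf q=(q_{ij})_{i,j\in I}$ with entries in $\mathbb F^\times$ such that $q_{ii}^k\neq 1$ for $k=1,\dots,\max(1-a_{ij},2)$ and all $i,j\in I$. Two multiparameters are *twist-equivalent*, $\mathbf q'\sim\mathbf q''$, if $q'_{ij}q'_{ji}=q''_{ij}q''_{ji}$ and $q'_{ii}=q''_{ii}$ for all $i,j\in I$. A multiparameter is *of Cartan type $A$* if $q_{ij}q_{ji}=q_{ii}^{a_{ij}}$ for all $i,j$. **The algebras.** $U_{\mathbf q}(\mathfrak g_D)$ is the unital associative $\mathbb F$-algebra with generators $E_i,F_i,K_i^{\pm1},L_i^{\pm1}$ ($i\in I$) and relations (for all $i,j\in I$): $K_i^{\pm1}K_i^{\mp1}=1=L_i^{\pm1}L_i^{\mp1}$;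 all $K_i^{\pm1},L_j^{\pm1}$ commute with each other; $$K_iE_jK_i^{-1}=q_{ij}E_j,\quad L_iE_jL_i^{-1}=q_{ji}^{-1}E_j,\quad K_iF_jK_i^{-1}=q_{ij}^{-1}F_j,\quad L_iF_jL_i^{-1}=q_{ji}F_j,$$ $$E_iF_j-F_jE_i=\delta_{ij}\,q_{ii}\,\frac{K_i-L_i}{q_{ii}-1},$$ $$\sum_{k=0}^{1-a_{ij}}(-1)^k\binom{1-a_{ij}}{k}_{q_{ii}}q_{ii}^{\binom k2}q_{ij}^{k}\,E_i^{1-a_{ij}-k}E_jE_i^{k}=0,\qquad \sum_{k=0}^{1-a_{ij}}(-1)^k\binom{1-a_{ij}}{k}_{q_{ii}}q_{ii}^{\binom k2}q_{ji}^{k}\,F_i^{1-a_{ij}-k}F_jF_i^{k}=0\qquad(i\ne j),$$ where $\binom mk_{q}=\frac{(m)_q!}{(k)_q!(m-k)_q!}$, $(m)_q=1+q+\dots+q^{m-1}$. It is a Hopf algebra with $\Delta(E_i)=E_i\otimes1+K_i\otimes E_i$, $\Delta(F_i)=F_i\otimes L_i+1\otimes F_i$, $\epsilon(E_i)=\epsilon(F_i)=0$,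 $S(E_i)=-K_i^{-1}E_i$, $S(F_i)=-F_iL_i^{-1}$, and with all $K_i^{\pm1},L_i^{\pm1}$ group-like. The *quantum Borel subalgebras* are the Hopf subalgebras $U_{\mathbf q}(\mathfrak b_+)$, generated by all $K_i^{\pm1},E_i$, and $U_{\mathbf q}(\mathfrak b_-)$, generated by all $F_i,L_i^{\pm1}$. **Toral cocycles.** Let $G_1,\dots,G_n$ be the standard generators of the (multiplicatively written) group $\mathcal G_n=\mathbb Z^n$, and let $p$ be the Hopf algebra map from $U_{\mathbf q}(\mathfrak g_D)$ to the group algebra $\mathbb F[\mathcal G_n]$ with $p(E_i)=p(F_i)=0$, $p(K_i^{\pm1})=p(L_i^{\pm1})=G_i^{\pm1}$; restrict it to $U_{\mathbf q}(\mathfrak b_\pm)$ as well. For $H$ one of these three Hopf algebras and a bicharacter $\chi:\mathcal G_n\times\mathcal G_n\to\mathbb F^\times$, extended bilinearly to $\mathbb F[\mathcal G_n]$, put $\sigma_\chi:=\chi\circ(p\otimes p)$. A *toral 2-cocycle* of $H$ is a convolution invertible form $\sigma=\sigma_\chi:H\otimes H\to\mathbb F$ of this kind; it satisfies $\sigma(b_{(1)},c_{(1)})\sigma(a,b_{(2)}c_{(2)})=\sigma(a_{(1)},b_{(1)})\sigma(a_{(2)}b_{(2)},c)$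 and $\sigma(a,1)=\epsilon(a)=\sigma(1,a)$. The *2-cocycle deformation* $H_\sigma$ is the Hopf algebra with the coalgebra structure and the unit of $H$, with product $a\cdot_\sigma b=\sigma(a_{(1)},b_{(1)})\,a_{(2)}b_{(2)}\,\sigma^{-1}(a_{(3)},b_{(3)})$ and antipode $S_\sigma(a)=\sigma(a_{(1)},S(a_{(2)}))\,S(a_{(3)})\,\sigma^{-1}(S(a_{(4)}),a_{(5)})$. **Theorem.** (a) If $\mathbf q'\sim\mathbf q''$ are twist-equivalent multiparameters, then there is a toral 2-cocycle $\sigma$ of $U_{\mathbf q'}(\mathfrak g_D)$ with $U_{\mathbf q''}(\mathfrak g_D)\cong\big(U_{\mathbf q'}(\mathfrak g_D)\big)_\sigma$ as Hopf algebras. (b) If $\mathbf q$ is a multiparameter of Cartan type $A$, if $q\in\mathbb F^\times$ satisfies $q_{ii}=q^{2d_i}$ for all $i\in I$, and if $\check{\mathbf q}:=(q^{d_ia_{ij}})_{i,j\in I}$ is the associated canonical multiparameter, then there is a toral 2-cocycle $\sigma$ of $U_{\check{\mathbf q}}(\mathfrak g_D)$ with $U_{\mathbf q}(\mathfrak g_D)\cong\big(U_{\check{\mathbf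 q}}(\mathfrak g_D)\big)_\sigma$ as Hopf algebras. (c) Both (a) and (b) hold likewise with $U(\mathfrak g_D)$ replaced throughout by $U(\mathfrak b_+)$, and by $U(\mathfrak b_-)$. -/

import Mathlib

open scoped TensorProduct

/-- The Gaussian binomial coefficient `(m choose k)_q`, i.e. the value at `q` of the polynomial
`(m)_q! / ((k)_q! (m - k)_q!) ∈ ℤ[q]`, defined by the `q`-Pascal recursion. -/
def gaussBinom {F : Type*} [CommRing F] (q : F) : ℕ → ℕ → F
  | _, 0 => 1
  | 0, _ + 1 => 0
  | m + 1, k + 1 => gaussBinom q m k + q ^ (k + 1) * gaussBinom q m (k + 1)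

/-- The `q`-Serre expression
`∑_{k=0}^{m} (-1)^k (m choose k)_q q^{k(k-1)/2} c^k x^{m-k} y x^k`. -/
def qSerre {F B : Type*} [CommRing F] [Ring B] [Algebra F B] (q c : F) (m : ℕ) (x y : B) : B :=
  ∑ k ∈ Finset.range (m + 1),
    ((-1) ^ k * gaussBinom q m k * q ^ (k.choose 2) * c ^ k) • (x ^ (m - k) * y * x ^ k)

section QSerre

variable {F : Type*} [CommRing F]

lemma gaussBinom_zero_right (q : F) (m : ℕ) : gaussBinom q m 0 = 1 := by
  cases m <;> rfl

lemma gaussBinom_succ_succ (q : F) (m k : ℕ) :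
    gaussBinom q (m + 1) (k + 1) = gaussBinom q m k + q ^ (k + 1) * gaussBinom q m (k + 1) := rfl

lemma gaussBinom_eq_zero (q : F) : ∀ m k : ℕ, m < k → gaussBinom q m k = 0
  | 0, k + 1, _ => rfl
  | m + 1, k + 1, h => by
      rw [gaussBinom_succ_succ, gaussBinom_eq_zero q m k (by omega),
        gaussBinom_eq_zero q m (k + 1) (by omega)]
      simp

lemma gaussBinom_self (q : F) : ∀ m : ℕ, gaussBinom q m m = 1
  | 0 => rfl
  | m + 1 => by
      rw [gaussBinom_succ_succ, gaussBinom_self q m, gaussBinom_eq_zero q m (m + 1) (by omega)]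
      simp

lemma gaussBinom_succ_succ' (q : F) : ∀ m k : ℕ, k ≤ m →
    gaussBinom q (m + 1) (k + 1) = q ^ (m - k) * gaussBinom q m k + gaussBinom q m (k + 1)
  | 0, 0, _ => by simp [gaussBinom]
  | m + 1, 0, _ => by
      rw [gaussBinom_succ_succ, gaussBinom_succ_succ' q m 0 (by omega), gaussBinom_zero_right,
        gaussBinom_zero_right]
      have := gaussBinom_succ_succ q m 0
      rw [gaussBinom_succ_succ' q m 0 (by omega), gaussBinom_zero_right] at this
      simp only [Nat.sub_zero, pow_succ] at this ⊢
      linear_combination -this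
  | m + 1, k + 1, h => by
      rcases Nat.lt_or_ge m (k + 1) with hk | hk
      · obtain rfl : k = m := by omega
        rw [gaussBinom_self, gaussBinom_self, gaussBinom_eq_zero q (k + 1) (k + 1 + 1) (by omega)]
        simp
      · have h6 := gaussBinom_succ_succ' q m (k + 1) (by omega)
        rw [gaussBinom_succ_succ q (m + 1) (k + 1), h6]
        have h1 := gaussBinom_succ_succ q m k
        have h2 := gaussBinom_succ_succ q m (k + 1)
        have h3 := gaussBinom_succ_succ' q m k (by omega)
        have h4 : m - k = (m - (k + 1)) + 1 := by omega
        have h5 : m + 1 - (k + 1) = (m - (k + 1)) + 1 := by omega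
        rw [h4] at h3
        rw [h5]
        simp only [pow_succ] at *
        have h7 := h2.symm.trans h6
        linear_combination h3 - q ^ (m - (k + 1)) * q * h1 + h7

variable {B : Type*} [Ring B] [Algebra F B]

lemma qSerre_zero (q c : F) (x y : B) : qSerre q c 0 x y = y := by
  simp [qSerre, gaussBinom]

lemma qSerre_succ (q c : F) (m : ℕ) (x y : B) :
    qSerre q c (m + 1) x y =
      x * qSerre q c m x y - (q ^ m * c) • (qSerre q c m x y * x) := by
  have h1 : x * qSerre q c m x y = ∑ k ∈ Finset.range (m + 2),
      ((-1) ^ k * gaussBinom q m k * q ^ (k.choose 2) * c ^ k) • (x ^ (m + 1 - k) * y * x ^ k) := by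
    rw [Finset.sum_range_succ, gaussBinom_eq_zero q m (m + 1) (by omega), qSerre, Finset.mul_sum]
    simp only [mul_zero, zero_mul, zero_smul, add_zero]
    refine Finset.sum_congr rfl fun k hk ↦ ?_
    rw [Finset.mem_range] at hk
    rw [show m + 1 - k = (m - k) + 1 by omega, pow_succ']
    simp [mul_assoc]
  have h2 : (q ^ m * c) • (qSerre q c m x y * x) = ∑ k ∈ Finset.range (m + 1),
      ((-1) ^ k * gaussBinom q m k * q ^ (k.choose 2 + m) * c ^ (k + 1)) •
        (x ^ (m + 1 - (k + 1)) * y * x ^ (k + 1)) := by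
    rw [qSerre, Finset.sum_mul, Finset.smul_sum]
    refine Finset.sum_congr rfl fun k _ ↦ ?_
    rw [smul_mul_assoc, smul_smul, show m + 1 - (k + 1) = m - k by omega, pow_succ x k,
      ← mul_assoc (x ^ (m - k) * y)]
    congr 1
    ring
  rw [h1, h2, qSerre, Finset.sum_range_succ' _ (m + 1), Finset.sum_range_succ' _ (m + 1),
    add_sub_right_comm, ← Finset.sum_sub_distrib]
  congr 1
  · refine Finset.sum_congr rfl fun k hk ↦ ?_
    rw [Finset.mem_range] at hk
    rw [← sub_smul]
    congr 1
    rw [gaussBinom_succ_succ' q m k (by omega), Nat.choose_succ_succ' k 1, Nat.choose_one_right]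
    have : q ^ (k.choose 2 + m) = q ^ (m - k) * q ^ (k + k.choose 2) := by
      rw [← pow_add]; congr 1; omega
    rw [this]
    ring
  · simp [gaussBinom_zero_right]

lemma map_qSerre {B' : Type*} [Ring B'] [Algebra F B'] (f : B →ₐ[F] B') (q c : F) (m : ℕ)
    (x y : B) : f (qSerre q c m x y) = qSerre q c m (f x) (f y) := by
  simp [qSerre, map_sum]

lemma pow_skew {X Z : B} {q : F} (h : Z * X = q • (X * Z)) (k : ℕ) :
    Z * X ^ k = q ^ k • (X ^ k * Z) := by
  induction k with
  | zero => simp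
  | succ k ih =>
      rw [pow_succ, ← mul_assoc, ih, smul_mul_assoc, mul_assoc, h, mul_smul_comm, smul_smul,
        ← mul_assoc, pow_succ]

lemma skew_qSerre {X Y Z : B} {r c : F} (hX : Z * X = r • (X * Z)) (hY : Z * Y = c • (Y * Z))
    (q' c' : F) (m : ℕ) :
    Z * qSerre q' c' m X Y = (r ^ m * c) • (qSerre q' c' m X Y * Z) := by
  induction m with
  | zero => simp [qSerre_zero, hY]
  | succ m ih =>
      rw [qSerre_succ, mul_sub, ← mul_assoc, hX, mul_smul_comm, ← mul_assoc, ih, smul_mul_assoc,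
        smul_mul_assoc, mul_assoc, ih, mul_assoc _ Z X, hX, sub_mul, smul_sub, smul_mul_assoc]
      simp only [mul_smul_comm, smul_smul, mul_assoc]
      congr 2 <;> ring

lemma qSerre_skew {X Y Z : B} {r c : F} (hX : X * Z = r • (Z * X)) (hY : Y * Z = c • (Z * Y))
    (q' c' : F) (m : ℕ) :
    qSerre q' c' m X Y * Z = (r ^ m * c) • (Z * qSerre q' c' m X Y) := by
  induction m with
  | zero => simp [qSerre_zero, hY]
  | succ m ih =>
      rw [qSerre_succ, sub_mul, mul_assoc, ih, smul_mul_assoc, mul_assoc _ X Z, hX,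
        mul_smul_comm, mul_smul_comm, ← mul_assoc, hX, ← mul_assoc _ Z X, ih, mul_sub]
      simp only [mul_smul_comm, smul_smul, mul_assoc, smul_mul_assoc, smul_sub]
      congr 2 <;> ring

/-- The coproduct of a quantum Serre element, in abstract form. -/
lemma qSerre_add {X₁ X₂ Y₁ Y₂ : B} {q c c' : F} (hXX : X₂ * X₁ = q • (X₁ * X₂))
    (hXY : X₂ * Y₁ = c • (Y₁ * X₂)) (hYX : Y₂ * X₁ = c' • (X₁ * Y₂)) (m : ℕ) :
    qSerre q c m (X₁ + X₂) (Y₁ + Y₂) = qSerre q c m X₁ Y₁ +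
      ∑ k ∈ Finset.range (m + 1), (gaussBinom q m k * ∏ s ∈ Finset.Ico k m,
        (1 - q ^ s * (c * c'))) • (X₁ ^ (m - k) * qSerre q c k X₂ Y₂) := by
  induction m with
  | zero => simp [qSerre_zero, gaussBinom]
  | succ m ih =>
      have hA : X₂ * qSerre q c m X₁ Y₁ = (q ^ m * c) • (qSerre q c m X₁ Y₁ * X₂) :=
        skew_qSerre hXX hXY q c m
      set p := c * c' with hp
      set a : ℕ → ℕ → F := fun m k ↦ gaussBinom q m k * ∏ s ∈ Finset.Ico k m, (1 - q ^ s * p)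
        with ha
      have hterm : ∀ k ∈ Finset.range (m + 1),
          (X₁ + X₂) * (X₁ ^ (m - k) * qSerre q c k X₂ Y₂) -
            (q ^ m * c) • (X₁ ^ (m - k) * qSerre q c k X₂ Y₂ * (X₁ + X₂)) =
          (1 - q ^ (m + k) * p) • (X₁ ^ (m + 1 - k) * qSerre q c k X₂ Y₂) +
            q ^ (m - k) • (X₁ ^ (m + 1 - (k + 1)) * qSerre q c (k + 1) X₂ Y₂) := by
        intro k hk
        rw [Finset.mem_range] at hk
        have e1 : qSerre q c k X₂ Y₂ * X₁ = (q ^ k * c') • (X₁ * qSerre q c k X₂ Y₂) :=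
          qSerre_skew hXX hYX q c k
        have e2 : X₂ * X₁ ^ (m - k) = q ^ (m - k) • (X₁ ^ (m - k) * X₂) := pow_skew hXX _
        have e3 : q ^ m = q ^ (m - k) * q ^ k := by rw [← pow_add]; congr 1; omega
        rw [show m + 1 - (k + 1) = m - k by omega, show m + 1 - k = (m - k) + 1 by omega,
          qSerre_succ q c k X₂, add_mul, mul_add, smul_add, ← mul_assoc X₂, e2, mul_assoc _ _ X₁,
          e1, ← mul_assoc X₁, ← pow_succ', mul_smul_comm, ← mul_assoc (X₁ ^ (m - k)) X₁,
          ← pow_succ, smul_mul_assoc, mul_sub, smul_sub, mul_smul_comm, sub_smul, one_smul]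
        simp only [smul_smul, mul_assoc]
        have e4 : q ^ m * (c * (q ^ k * c')) = q ^ (m + k) * p := by rw [hp]; ring
        have e5 : q ^ (m - k) * (q ^ k * c) = q ^ m * c := by rw [e3]; ring
        rw [e4, e5]
        abel
      have ha0 : a (m + 1) 0 = (1 - q ^ m * p) * a m 0 := by
        simp only [ha, gaussBinom_zero_right, one_mul]
        rw [Finset.prod_Ico_succ_top (by omega), mul_comm]
      have haS : ∀ k ≤ m, a (m + 1) (k + 1) =
          (1 - q ^ (m + (k + 1)) * p) * a m (k + 1) + q ^ (m - k) * a m k := by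
        intro k hk
        simp only [ha]
        have g1 := gaussBinom_succ_succ q m k
        have g2 := gaussBinom_succ_succ' q m k hk
        rcases Nat.lt_or_ge k m with hkm | hkm
        · rw [Finset.prod_Ico_succ_top (by omega), Finset.prod_eq_prod_Ico_succ_bot hkm]
          have e3 : q ^ m = q ^ (m - k) * q ^ k := by rw [← pow_add]; congr 1; omega
          rw [pow_add q m (k + 1), e3]
          rw [g1] at g2 ⊢
          linear_combination (∏ s ∈ Finset.Ico (k + 1) m, (1 - q ^ s * p)) * g2
        · obtain rfl : k = m := by omega
          simp [gaussBinom_self, gaussBinom_eq_zero q k (k + 1) (by omega)]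
      have hL : (X₁ + X₂) * (qSerre q c m X₁ Y₁ + ∑ k ∈ Finset.range (m + 1),
            a m k • (X₁ ^ (m - k) * qSerre q c k X₂ Y₂)) -
          (q ^ m * c) • ((qSerre q c m X₁ Y₁ + ∑ k ∈ Finset.range (m + 1),
            a m k • (X₁ ^ (m - k) * qSerre q c k X₂ Y₂)) * (X₁ + X₂)) =
          qSerre q c (m + 1) X₁ Y₁ + ∑ k ∈ Finset.range (m + 1),
            a m k • ((X₁ + X₂) * (X₁ ^ (m - k) * qSerre q c k X₂ Y₂) -
              (q ^ m * c) • (X₁ ^ (m - k) * qSerre q c k X₂ Y₂ * (X₁ + X₂))) := by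
        have hΦ := fun z : B ↦ show ((LinearMap.mulLeft F (X₁ + X₂) -
          (q ^ m * c) • LinearMap.mulRight F (X₁ + X₂)) z) =
            (X₁ + X₂) * z - (q ^ m * c) • (z * (X₁ + X₂)) from rfl
        simp only [← hΦ, map_add, map_sum, map_smul]
        congr 1
        rw [hΦ, qSerre_succ, add_mul X₁ X₂, mul_add _ X₁ X₂, smul_add, hA]
        abel
      rw [qSerre_succ, ih, hL]
      congr 1
      rw [Finset.sum_congr rfl fun k hk ↦ by rw [hterm k hk]]
      simp only [smul_add, smul_smul, Finset.sum_add_distrib]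
      have hz : ∑ k ∈ Finset.range (m + 1), (a m k * (1 - q ^ (m + k) * p)) •
          (X₁ ^ (m + 1 - k) * qSerre q c k X₂ Y₂) =
          ∑ k ∈ Finset.range (m + 2), (a m k * (1 - q ^ (m + k) * p)) •
          (X₁ ^ (m + 1 - k) * qSerre q c k X₂ Y₂) := by
        rw [Finset.sum_range_succ _ (m + 1)]
        simp [ha, gaussBinom_eq_zero q m (m + 1) (by omega)]
      rw [hz, Finset.sum_range_succ' _ (m + 1), Finset.sum_range_succ' _ (m + 1),
        add_right_comm, ← Finset.sum_add_distrib]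
      congr 1
      · refine Finset.sum_congr rfl fun k hk ↦ ?_
        rw [Finset.mem_range] at hk
        rw [← add_smul]
        change _ = a (m + 1) (k + 1) • _
        rw [haS k (by omega)]
        congr 1
        ring
      · change _ = a (m + 1) 0 • _
        rw [ha0, mul_comm]
        rfl

/-- The commutator of a quantum Serre element with a generator of the opposite type. -/
lemma qSerre_comm {F : Type*} [Field F] {B : Type*} [Ring B] [Algebra F B]
    {x y f g h : B} {q c c' κ : F} (hq : q ≠ 0)
    (hc' : c' ≠ 0) (hx : x * f - f * x = κ • (g - h)) (hy : y * f = f * y)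
    (hgx : g * x = q • (x * g)) (hgy : g * y = c • (y * g)) (hhx : h * x = q⁻¹ • (x * h))
    (hhy : h * y = c'⁻¹ • (y * h)) (m : ℕ) :
    qSerre q c (m + 1) x y * f - f * qSerre q c (m + 1) x y =
      (-(κ * c'⁻¹ * q⁻¹ ^ m * (∑ s ∈ Finset.range (m + 1), q ^ s) * (1 - q ^ m * (c * c')))) •
        (qSerre q c m x y * h) := by
  have key : ∀ m : ℕ, qSerre q c (m + 1) x y * f - f * qSerre q c (m + 1) x y =
        (κ * (q ^ m * c - q⁻¹ ^ m * c'⁻¹)) • (qSerre q c m x y * h) +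
        (x * (qSerre q c m x y * f - f * qSerre q c m x y) -
          (q ^ m * c) • ((qSerre q c m x y * f - f * qSerre q c m x y) * x)) := by
    intro m
    have hg : g * qSerre q c m x y = (q ^ m * c) • (qSerre q c m x y * g) :=
      skew_qSerre hgx hgy q c m
    have hh : h * qSerre q c m x y = (q⁻¹ ^ m * c'⁻¹) • (qSerre q c m x y * h) :=
      skew_qSerre hhx hhy q c m
    rw [qSerre_succ]
    set u := qSerre q c m x y
    set r := q ^ m * c
    have h1 : (x * f - f * x) * u = κ • (r • (u * g)) - κ • ((q⁻¹ ^ m * c'⁻¹) • (u * h)) := by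
      rw [hx, smul_mul_assoc, sub_mul, hg, hh, smul_sub]
    have h2 : u * (x * f - f * x) = κ • (u * g) - κ • (u * h) := by
      rw [hx, mul_smul_comm, mul_sub, smul_sub]
    have h3 : (x * u - r • (u * x)) * f - f * (x * u - r • (u * x)) =
        (x * f - f * x) * u - r • (u * (x * f - f * x)) +
        (x * (u * f - f * u) - r • ((u * f - f * u) * x)) := by
      simp only [mul_sub, sub_mul, smul_sub, smul_mul_assoc, mul_smul_comm, mul_assoc]
      abel
    rw [h3, h1, h2]
    congr 1
    simp only [smul_sub, smul_smul, mul_sub, sub_smul, mul_comm κ r]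
    abel
  induction m with
  | zero =>
      rw [key]
      simp only [qSerre_zero, hy, sub_self, mul_zero, zero_mul, smul_zero, add_zero]
      congr 1
      simp
      field_simp
      ring
  | succ m ih =>
      rw [key, ih]
      have e : qSerre q c m x y * h * x = q⁻¹ • (qSerre q c m x y * x * h) := by
        rw [mul_assoc, hhx, mul_smul_comm, mul_assoc]
      have e' : qSerre q c (m + 1) x y * h = x * qSerre q c m x y * h -
          (q ^ m * c) • (qSerre q c m x y * x * h) := by
        rw [qSerre_succ, sub_mul, smul_mul_assoc]
      rw [smul_mul_assoc, e, mul_smul_comm, ← mul_assoc x, smul_smul, smul_smul,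
        eq_add_of_sub_eq e'.symm, smul_add, smul_smul]
      set t := -(κ * c'⁻¹ * q⁻¹ ^ m * (∑ s ∈ Finset.range (m + 1), q ^ s) *
        (1 - q ^ m * (c * c')))
      have e2 : q ^ (m + 1) * c * t * q⁻¹ = t * (q ^ m * c) := by
        field_simp
        ring
      rw [e2, add_sub_cancel_right, ← add_smul]
      congr 1
      have hs : ∑ s ∈ Finset.range (m + 1 + 1), q ^ s = 1 + q * ∑ s ∈ Finset.range (m + 1), q ^ s := by
        rw [Finset.sum_range_succ', Finset.mul_sum, add_comm]
        simp [pow_succ, mul_comm]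
      have hs' : ∑ s ∈ Finset.range (m + 1 + 1), q ^ s =
          ∑ s ∈ Finset.range (m + 1), q ^ s + q ^ (m + 1) := Finset.sum_range_succ _ _
      have hs'' := hs.symm.trans hs'
      rw [hs]
      simp only [t]
      set S := ∑ s ∈ Finset.range (m + 1), q ^ s
      rw [inv_pow, inv_pow]
      field_simp
      linear_combination (-κ * q ^ (2 * m + 1) * c * c') * hs''

end QSerre

/-- The generators `E_i`, `F_i`, `K_i^{±1}`, `L_i^{±1}`. -/
inductive Gen (n : ℕ) : Type
  | e (i : Fin n)
  | f (i : Fin n)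
  | k (i : Fin n)
  | kInv (i : Fin n)
  | l (i : Fin n)
  | lInv (i : Fin n)

section PreAlg

variable {𝕜 : Type*} [Field 𝕜] {n : ℕ}

/-- The defining relations other than the quantum Serre relations. -/
inductive PreRel (q : Fin n → Fin n → 𝕜ˣ) :
    FreeAlgebra 𝕜 (Gen n) → FreeAlgebra 𝕜 (Gen n) → Prop
  | k_kInv (i : Fin n) : PreRel q (.ι 𝕜 (.k i) * .ι 𝕜 (.kInv i)) 1
  | kInv_k (i : Fin n) : PreRel q (.ι 𝕜 (.kInv i) * .ι 𝕜 (.k i)) 1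
  | l_lInv (i : Fin n) : PreRel q (.ι 𝕜 (.l i) * .ι 𝕜 (.lInv i)) 1
  | lInv_l (i : Fin n) : PreRel q (.ι 𝕜 (.lInv i) * .ι 𝕜 (.l i)) 1
  | k_l (i j : Fin n) : PreRel q (.ι 𝕜 (.k i) * .ι 𝕜 (.l j)) (.ι 𝕜 (.l j) * .ι 𝕜 (.k i))
  | k_k (i j : Fin n) : PreRel q (.ι 𝕜 (.k i) * .ι 𝕜 (.k j)) (.ι 𝕜 (.k j) * .ι 𝕜 (.k i))
  | l_l (i j : Fin n) : PreRel q (.ι 𝕜 (.l i) * .ι 𝕜 (.l j)) (.ι 𝕜 (.l j) * .ι 𝕜 (.l i))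
  | k_e (i j : Fin n) : PreRel q (.ι 𝕜 (.k i) * .ι 𝕜 (.e j) * .ι 𝕜 (.kInv i))
      ((q i j : 𝕜) • .ι 𝕜 (.e j))
  | l_e (i j : Fin n) : PreRel q (.ι 𝕜 (.l i) * .ι 𝕜 (.e j) * .ι 𝕜 (.lInv i))
      ((q j i : 𝕜)⁻¹ • .ι 𝕜 (.e j))
  | k_f (i j : Fin n) : PreRel q (.ι 𝕜 (.k i) * .ι 𝕜 (.f j) * .ι 𝕜 (.kInv i))
      ((q i j : 𝕜)⁻¹ • .ι 𝕜 (.f j))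
  | l_f (i j : Fin n) : PreRel q (.ι 𝕜 (.l i) * .ι 𝕜 (.f j) * .ι 𝕜 (.lInv i))
      ((q j i : 𝕜) • .ι 𝕜 (.f j))
  | e_f (i j : Fin n) : PreRel q (.ι 𝕜 (.e i) * .ι 𝕜 (.f j) - .ι 𝕜 (.f j) * .ι 𝕜 (.e i))
      (if i = j then ((q i i : 𝕜) / ((q i i : 𝕜) - 1)) • (.ι 𝕜 (.k i) - .ι 𝕜 (.l i)) else 0)

/-- The algebra presented by all defining relations other than the quantum Serre relations. -/
def PreAlg (q : Fin n → Fin n → 𝕜ˣ) : Type _ := RingQuot (PreRel q)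

namespace PreAlg

variable (q : Fin n → Fin n → 𝕜ˣ)

instance : Ring (PreAlg q) := inferInstanceAs (Ring (RingQuot (PreRel q)))

instance : Algebra 𝕜 (PreAlg q) := inferInstanceAs (Algebra 𝕜 (RingQuot (PreRel q)))

/-- The quotient map from the free algebra. -/
def mk : FreeAlgebra 𝕜 (Gen n) →ₐ[𝕜] PreAlg q := RingQuot.mkAlgHom 𝕜 (PreRel q)

/-- A generator, as an element of `PreAlg q`. -/
def gen (g : Gen n) : PreAlg q := mk q (.ι 𝕜 g)

section Lift

variable {q} {B : Type*} [Ring B] [Algebra 𝕜 B]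

/-- The algebra map out of `PreAlg q` determined by images of the generators that satisfy the
defining relations. -/
def lift (φ : Gen n → B)
    (h : ∀ ⦃x y⦄, PreRel q x y → FreeAlgebra.lift 𝕜 φ x = FreeAlgebra.lift 𝕜 φ y) :
    PreAlg q →ₐ[𝕜] B :=
  (RingQuot.liftAlgHom 𝕜 ⟨FreeAlgebra.lift 𝕜 φ, h⟩ : RingQuot (PreRel q) →ₐ[𝕜] B)

@[simp] lemma lift_gen (φ : Gen n → B)
    (h : ∀ ⦃x y⦄, PreRel q x y → FreeAlgebra.lift 𝕜 φ x = FreeAlgebra.lift 𝕜 φ y) (g : Gen n) :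
    lift φ h (gen q g) = φ g :=
  (RingQuot.liftAlgHom_mkAlgHom_apply 𝕜 (FreeAlgebra.lift 𝕜 φ) h (.ι 𝕜 g)).trans
    (FreeAlgebra.lift_ι_apply φ g)

lemma hom_ext {φ ψ : PreAlg q →ₐ[𝕜] B} (h : ∀ g, φ (gen q g) = ψ (gen q g)) : φ = ψ := by
  refine RingQuot.ringQuot_ext' 𝕜 (s := PreRel q) φ ψ (FreeAlgebra.hom_ext ?_)
  ext g
  exact h g

@[elab_as_elim] lemma induction {P : PreAlg q → Prop}
    (algebraMap : ∀ r : 𝕜, P (algebraMap 𝕜 (PreAlg q) r)) (gen : ∀ g, P (gen q g))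
    (mul : ∀ a b, P a → P b → P (a * b)) (add : ∀ a b, P a → P b → P (a + b)) (a : PreAlg q) :
    P a := by
  obtain ⟨x, rfl⟩ : ∃ x, mk q x = a := RingQuot.mkAlgHom_surjective 𝕜 (PreRel q) a
  induction x using FreeAlgebra.induction with
  | grade0 r => simpa using algebraMap r
  | grade1 g => exact gen g
  | mul a b ha hb => simpa using mul _ _ ha hb
  | add a b ha hb => simpa using add _ _ ha hb

end Lift

section Relations

variable {q}

private lemma rel {x y : FreeAlgebra 𝕜 (Gen n)} (h : PreRel q x y) :
    mk q x = mk q y :=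
  RingQuot.mkAlgHom_rel 𝕜 h

@[simp] lemma k_kInv (i : Fin n) : gen q (.k i) * gen q (.kInv i) = 1 := by
  simpa [gen] using rel (PreRel.k_kInv (q := q) i)

@[simp] lemma kInv_k (i : Fin n) : gen q (.kInv i) * gen q (.k i) = 1 := by
  simpa [gen] using rel (PreRel.kInv_k (q := q) i)

@[simp] lemma l_lInv (i : Fin n) : gen q (.l i) * gen q (.lInv i) = 1 := by
  simpa [gen] using rel (PreRel.l_lInv (q := q) i)

@[simp] lemma lInv_l (i : Fin n) : gen q (.lInv i) * gen q (.l i) = 1 := by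
  simpa [gen] using rel (PreRel.lInv_l (q := q) i)

lemma k_l (i j : Fin n) : gen q (.k i) * gen q (.l j) = gen q (.l j) * gen q (.k i) := by
  simpa [gen] using rel (PreRel.k_l (q := q) i j)

lemma k_k (i j : Fin n) : gen q (.k i) * gen q (.k j) = gen q (.k j) * gen q (.k i) := by
  simpa [gen] using rel (PreRel.k_k (q := q) i j)

lemma l_l (i j : Fin n) : gen q (.l i) * gen q (.l j) = gen q (.l j) * gen q (.l i) := by
  simpa [gen] using rel (PreRel.l_l (q := q) i j)

lemma k_e' (i j : Fin n) :
    gen q (.k i) * gen q (.e j) * gen q (.kInv i) = (q i j : 𝕜) • gen q (.e j) := by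
  simpa [gen] using rel (PreRel.k_e (q := q) i j)

lemma l_e' (i j : Fin n) :
    gen q (.l i) * gen q (.e j) * gen q (.lInv i) = (q j i : 𝕜)⁻¹ • gen q (.e j) := by
  simpa [gen] using rel (PreRel.l_e (q := q) i j)

lemma k_f' (i j : Fin n) :
    gen q (.k i) * gen q (.f j) * gen q (.kInv i) = (q i j : 𝕜)⁻¹ • gen q (.f j) := by
  simpa [gen] using rel (PreRel.k_f (q := q) i j)

lemma l_f' (i j : Fin n) :
    gen q (.l i) * gen q (.f j) * gen q (.lInv i) = (q j i : 𝕜) • gen q (.f j) := by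
  simpa [gen] using rel (PreRel.l_f (q := q) i j)

lemma e_f (i j : Fin n) :
    gen q (.e i) * gen q (.f j) - gen q (.f j) * gen q (.e i) =
      if i = j then ((q i i : 𝕜) / ((q i i : 𝕜) - 1)) • (gen q (.k i) - gen q (.l i)) else 0 := by
  have := rel (PreRel.e_f (q := q) i j)
  split_ifs at this ⊢ <;> simpa [gen] using this

private lemma comm_of_conj {A : Type*} [Ring A] [Algebra 𝕜 A] {g g' x : A} {c : 𝕜}
    (h : g * x * g' = c • x) (hg : g' * g = 1) : g * x = c • (x * g) := by
  rw [← smul_mul_assoc, ← h, mul_assoc, hg, mul_one]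

private lemma inv_comm_of_conj {A : Type*} [Ring A] [Algebra 𝕜 A] {g g' x : A} {c : 𝕜}
    (h : g * x = c • (x * g)) (hg : g' * g = 1) (hg' : g * g' = 1) (hc : c ≠ 0) :
    g' * x = c⁻¹ • (x * g') := by
  have h1 : x * g' = c • (g' * x) := by
    calc x * g' = g' * (g * x) * g' := by rw [← mul_assoc g', hg, one_mul]
      _ = c • (g' * x) := by
        rw [h, mul_smul_comm, smul_mul_assoc, mul_assoc, mul_assoc, hg', mul_one]
  rw [h1, smul_smul, inv_mul_cancel₀ hc, one_smul]

lemma k_e (i j : Fin n) :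
    gen q (.k i) * gen q (.e j) = (q i j : 𝕜) • (gen q (.e j) * gen q (.k i)) :=
  comm_of_conj (k_e' i j) (kInv_k i)

lemma l_e (i j : Fin n) :
    gen q (.l i) * gen q (.e j) = (q j i : 𝕜)⁻¹ • (gen q (.e j) * gen q (.l i)) :=
  comm_of_conj (l_e' i j) (lInv_l i)

lemma k_f (i j : Fin n) :
    gen q (.k i) * gen q (.f j) = (q i j : 𝕜)⁻¹ • (gen q (.f j) * gen q (.k i)) :=
  comm_of_conj (k_f' i j) (kInv_k i)

lemma l_f (i j : Fin n) :
    gen q (.l i) * gen q (.f j) = (q j i : 𝕜) • (gen q (.f j) * gen q (.l i)) :=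
  comm_of_conj (l_f' i j) (lInv_l i)

lemma kInv_e (i j : Fin n) :
    gen q (.kInv i) * gen q (.e j) = (q i j : 𝕜)⁻¹ • (gen q (.e j) * gen q (.kInv i)) :=
  inv_comm_of_conj (k_e i j) (kInv_k i) (k_kInv i) (q i j).ne_zero

lemma lInv_e (i j : Fin n) :
    gen q (.lInv i) * gen q (.e j) = (q j i : 𝕜) • (gen q (.e j) * gen q (.lInv i)) := by
  simpa using inv_comm_of_conj (l_e (q := q) i j) (lInv_l i) (l_lInv i)
    (inv_ne_zero (q j i).ne_zero)

lemma kInv_f (i j : Fin n) :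
    gen q (.kInv i) * gen q (.f j) = (q i j : 𝕜) • (gen q (.f j) * gen q (.kInv i)) := by
  simpa using inv_comm_of_conj (k_f (q := q) i j) (kInv_k i) (k_kInv i)
    (inv_ne_zero (q i j).ne_zero)

lemma lInv_f (i j : Fin n) :
    gen q (.lInv i) * gen q (.f j) = (q j i : 𝕜)⁻¹ • (gen q (.f j) * gen q (.lInv i)) :=
  inv_comm_of_conj (l_f i j) (lInv_l i) (l_lInv i) (q j i).ne_zero

private lemma commute_inv {A : Type*} [Monoid A] {g g' x : A} (h : Commute g x) (hg : g' * g = 1)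
    (hg' : g * g' = 1) : Commute g' x := by
  change g' * x = x * g'
  calc g' * x = g' * (x * g) * g' := by rw [mul_assoc, mul_assoc, hg', mul_one]
    _ = g' * g * x * g' := by rw [← h.eq]; simp only [mul_assoc]
    _ = x * g' := by rw [hg, one_mul]

lemma kInv_commute {i : Fin n} {x : PreAlg q} (h : Commute (gen q (.k i)) x) :
    Commute (gen q (.kInv i)) x := commute_inv h (kInv_k i) (k_kInv i)

lemma lInv_commute {i : Fin n} {x : PreAlg q} (h : Commute (gen q (.l i)) x) :
    Commute (gen q (.lInv i)) x := commute_inv h (lInv_l i) (l_lInv i)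

end Relations

/-- The coproduct on the generators. -/
def comulGen : Gen n → PreAlg q ⊗[𝕜] PreAlg q
  | .e i => gen q (.e i) ⊗ₜ 1 + gen q (.k i) ⊗ₜ gen q (.e i)
  | .f i => gen q (.f i) ⊗ₜ gen q (.l i) + 1 ⊗ₜ gen q (.f i)
  | .k i => gen q (.k i) ⊗ₜ gen q (.k i)
  | .kInv i => gen q (.kInv i) ⊗ₜ gen q (.kInv i)
  | .l i => gen q (.l i) ⊗ₜ gen q (.l i)
  | .lInv i => gen q (.lInv i) ⊗ₜ gen q (.lInv i)

/-- The counit on the generators. -/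
def counitGen : Gen n → 𝕜
  | .e _ => 0
  | .f _ => 0
  | .k _ => 1
  | .kInv _ => 1
  | .l _ => 1
  | .lInv _ => 1

/-- The antipode on the generators. -/
def antipodeGen : Gen n → PreAlg q
  | .e i => -(gen q (.kInv i) * gen q (.e i))
  | .f i => -(gen q (.f i) * gen q (.lInv i))
  | .k i => gen q (.kInv i)
  | .kInv i => gen q (.k i)
  | .l i => gen q (.lInv i)
  | .lInv i => gen q (.l i)

/-- The coproduct of `PreAlg q`. -/
def comulHom : PreAlg q →ₐ[𝕜] PreAlg q ⊗[𝕜] PreAlg q :=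
  lift (comulGen q) (by
    intro x y h
    induction h with
    | k_kInv i => simp [comulGen, Algebra.TensorProduct.one_def]
    | kInv_k i => simp [comulGen, Algebra.TensorProduct.one_def]
    | l_lInv i => simp [comulGen, Algebra.TensorProduct.one_def]
    | lInv_l i => simp [comulGen, Algebra.TensorProduct.one_def]
    | k_l i j => simp [comulGen, k_l i j]
    | k_k i j => simp [comulGen, k_k i j]
    | l_l i j => simp [comulGen, l_l i j]
    | k_e i j =>
        have : gen q (.k i) * gen q (.k j) * gen q (.kInv i) = gen q (.k j) := by
          rw [k_k, mul_assoc, k_kInv, mul_one]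
        simp [comulGen, mul_add, add_mul, k_e' i j, this, TensorProduct.smul_tmul']
    | l_e i j =>
        have : gen q (.l i) * gen q (.k j) * gen q (.lInv i) = gen q (.k j) := by
          rw [← k_l, mul_assoc, l_lInv, mul_one]
        simp [comulGen, mul_add, add_mul, l_e' i j, this, TensorProduct.smul_tmul']
    | k_f i j =>
        have : gen q (.k i) * gen q (.l j) * gen q (.kInv i) = gen q (.l j) := by
          rw [k_l, mul_assoc, k_kInv, mul_one]
        simp [comulGen, mul_add, add_mul, k_f' i j, this, TensorProduct.smul_tmul']
    | l_f i j =>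
        have : gen q (.l i) * gen q (.l j) * gen q (.lInv i) = gen q (.l j) := by
          rw [l_l, mul_assoc, l_lInv, mul_one]
        simp [comulGen, mul_add, add_mul, l_f' i j, this, TensorProduct.smul_tmul']
    | e_f i j =>
        have h1 : (gen q (.k i) * gen q (.f j)) ⊗ₜ[𝕜] (gen q (.e i) * gen q (.l j)) =
            (gen q (.f j) * gen q (.k i)) ⊗ₜ[𝕜] (gen q (.l j) * gen q (.e i)) := by
          rw [k_f, l_e, TensorProduct.tmul_smul, TensorProduct.smul_tmul']
        have h2 : FreeAlgebra.lift 𝕜 (comulGen q) (.ι 𝕜 (.e i) * .ι 𝕜 (.f j) -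
            .ι 𝕜 (.f j) * .ι 𝕜 (.e i)) =
            (gen q (.e i) * gen q (.f j) - gen q (.f j) * gen q (.e i)) ⊗ₜ[𝕜] gen q (.l j) +
            gen q (.k i) ⊗ₜ[𝕜] (gen q (.e i) * gen q (.f j) - gen q (.f j) * gen q (.e i)) := by
          simp only [map_sub, map_mul, FreeAlgebra.lift_ι_apply, comulGen, mul_add, add_mul,
            Algebra.TensorProduct.tmul_mul_tmul, mul_one, one_mul, h1, TensorProduct.sub_tmul,
            TensorProduct.tmul_sub]
          abel
        rw [h2, e_f]
        split_ifs with hij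
        · subst hij
          simp only [map_smul, map_sub, FreeAlgebra.lift_ι_apply, comulGen,
            ← TensorProduct.smul_tmul', TensorProduct.tmul_smul, ← smul_add,
            TensorProduct.sub_tmul, TensorProduct.tmul_sub]
          congr 1
          abel
        · simp)

/-- The counit of `PreAlg q`. -/
def counitHom : PreAlg q →ₐ[𝕜] 𝕜 :=
  lift counitGen (by
    intro x y h
    induction h with
    | e_f i j => split_ifs <;> simp [counitGen]
    | _ => simp [counitGen])

/-- The antipode of `PreAlg q`, as an algebra map to the opposite algebra. -/
def antipodeHom : PreAlg q →ₐ[𝕜] (PreAlg q)ᵐᵒᵖ :=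
  lift (fun g ↦ MulOpposite.op (antipodeGen q g)) (by
    intro x y h
    induction h with
    | k_kInv i => simp [antipodeGen, ← MulOpposite.op_mul]
    | kInv_k i => simp [antipodeGen, ← MulOpposite.op_mul]
    | l_lInv i => simp [antipodeGen, ← MulOpposite.op_mul]
    | lInv_l i => simp [antipodeGen, ← MulOpposite.op_mul]
    | k_l i j =>
        have : Commute (gen q (.kInv i)) (gen q (.lInv j)) :=
          kInv_commute (lInv_commute (k_l i j).symm).symm
        simp [antipodeGen, ← MulOpposite.op_mul, this.eq]
    | k_k i j =>
        have : Commute (gen q (.kInv i)) (gen q (.kInv j)) :=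
          kInv_commute (kInv_commute (k_k i j).symm).symm
        simp [antipodeGen, ← MulOpposite.op_mul, this.eq]
    | l_l i j =>
        have : Commute (gen q (.lInv i)) (gen q (.lInv j)) :=
          lInv_commute (lInv_commute (l_l i j).symm).symm
        simp [antipodeGen, ← MulOpposite.op_mul, this.eq]
    | k_e i j =>
        have h1 : Commute (gen q (.k i)) (gen q (.kInv j)) := (kInv_commute (k_k j i)).symm
        have h2 : gen q (.k i) * (gen q (.kInv j) * (gen q (.e j) * gen q (.kInv i))) =
            (q i j : 𝕜) • (gen q (.kInv j) * gen q (.e j)) := by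
          rw [← mul_assoc, h1.eq, mul_assoc, ← mul_assoc (gen q (.k i)), k_e', mul_smul_comm]
        apply MulOpposite.unop_injective
        simp [antipodeGen, h2, mul_assoc]
    | l_e i j =>
        have h1 : Commute (gen q (.l i)) (gen q (.kInv j)) := (kInv_commute (k_l j i)).symm
        have h2 : gen q (.l i) * (gen q (.kInv j) * (gen q (.e j) * gen q (.lInv i))) =
            (q j i : 𝕜)⁻¹ • (gen q (.kInv j) * gen q (.e j)) := by
          rw [← mul_assoc, h1.eq, mul_assoc, ← mul_assoc (gen q (.l i)), l_e', mul_smul_comm]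
        apply MulOpposite.unop_injective
        simp [antipodeGen, h2, mul_assoc]
    | k_f i j =>
        have h1 : Commute (gen q (.lInv j)) (gen q (.kInv i)) :=
          lInv_commute (kInv_commute (k_l i j)).symm
        have h2 : gen q (.k i) * (gen q (.f j) * (gen q (.lInv j) * gen q (.kInv i))) =
            (q i j : 𝕜)⁻¹ • (gen q (.f j) * gen q (.lInv j)) := by
          rw [h1.eq, ← mul_assoc (gen q (.f j)), ← mul_assoc, ← mul_assoc, k_f', smul_mul_assoc]
        apply MulOpposite.unop_injective
        simp [antipodeGen, h2, mul_assoc]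
    | l_f i j =>
        have h1 : Commute (gen q (.lInv j)) (gen q (.lInv i)) :=
          lInv_commute (lInv_commute (l_l i j)).symm
        have h2 : gen q (.l i) * (gen q (.f j) * (gen q (.lInv j) * gen q (.lInv i))) =
            (q j i : 𝕜) • (gen q (.f j) * gen q (.lInv j)) := by
          rw [h1.eq, ← mul_assoc (gen q (.f j)), ← mul_assoc, ← mul_assoc, l_f', smul_mul_assoc]
        apply MulOpposite.unop_injective
        simp [antipodeGen, h2, mul_assoc]
    | e_f i j =>
        have h1 : Commute (gen q (.kInv i)) (gen q (.lInv j)) :=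
          kInv_commute (lInv_commute (k_l i j).symm).symm
        have h2 : gen q (.f j) * gen q (.lInv j) * (gen q (.kInv i) * gen q (.e i)) =
            gen q (.kInv i) * (gen q (.f j) * gen q (.e i)) * gen q (.lInv j) := by
          have h3 : gen q (.f j) * gen q (.kInv i) =
              (q i j : 𝕜)⁻¹ • (gen q (.kInv i) * gen q (.f j)) := by
            rw [kInv_f, smul_smul, inv_mul_cancel₀ (q i j).ne_zero, one_smul]
          calc gen q (.f j) * gen q (.lInv j) * (gen q (.kInv i) * gen q (.e i))
              = gen q (.f j) * (gen q (.kInv i) * gen q (.lInv j)) * gen q (.e i) := by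
                rw [h1.eq]; simp only [mul_assoc]
            _ = gen q (.f j) * gen q (.kInv i) * (gen q (.lInv j) * gen q (.e i)) := by
                simp only [mul_assoc]
            _ = gen q (.kInv i) * (gen q (.f j) * gen q (.e i)) * gen q (.lInv j) := by
                rw [h3, lInv_e, smul_mul_smul_comm, inv_mul_cancel₀ (q i j).ne_zero, one_smul]
                simp only [mul_assoc]
        have h4 : gen q (.f j) * gen q (.lInv j) * (gen q (.kInv i) * gen q (.e i)) -
            gen q (.kInv i) * gen q (.e i) * (gen q (.f j) * gen q (.lInv j)) =
            -(gen q (.kInv i) * (gen q (.e i) * gen q (.f j) - gen q (.f j) * gen q (.e i)) *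
              gen q (.lInv j)) := by
          rw [h2, mul_sub, sub_mul, neg_sub]
          simp only [mul_assoc]
        rw [e_f] at h4
        apply MulOpposite.unop_injective
        split_ifs at h4 ⊢ with hij
        · subst hij
          have h5 : gen q (.kInv i) * (gen q (.k i) - gen q (.l i)) * gen q (.lInv i) =
              gen q (.lInv i) - gen q (.kInv i) := by
            rw [mul_sub, kInv_k, sub_mul, one_mul, mul_assoc, l_lInv, mul_one]
          rw [mul_smul_comm, smul_mul_assoc, h5, ← smul_neg, neg_sub] at h4
          simpa [antipodeGen] using h4
        · simpa [antipodeGen] using h4)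

lemma comulHom_gen (g : Gen n) : comulHom q (gen q g) = comulGen q g := lift_gen _ _ g

lemma counitHom_gen (g : Gen n) : counitHom q (gen q g) = counitGen g := lift_gen _ _ g

lemma comulHom_assoc :
    (Algebra.TensorProduct.assoc 𝕜 𝕜 𝕜 (PreAlg q) (PreAlg q) (PreAlg q)).toAlgHom.comp
      ((Algebra.TensorProduct.map (comulHom q) (.id 𝕜 (PreAlg q))).comp (comulHom q)) =
    (Algebra.TensorProduct.map (.id 𝕜 (PreAlg q)) (comulHom q)).comp (comulHom q) := by
  refine hom_ext (q := q) fun g ↦ ?_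
  cases g <;> simp [comulHom_gen, comulGen, TensorProduct.add_tmul, TensorProduct.tmul_add,
    Algebra.TensorProduct.one_def, add_assoc]

lemma counitHom_left :
    (Algebra.TensorProduct.map (counitHom q) (.id 𝕜 (PreAlg q))).comp (comulHom q) =
      (Algebra.TensorProduct.lid 𝕜 (PreAlg q)).symm := by
  refine hom_ext (q := q) fun g ↦ ?_
  cases g <;> simp [comulHom_gen, counitHom_gen, counitGen, comulGen]

lemma counitHom_right :
    (Algebra.TensorProduct.map (.id 𝕜 (PreAlg q)) (counitHom q)).comp (comulHom q) =
      (Algebra.TensorProduct.rid 𝕜 𝕜 (PreAlg q)).symm := by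
  refine hom_ext (q := q) fun g ↦ ?_
  cases g <;> simp [comulHom_gen, counitHom_gen, counitGen, comulGen]

instance : Bialgebra 𝕜 (PreAlg q) :=
  .ofAlgHom (comulHom q) (counitHom q) (comulHom_assoc q) (counitHom_left q) (counitHom_right q)

lemma comul_gen (g : Gen n) : Coalgebra.comul (R := 𝕜) (gen q g) = comulGen q g :=
  lift_gen _ _ g

lemma counit_gen (g : Gen n) : Coalgebra.counit (R := 𝕜) (gen q g) = counitGen g :=
  lift_gen _ _ g

/-- The antipode of `PreAlg q`. -/
def antipodeLin : PreAlg q →ₗ[𝕜] PreAlg q :=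
  (MulOpposite.opLinearEquiv 𝕜).symm.toLinearMap ∘ₗ (antipodeHom q).toLinearMap

lemma antipodeLin_gen (g : Gen n) : antipodeLin q (gen q g) = antipodeGen q g := by
  simp [antipodeLin, antipodeHom]

lemma antipodeLin_mul (a b : PreAlg q) :
    antipodeLin q (a * b) = antipodeLin q b * antipodeLin q a := by
  simp [antipodeLin]

lemma antipodeLin_algebraMap (r : 𝕜) :
    antipodeLin q (algebraMap 𝕜 (PreAlg q) r) = algebraMap 𝕜 (PreAlg q) r := by
  simp [antipodeLin]

private lemma rTensor_mul (t : PreAlg q ⊗[𝕜] PreAlg q) {r : 𝕜} (u : PreAlg q ⊗[𝕜] PreAlg q)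
    (ht : LinearMap.mul' 𝕜 _ ((antipodeLin q).rTensor _ t) = algebraMap 𝕜 _ r) :
    LinearMap.mul' 𝕜 _ ((antipodeLin q).rTensor _ (t * u)) =
      algebraMap 𝕜 _ r * LinearMap.mul' 𝕜 _ ((antipodeLin q).rTensor _ u) := by
  induction u with
  | zero => simp
  | add u v hu hv => simp only [mul_add, map_add, hu, hv]
  | tmul x y =>
      have key : ∀ t : PreAlg q ⊗[𝕜] PreAlg q,
          LinearMap.mul' 𝕜 _ ((antipodeLin q).rTensor _ (t * x ⊗ₜ y)) =
            antipodeLin q x * LinearMap.mul' 𝕜 _ ((antipodeLin q).rTensor _ t) * y := by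
        intro t
        induction t with
        | zero => simp
        | add u v hu hv => simp only [add_mul, mul_add, map_add, hu, hv]
        | tmul a b => simp [antipodeLin_mul, mul_assoc]
      rw [key, ht, ← Algebra.commutes]
      simp [mul_assoc]

private lemma lTensor_mul (t : PreAlg q ⊗[𝕜] PreAlg q) {r : 𝕜} (u : PreAlg q ⊗[𝕜] PreAlg q)
    (hu : LinearMap.mul' 𝕜 _ ((antipodeLin q).lTensor _ u) = algebraMap 𝕜 _ r) :
    LinearMap.mul' 𝕜 _ ((antipodeLin q).lTensor _ (t * u)) =
      LinearMap.mul' 𝕜 _ ((antipodeLin q).lTensor _ t) * algebraMap 𝕜 _ r := by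
  induction t with
  | zero => simp
  | add u v hu hv => simp only [add_mul, map_add, hu, hv]
  | tmul x y =>
      have key : ∀ u : PreAlg q ⊗[𝕜] PreAlg q,
          LinearMap.mul' 𝕜 _ ((antipodeLin q).lTensor _ (x ⊗ₜ y * u)) =
            x * LinearMap.mul' 𝕜 _ ((antipodeLin q).lTensor _ u) * antipodeLin q y := by
        intro u
        induction u with
        | zero => simp
        | add u v hu hv => simp only [add_mul, mul_add, map_add, hu, hv]
        | tmul a b => simp [antipodeLin_mul, mul_assoc]
      rw [key, hu, mul_assoc, Algebra.commutes]
      simp [mul_assoc]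

lemma antipode_left (a : PreAlg q) :
    LinearMap.mul' 𝕜 _ ((antipodeLin q).rTensor _ (Coalgebra.comul a)) =
      algebraMap 𝕜 _ (Coalgebra.counit (R := 𝕜) a) := by
  induction a using PreAlg.induction with
  | algebraMap r =>
      simp only [Bialgebra.comul_algebraMap, Bialgebra.counit_algebraMap,
        Algebra.TensorProduct.algebraMap_apply, LinearMap.rTensor_tmul, LinearMap.mul'_apply,
        antipodeLin_algebraMap, mul_one]
  | gen g =>
      rw [comul_gen, counit_gen]
      cases g <;> simp [comulGen, counitGen, antipodeLin_gen, antipodeGen,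
        ← map_one (algebraMap 𝕜 (PreAlg q)), antipodeLin_algebraMap, -map_one]
      all_goals simp [mul_assoc]
  | mul a b ha hb =>
      rw [Bialgebra.comul_mul, rTensor_mul q _ _ ha, hb, Bialgebra.counit_mul, map_mul]
  | add a b ha hb => simp only [map_add, ha, hb]

lemma antipode_right (a : PreAlg q) :
    LinearMap.mul' 𝕜 _ ((antipodeLin q).lTensor _ (Coalgebra.comul a)) =
      algebraMap 𝕜 _ (Coalgebra.counit (R := 𝕜) a) := by
  induction a using PreAlg.induction with
  | algebraMap r =>
      have h1 : antipodeLin q 1 = 1 := by simpa using antipodeLin_algebraMap q 1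
      simp only [Bialgebra.comul_algebraMap, Bialgebra.counit_algebraMap,
        Algebra.TensorProduct.algebraMap_apply, LinearMap.lTensor_tmul, LinearMap.mul'_apply,
        h1, mul_one]
  | gen g =>
      have h1 : antipodeLin q 1 = 1 := by simpa using antipodeLin_algebraMap q 1
      rw [comul_gen, counit_gen]
      cases g <;> simp [comulGen, counitGen, antipodeLin_gen, antipodeGen, h1, ← mul_assoc]
  | mul a b ha hb =>
      rw [Bialgebra.comul_mul, lTensor_mul q _ _ hb, ha, Bialgebra.counit_mul, map_mul]
  | add a b ha hb => simp only [map_add, ha, hb]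

instance : HopfAlgebra 𝕜 (PreAlg q) where
  antipode := antipodeLin q
  mul_antipode_rTensor_comul := LinearMap.ext (antipode_left q)
  mul_antipode_lTensor_comul := LinearMap.ext (antipode_right q)

end PreAlg

end PreAlg

section QSerreTensor

variable {𝕜 : Type*} [Field 𝕜] {B : Type*} [Ring B] [Algebra 𝕜 B]

lemma qSerre_tmul_left {g h x y : B} (hgh : g * h = h * g) (q c : 𝕜) (m : ℕ) :
    qSerre q c m (g ⊗ₜ[𝕜] x) (h ⊗ₜ[𝕜] y) = (g ^ m * h) ⊗ₜ[𝕜] qSerre q c m x y := by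
  induction m with
  | zero => simp [qSerre_zero]
  | succ m ih =>
      have h1 : g ^ m * h * g = g ^ (m + 1) * h := by rw [mul_assoc, ← hgh, pow_succ, mul_assoc]
      rw [qSerre_succ, ih, qSerre_succ, Algebra.TensorProduct.tmul_mul_tmul,
        Algebra.TensorProduct.tmul_mul_tmul, h1, ← mul_assoc, ← pow_succ', TensorProduct.tmul_sub,
        TensorProduct.tmul_smul]

lemma qSerre_tmul_right {g h x y : B} (hgh : g * h = h * g) (q c : 𝕜) (m : ℕ) :
    qSerre q c m (x ⊗ₜ[𝕜] g) (y ⊗ₜ[𝕜] h) = qSerre q c m x y ⊗ₜ[𝕜] (g ^ m * h) := by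
  induction m with
  | zero => simp [qSerre_zero]
  | succ m ih =>
      have h1 : g ^ m * h * g = g ^ (m + 1) * h := by rw [mul_assoc, ← hgh, pow_succ, mul_assoc]
      rw [qSerre_succ, ih, qSerre_succ, Algebra.TensorProduct.tmul_mul_tmul,
        Algebra.TensorProduct.tmul_mul_tmul, h1, ← mul_assoc, ← pow_succ', TensorProduct.sub_tmul,
        TensorProduct.smul_tmul']

lemma qSerre_descend (J : TwoSidedIdeal B) {x y f g h h' : B} {q c c' κ : 𝕜} (hq : q ≠ 0)
    (hc' : c' ≠ 0) (hκ : κ ≠ 0) (hx : x * f - f * x = κ • (g - h)) (hy : y * f = f * y)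
    (hgx : g * x = q • (x * g)) (hgy : g * y = c • (y * g)) (hhx : h * x = q⁻¹ • (x * h))
    (hhy : h * y = c'⁻¹ • (y * h)) (hh : h * h' = 1) (m : ℕ)
    (hm : ∀ k, 1 ≤ k → k ≤ m → q ^ k ≠ 1) (hJ : qSerre q c m x y ∈ J) (k : ℕ) (hk : k ≤ m) :
    (∏ s ∈ Finset.Ico k m, (1 - q ^ s * (c * c'))) • qSerre q c k x y ∈ J := by
  have hsmul : ∀ (r : 𝕜) {z : B}, z ∈ J → r • z ∈ J := fun r z hz ↦ by
    rw [Algebra.smul_def]; exact J.mul_mem_left _ _ hz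
  induction hd : m - k generalizing k with
  | zero =>
      obtain rfl : k = m := by omega
      simpa using hJ
  | succ d ih =>
      have h1 := ih (k + 1) (by omega) (by omega)
      have h2 := J.sub_mem (J.mul_mem_right _ f h1) (J.mul_mem_left f _ h1)
      rw [smul_mul_assoc, mul_smul_comm, ← smul_sub,
        qSerre_comm hq hc' hx hy hgx hgy hhx hhy k] at h2
      have h3 := J.mul_mem_right _ h' h2
      rw [smul_mul_assoc, smul_mul_assoc, mul_assoc (qSerre q c k x y), hh, mul_one, smul_smul] at h3
      have hs : (∑ s ∈ Finset.range (k + 1), q ^ s) ≠ 0 := by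
        intro h0
        have := geom_sum_mul q (k + 1)
        rw [h0, zero_mul] at this
        exact hm (k + 1) (by omega) (by omega) (sub_eq_zero.mp this.symm)
      have h4 := hsmul (-(κ * c'⁻¹ * q⁻¹ ^ k * ∑ s ∈ Finset.range (k + 1), q ^ s))⁻¹ h3
      rw [smul_smul] at h4
      rw [Finset.prod_eq_prod_Ico_succ_bot (by omega)]
      convert h4 using 2
      rw [inv_pow]
      field_simp

end QSerreTensor

section MpQUEA

variable {𝕜 : Type*} [Field 𝕜] {n : ℕ}

/-- A multiparameter matrix `q` over `𝕜` compatible with the integral matrix `A`: its entries are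
nonzero and `q_{ii}^k ≠ 1` for `k = 1, …, max (1 - a_{ij}) 2`. -/
structure Multiparameter (𝕜 : Type*) [Field 𝕜] {n : ℕ} (A : Matrix (Fin n) (Fin n) ℤ) where
  /-- The entries. -/
  val : Fin n → Fin n → 𝕜ˣ
  pow_ne_one : ∀ (i j : Fin n) (k : ℕ), 1 ≤ k → (k : ℤ) ≤ max (1 - A i j) 2 → val i i ^ k ≠ 1

variable {A : Matrix (Fin n) (Fin n) ℤ}

namespace Multiparameter

lemma coe_pow_ne_one (q : Multiparameter 𝕜 A) (i j : Fin n) (k : ℕ) (hk : 1 ≤ k)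
    (hk' : k ≤ (1 - A i j).toNat) : (q.val i i : 𝕜) ^ k ≠ 1 := by
  intro h
  refine q.pow_ne_one i j k hk (by omega) (Units.ext ?_)
  simpa using h

lemma coe_ne_one (q : Multiparameter 𝕜 A) (i : Fin n) : (q.val i i : 𝕜) ≠ 1 := by
  intro h
  refine q.pow_ne_one i i 1 le_rfl ?_ (Units.ext ?_)
  · exact le_trans (by norm_num) (le_max_right _ _)
  · simpa using h

end Multiparameter

namespace MpQUEA

open PreAlg

/-- The quantum Serre element in the `E`'s. -/
def serreE (q : Multiparameter 𝕜 A) (i j : Fin n) : PreAlg q.val :=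
  qSerre (q.val i i : 𝕜) (q.val i j : 𝕜) (1 - A i j).toNat (gen _ (.e i)) (gen _ (.e j))

/-- The quantum Serre element in the `F`'s. -/
def serreF (q : Multiparameter 𝕜 A) (i j : Fin n) : PreAlg q.val :=
  qSerre (q.val i i : 𝕜) (q.val j i : 𝕜) (1 - A i j).toNat (gen _ (.f i)) (gen _ (.f j))

/-- The two-sided ideal generated by the quantum Serre elements. -/
def serreIdeal (q : Multiparameter 𝕜 A) : TwoSidedIdeal (PreAlg q.val) :=
  TwoSidedIdeal.span {x | ∃ i j, i ≠ j ∧ (x = serreE q i j ∨ x = serreF q i j)}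

section HopfIdeal

variable (q : Multiparameter 𝕜 A) {i j : Fin n}

private lemma kappa_ne_zero (i : Fin n) :
    (q.val i i : 𝕜) / ((q.val i i : 𝕜) - 1) ≠ 0 :=
  div_ne_zero (q.val i i).ne_zero (sub_ne_zero.mpr (q.coe_ne_one i))

lemma serreE_mem (hij : i ≠ j) : serreE q i j ∈ serreIdeal q :=
  TwoSidedIdeal.subset_span ⟨i, j, hij, .inl rfl⟩

lemma serreF_mem (hij : i ≠ j) : serreF q i j ∈ serreIdeal q :=
  TwoSidedIdeal.subset_span ⟨i, j, hij, .inr rfl⟩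

lemma serreE_descend (hij : i ≠ j) (k : ℕ) (hk : k ≤ (1 - A i j).toNat) :
    (∏ s ∈ Finset.Ico k (1 - A i j).toNat,
      (1 - (q.val i i : 𝕜) ^ s * ((q.val i j : 𝕜) * (q.val j i : 𝕜)))) •
      qSerre (q.val i i : 𝕜) (q.val i j : 𝕜) k (gen q.val (.e i)) (gen q.val (.e j)) ∈
        serreIdeal q := by
  refine qSerre_descend (serreIdeal q) (f := gen q.val (.f i)) (g := gen q.val (.k i))
    (h := gen q.val (.l i)) (h' := gen q.val (.lInv i)) (q.val i i).ne_zero (q.val j i).ne_zero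
    (kappa_ne_zero q i) ?_ ?_ (k_e i i) (k_e i j) (l_e i i) (l_e i j) (l_lInv i) _
    (fun k ↦ q.coe_pow_ne_one i j k) (serreE_mem q hij) k hk
  · rw [e_f, if_pos rfl]
  · rw [← sub_eq_zero, e_f, if_neg hij.symm]

lemma serreF_descend (hij : i ≠ j) (k : ℕ) (hk : k ≤ (1 - A i j).toNat) :
    (∏ s ∈ Finset.Ico k (1 - A i j).toNat,
      (1 - (q.val i i : 𝕜) ^ s * ((q.val j i : 𝕜) * (q.val i j : 𝕜)))) •
      qSerre (q.val i i : 𝕜) (q.val j i : 𝕜) k (gen q.val (.f i)) (gen q.val (.f j)) ∈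
        serreIdeal q := by
  refine qSerre_descend (serreIdeal q) (f := gen q.val (.e i)) (g := gen q.val (.l i))
    (h := gen q.val (.k i)) (h' := gen q.val (.kInv i)) (q.val i i).ne_zero (q.val i j).ne_zero
    (kappa_ne_zero q i) ?_ ?_ (l_f i i) (l_f i j) (k_f i i) (k_f i j) (k_kInv i) _
    (fun k ↦ q.coe_pow_ne_one i j k) (serreF_mem q hij) k hk
  · rw [← neg_sub, e_f, if_pos rfl, ← smul_neg, neg_sub]
  · rw [eq_comm, ← sub_eq_zero, e_f, if_neg hij]

private lemma coeff_smul_mem {J : TwoSidedIdeal (PreAlg q.val)} {r s : 𝕜} {x : PreAlg q.val}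
    (h : s • x ∈ J) : (r * s) • x ∈ J := by
  rw [mul_smul, Algebra.smul_def]
  exact J.mul_mem_left _ _ h

lemma comul_serreE (hij : i ≠ j) : ∃ (a : ℕ → PreAlg q.val) (u : ℕ → PreAlg q.val),
    (∀ k ∈ Finset.range ((1 - A i j).toNat + 1), u k ∈ serreIdeal q) ∧
    Coalgebra.comul (R := 𝕜) (serreE q i j) = serreE q i j ⊗ₜ 1 +
      ∑ k ∈ Finset.range ((1 - A i j).toNat + 1), a k ⊗ₜ u k := by
  set m := (1 - A i j).toNat with hm
  refine ⟨fun k ↦ gen _ (.e i) ^ (m - k) * (gen _ (.k i) ^ k * gen _ (.k j)),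
    fun k ↦ (gaussBinom (q.val i i : 𝕜) m k * ∏ s ∈ Finset.Ico k m,
      (1 - (q.val i i : 𝕜) ^ s * ((q.val i j : 𝕜) * (q.val j i : 𝕜)))) •
      qSerre (q.val i i : 𝕜) (q.val i j : 𝕜) k (gen q.val (.e i)) (gen q.val (.e j)),
    fun k hk ↦ coeff_smul_mem q (serreE_descend q hij k (by
      rw [Finset.mem_range] at hk; omega)), ?_⟩
  rw [serreE, ← Bialgebra.comulAlgHom_apply, map_qSerre, Bialgebra.comulAlgHom_apply,
    Bialgebra.comulAlgHom_apply, comul_gen, comul_gen, comulGen, comulGen, ← hm,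
    qSerre_add (c' := (q.val j i : 𝕜))]
  · congr 1
    · exact (map_qSerre (Algebra.TensorProduct.includeLeft :
        PreAlg q.val →ₐ[𝕜] PreAlg q.val ⊗[𝕜] PreAlg q.val) _ _ _ _ _).symm
    · refine Finset.sum_congr rfl fun k _ ↦ ?_
      rw [qSerre_tmul_left (k_k i j), Algebra.TensorProduct.tmul_pow,
        Algebra.TensorProduct.tmul_mul_tmul, one_pow, one_mul, TensorProduct.tmul_smul]
  · simp [k_e, TensorProduct.smul_tmul']
  · simp [k_e, TensorProduct.smul_tmul']
  · simp [k_e, TensorProduct.smul_tmul']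

lemma comul_serreF (hij : i ≠ j) : ∃ (a : ℕ → PreAlg q.val) (u : ℕ → PreAlg q.val),
    (∀ k ∈ Finset.range ((1 - A i j).toNat + 1), u k ∈ serreIdeal q) ∧
    Coalgebra.comul (R := 𝕜) (serreF q i j) = 1 ⊗ₜ serreF q i j +
      ∑ k ∈ Finset.range ((1 - A i j).toNat + 1), u k ⊗ₜ a k := by
  set m := (1 - A i j).toNat with hm
  refine ⟨fun k ↦ gen _ (.f i) ^ (m - k) * (gen _ (.l i) ^ k * gen _ (.l j)),
    fun k ↦ (gaussBinom (q.val i i : 𝕜) m k * ∏ s ∈ Finset.Ico k m,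
      (1 - (q.val i i : 𝕜) ^ s * ((q.val j i : 𝕜) * (q.val i j : 𝕜)))) •
      qSerre (q.val i i : 𝕜) (q.val j i : 𝕜) k (gen q.val (.f i)) (gen q.val (.f j)),
    fun k hk ↦ coeff_smul_mem q (serreF_descend q hij k (by
      rw [Finset.mem_range] at hk; omega)), ?_⟩
  rw [serreF, ← Bialgebra.comulAlgHom_apply, map_qSerre, Bialgebra.comulAlgHom_apply,
    Bialgebra.comulAlgHom_apply, comul_gen, comul_gen, comulGen, comulGen, ← hm,
    add_comm (_ ⊗ₜ _), add_comm (gen q.val (.f j) ⊗ₜ _), qSerre_add (c' := (q.val i j : 𝕜))]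
  · congr 1
    · exact (map_qSerre (Algebra.TensorProduct.includeRight :
        PreAlg q.val →ₐ[𝕜] PreAlg q.val ⊗[𝕜] PreAlg q.val) _ _ _ _ _).symm
    · refine Finset.sum_congr rfl fun k _ ↦ ?_
      rw [qSerre_tmul_right (l_l i j), Algebra.TensorProduct.tmul_pow,
        Algebra.TensorProduct.tmul_mul_tmul, one_pow, one_mul, TensorProduct.smul_tmul']
  · simp [l_f]
  · simp [l_f]
  · simp [l_f]

lemma counit_serreE : Coalgebra.counit (R := 𝕜) (serreE q i j) = 0 := by
  rw [serreE, ← Bialgebra.counitAlgHom_apply, map_qSerre, Bialgebra.counitAlgHom_apply,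
    Bialgebra.counitAlgHom_apply, counit_gen, counit_gen]
  simp [qSerre, counitGen]

lemma counit_serreF : Coalgebra.counit (R := 𝕜) (serreF q i j) = 0 := by
  rw [serreF, ← Bialgebra.counitAlgHom_apply, map_qSerre, Bialgebra.counitAlgHom_apply,
    Bialgebra.counitAlgHom_apply, counit_gen, counit_gen]
  simp [qSerre, counitGen]

lemma antipode_serreE (hij : i ≠ j) :
    HopfAlgebra.antipode 𝕜 (serreE q i j) ∈ serreIdeal q := by
  obtain ⟨a, u, hu, h⟩ := comul_serreE q hij
  have h1 := HopfAlgebra.mul_antipode_rTensor_comul_apply (R := 𝕜) (serreE q i j)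
  rw [h, counit_serreE, map_zero] at h1
  simp only [map_add, map_sum, LinearMap.rTensor_tmul, LinearMap.mul'_apply, mul_one] at h1
  rw [eq_neg_of_add_eq_zero_left h1]
  exact (serreIdeal q).neg_mem (sum_mem fun k hk ↦
    (serreIdeal q).mul_mem_left _ _ (hu k hk))

lemma antipode_serreF (hij : i ≠ j) :
    HopfAlgebra.antipode 𝕜 (serreF q i j) ∈ serreIdeal q := by
  obtain ⟨a, u, hu, h⟩ := comul_serreF q hij
  have h1 := HopfAlgebra.mul_antipode_lTensor_comul_apply (R := 𝕜) (serreF q i j)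
  rw [h, counit_serreF, map_zero] at h1
  simp only [map_add, map_sum, LinearMap.lTensor_tmul, LinearMap.mul'_apply, one_mul] at h1
  rw [eq_neg_of_add_eq_zero_left h1]
  exact (serreIdeal q).neg_mem (sum_mem fun k hk ↦
    (serreIdeal q).mul_mem_right _ _ (hu k hk))

private lemma le_ker {B : Type*} [Ring B] [Algebra 𝕜 B] (φ : PreAlg q.val →ₐ[𝕜] B)
    (hE : ∀ i j, i ≠ j → φ (serreE q i j) = 0) (hF : ∀ i j, i ≠ j → φ (serreF q i j) = 0)
    {x : PreAlg q.val} (hx : x ∈ serreIdeal q) : φ x = 0 := by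
  have : serreIdeal q ≤ TwoSidedIdeal.ker φ := by
    refine TwoSidedIdeal.span_le.mpr ?_
    rintro _ ⟨i, j, hij, rfl | rfl⟩
    · exact (TwoSidedIdeal.mem_ker _).mpr (hE i j hij)
    · exact (TwoSidedIdeal.mem_ker _).mpr (hF i j hij)
  exact (TwoSidedIdeal.mem_ker _).mp (this hx)

private lemma mkA_eq_zero {x : PreAlg q.val} (hx : x ∈ serreIdeal q) :
    Ideal.Quotient.mkₐ 𝕜 (serreIdeal q).asIdeal x = 0 :=
  Ideal.Quotient.eq_zero_iff_mem.mpr (TwoSidedIdeal.mem_asIdeal.mpr hx)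

instance : (serreIdeal q).asIdeal.IsHopfIdeal 𝕜 where
  counit_eq_zero := fun x hx ↦
    le_ker q (Bialgebra.counitAlgHom 𝕜 (PreAlg q.val)) (fun i j _ ↦ counit_serreE q)
      (fun i j _ ↦ counit_serreF q) (TwoSidedIdeal.mem_asIdeal.mp hx)
  map_mkQ_comul_eq_zero := fun x hx ↦ by
    refine le_ker q ((Algebra.TensorProduct.map (Ideal.Quotient.mkₐ 𝕜 (serreIdeal q).asIdeal)
      (Ideal.Quotient.mkₐ 𝕜 (serreIdeal q).asIdeal)).comp
      (Bialgebra.comulAlgHom 𝕜 (PreAlg q.val))) ?_ ?_ (TwoSidedIdeal.mem_asIdeal.mp hx)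
    · intro i j hij
      obtain ⟨a, u, hu, h⟩ := comul_serreE q hij
      rw [AlgHom.comp_apply, Bialgebra.comulAlgHom_apply, h, map_add, map_sum,
        Algebra.TensorProduct.map_tmul, mkA_eq_zero q (serreE_mem q hij), TensorProduct.zero_tmul,
        zero_add]
      refine Finset.sum_eq_zero fun k hk ↦ ?_
      rw [Algebra.TensorProduct.map_tmul, mkA_eq_zero q (hu k hk), TensorProduct.tmul_zero]
    · intro i j hij
      obtain ⟨a, u, hu, h⟩ := comul_serreF q hij
      rw [AlgHom.comp_apply, Bialgebra.comulAlgHom_apply, h, map_add, map_sum,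
        Algebra.TensorProduct.map_tmul, mkA_eq_zero q (serreF_mem q hij), TensorProduct.tmul_zero,
        zero_add]
      refine Finset.sum_eq_zero fun k hk ↦ ?_
      rw [Algebra.TensorProduct.map_tmul, mkA_eq_zero q (hu k hk), TensorProduct.zero_tmul]
  antipode_mem := fun x hx ↦ by
    have h := le_ker q ((AlgHom.op (Ideal.Quotient.mkₐ 𝕜 (serreIdeal q).asIdeal)).comp
      (antipodeHom q.val)) ?_ ?_ (TwoSidedIdeal.mem_asIdeal.mp hx)
    · exact Ideal.Quotient.eq_zero_iff_mem.mp (MulOpposite.op_injective h)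
    · intro i j hij
      exact congrArg MulOpposite.op (mkA_eq_zero q (antipode_serreE q hij))
    · intro i j hij
      exact congrArg MulOpposite.op (mkA_eq_zero q (antipode_serreF q hij))

end HopfIdeal

end MpQUEA
end MpQUEA

section HopfSubalgebra

variable {𝕜 : Type*} [Field 𝕜] {H : Type*} [Ring H] [HopfAlgebra 𝕜 H]

/-- A subalgebra `B` of a Hopf algebra `H` is a Hopf subalgebra if `Δ(B) ⊆ B ⊗ B` and
`S(B) ⊆ B`. -/
structure IsHopfSubalgebra (B : Subalgebra 𝕜 H) : Prop where
  comul_mem : ∀ b ∈ B, Coalgebra.comul (R := 𝕜) b ∈ (Algebra.TensorProduct.map B.val B.val).range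
  antipode_mem : ∀ b ∈ B, HopfAlgebra.antipode 𝕜 b ∈ B

lemma mapVal_injective (B : Subalgebra 𝕜 H) :
    Function.Injective (Algebra.TensorProduct.map B.val B.val) :=
  TensorProduct.map_injective_of_flat_flat B.val.toLinearMap B.val.toLinearMap
    Subtype.val_injective Subtype.val_injective

namespace IsHopfSubalgebra

variable {B : Subalgebra 𝕜 H} (hB : IsHopfSubalgebra B)

/-- The restriction of the coproduct to a Hopf subalgebra. -/
noncomputable def comulHom : B →ₐ[𝕜] B ⊗[𝕜] B :=
  (AlgEquiv.ofInjective _ (mapVal_injective B)).symm.toAlgHom.comp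
    (((Bialgebra.comulAlgHom 𝕜 H).comp B.val).codRestrict _ fun b ↦ hB.comul_mem b b.2)

lemma map_comulHom (b : B) :
    Algebra.TensorProduct.map B.val B.val (hB.comulHom b) = Coalgebra.comul (R := 𝕜) (b : H) :=
  congrArg Subtype.val ((AlgEquiv.ofInjective _ (mapVal_injective B)).apply_symm_apply
    ((((Bialgebra.comulAlgHom 𝕜 H).comp B.val).codRestrict _ fun b ↦ hB.comul_mem b b.2) b))


private lemma assoc_tmul (u : B ⊗[𝕜] B) (y : B) :
    Algebra.TensorProduct.map B.val (Algebra.TensorProduct.map B.val B.val)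
      (Algebra.TensorProduct.assoc 𝕜 𝕜 𝕜 B B B (u ⊗ₜ y)) =
    Algebra.TensorProduct.assoc 𝕜 𝕜 𝕜 H H H
      (Algebra.TensorProduct.map B.val B.val u ⊗ₜ (y : H)) := by
  induction u with
  | zero => simp
  | add u v hu hv => simp only [TensorProduct.add_tmul, map_add, hu, hv]
  | tmul a b => simp

private lemma assoc_left (t : B ⊗[𝕜] B) :
    Algebra.TensorProduct.map B.val (Algebra.TensorProduct.map B.val B.val)
      (Algebra.TensorProduct.assoc 𝕜 𝕜 𝕜 B B B
        (Algebra.TensorProduct.map hB.comulHom (.id 𝕜 B) t)) =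
    TensorProduct.assoc 𝕜 H H H
      ((Coalgebra.comul (R := 𝕜)).rTensor H (Algebra.TensorProduct.map B.val B.val t)) := by
  induction t with
  | zero => simp
  | add u v hu hv => simp only [map_add, hu, hv]
  | tmul a b =>
      rw [Algebra.TensorProduct.map_tmul, Algebra.TensorProduct.map_tmul, AlgHom.id_apply,
        assoc_tmul, map_comulHom]
      rfl

private lemma assoc_right (t : B ⊗[𝕜] B) :
    Algebra.TensorProduct.map B.val (Algebra.TensorProduct.map B.val B.val)
      (Algebra.TensorProduct.map (.id 𝕜 B) hB.comulHom t) =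
    (Coalgebra.comul (R := 𝕜)).lTensor H (Algebra.TensorProduct.map B.val B.val t) := by
  induction t with
  | zero => simp
  | add u v hu hv => simp only [map_add, hu, hv]
  | tmul a b =>
      rw [Algebra.TensorProduct.map_tmul, Algebra.TensorProduct.map_tmul, AlgHom.id_apply,
        map_comulHom]
      rfl

private lemma counit_left (t : B ⊗[𝕜] B) :
    ((1 : 𝕜) ⊗ₜ[𝕜] ((TensorProduct.lid 𝕜 B (Algebra.TensorProduct.map
      ((Bialgebra.counitAlgHom 𝕜 H).comp B.val) (.id 𝕜 B) t) : B) : H)) =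
    (Coalgebra.counit (R := 𝕜)).rTensor H (Algebra.TensorProduct.map B.val B.val t) := by
  induction t with
  | zero => simp
  | add u v hu hv =>
      simp only [map_add, ← hu, ← hv, Subalgebra.coe_add, TensorProduct.tmul_add]
  | tmul a b => simp [TensorProduct.tmul_smul, TensorProduct.smul_tmul']

private lemma counit_right (t : B ⊗[𝕜] B) :
    (((TensorProduct.rid 𝕜 B (Algebra.TensorProduct.map (.id 𝕜 B)
      ((Bialgebra.counitAlgHom 𝕜 H).comp B.val) t) : B) : H) ⊗ₜ[𝕜] (1 : 𝕜)) =
    (Coalgebra.counit (R := 𝕜)).lTensor H (Algebra.TensorProduct.map B.val B.val t) := by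
  induction t with
  | zero => simp
  | add u v hu hv =>
      simp only [map_add, ← hu, ← hv, Subalgebra.coe_add, TensorProduct.add_tmul]
  | tmul a b => simp [TensorProduct.smul_tmul]

/-- The bialgebra structure on a Hopf subalgebra. -/
noncomputable abbrev bialgebra : Bialgebra 𝕜 B :=
  .ofAlgHom hB.comulHom ((Bialgebra.counitAlgHom 𝕜 H).comp B.val)
    (by
      refine AlgHom.ext fun b ↦ TensorProduct.map_injective_of_flat_flat B.val.toLinearMap
        (Algebra.TensorProduct.map B.val B.val).toLinearMap Subtype.val_injective
        (mapVal_injective B) ?_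
      refine (hB.assoc_left (hB.comulHom b)).trans (Eq.trans ?_ (hB.assoc_right _).symm)
      rw [map_comulHom, Coalgebra.coassoc_apply]
      exact congrArg _ (hB.map_comulHom b).symm)
    (by
      refine AlgHom.ext fun b ↦ (TensorProduct.lid 𝕜 B).injective (Subtype.val_injective ?_)
      have h := counit_left (hB.comulHom b)
      rw [map_comulHom, Coalgebra.rTensor_counit_comul] at h
      have h' := congrArg (TensorProduct.lid 𝕜 H) h
      simpa using h')
    (by
      refine AlgHom.ext fun b ↦ (TensorProduct.rid 𝕜 B).injective (Subtype.val_injective ?_)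
      have h := counit_right (hB.comulHom b)
      rw [map_comulHom, Coalgebra.lTensor_counit_comul] at h
      have h' := congrArg (TensorProduct.rid 𝕜 H) h
      simpa using h')

/-- The restriction of the antipode to a Hopf subalgebra. -/
noncomputable def antipodeLin : B →ₗ[𝕜] B :=
  ((HopfAlgebra.antipode 𝕜).comp B.val.toLinearMap).codRestrict (Subalgebra.toSubmodule B)
    fun b ↦ hB.antipode_mem b b.2

private lemma antipode_left (t : B ⊗[𝕜] B) :
    ((LinearMap.mul' 𝕜 B (hB.antipodeLin.rTensor B t) : B) : H) =
      LinearMap.mul' 𝕜 H ((HopfAlgebra.antipode 𝕜).rTensor H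
        (Algebra.TensorProduct.map B.val B.val t)) := by
  induction t with
  | zero => simp
  | add u v hu hv => simp only [map_add, ← hu, ← hv, Subalgebra.coe_add]
  | tmul a b => rfl

private lemma antipode_right (t : B ⊗[𝕜] B) :
    ((LinearMap.mul' 𝕜 B (hB.antipodeLin.lTensor B t) : B) : H) =
      LinearMap.mul' 𝕜 H ((HopfAlgebra.antipode 𝕜).lTensor H
        (Algebra.TensorProduct.map B.val B.val t)) := by
  induction t with
  | zero => simp
  | add u v hu hv => simp only [map_add, ← hu, ← hv, Subalgebra.coe_add]
  | tmul a b => rfl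

/-- The Hopf algebra structure on a Hopf subalgebra `B`, restricting that of `H`. -/
noncomputable abbrev hopfAlgebra : HopfAlgebra 𝕜 B where
  __ := hB.bialgebra
  antipode := hB.antipodeLin
  mul_antipode_rTensor_comul := LinearMap.ext fun b ↦ Subtype.val_injective <| by
    refine (hB.antipode_left (hB.comulHom b)).trans ?_
    rw [map_comulHom, HopfAlgebra.mul_antipode_rTensor_comul_apply]
    rfl
  mul_antipode_lTensor_comul := LinearMap.ext fun b ↦ Subtype.val_injective <| by
    refine (hB.antipode_right (hB.comulHom b)).trans ?_
    rw [map_comulHom, HopfAlgebra.mul_antipode_lTensor_comul_apply]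
    rfl

/-- The inclusion of a Hopf subalgebra, as a morphism of bialgebras. -/
noncomputable def incl : letI := hB.hopfAlgebra; B →ₐc[𝕜] H :=
  letI := hB.hopfAlgebra
  .ofAlgHom B.val rfl (AlgHom.ext hB.map_comulHom)

end IsHopfSubalgebra

lemma isHopfSubalgebra_adjoin (s : Set H)
    (hΔ : ∀ x ∈ s, Coalgebra.comul (R := 𝕜) x ∈
      (Algebra.TensorProduct.map (Algebra.adjoin 𝕜 s).val (Algebra.adjoin 𝕜 s).val).range)
    (hS : ∀ x ∈ s, HopfAlgebra.antipode 𝕜 x ∈ Algebra.adjoin 𝕜 s) :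
    IsHopfSubalgebra (Algebra.adjoin 𝕜 s) where
  comul_mem b hb := by
    induction hb using Algebra.adjoin_induction with
    | mem x hx => exact hΔ x hx
    | algebraMap r =>
        rw [Bialgebra.comul_algebraMap]
        exact Subalgebra.algebraMap_mem _ r
    | add x y _ _ hx hy => rw [map_add]; exact add_mem hx hy
    | mul x y _ _ hx hy => rw [Bialgebra.comul_mul]; exact mul_mem hx hy
  antipode_mem b hb := by
    induction hb using Algebra.adjoin_induction with
    | mem x hx => exact hS x hx
    | algebraMap r =>
        rw [Algebra.algebraMap_eq_smul_one, map_smul, HopfAlgebra.antipode_one]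
        exact Subalgebra.smul_mem _ (one_mem _) r
    | add x y _ _ hx hy => rw [map_add]; exact add_mem hx hy
    | mul x y _ _ hx hy =>
        rw [HopfAlgebra.antipode_mul_antidistrib]; exact mul_mem hy hx

end HopfSubalgebra

section CocycleDeformation

open WithConv

variable {𝕜 : Type*} [Field 𝕜] {H : Type*} [Ring H] [HopfAlgebra 𝕜 H]

/-- A convolution invertible linear form `σ` on `H ⊗ H` is a (normalized, Hopf) `2`-cocycle if
`σ(b₁, c₁) σ(a, b₂ c₂) = σ(a₁, b₁) σ(a₂ b₂, c)` and `σ(a, 1) = ε(a) = σ(1, a)`. -/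
structure IsHopfTwoCocycle (σ : (WithConv (H ⊗[𝕜] H →ₗ[𝕜] 𝕜))ˣ) : Prop where
  map_tmul_one : ∀ a : H, σ.val (a ⊗ₜ 1) = Coalgebra.counit (R := 𝕜) a
  map_one_tmul : ∀ a : H, σ.val (1 ⊗ₜ a) = Coalgebra.counit (R := 𝕜) a
  cocycle : ∀ a b c : H,
    (σ.val * toConv (σ.val.ofConv ∘ₗ TensorProduct.mk 𝕜 H H a ∘ₗ LinearMap.mul' 𝕜 H)) (b ⊗ₜ c) =
    (σ.val * toConv (σ.val.ofConv ∘ₗ (TensorProduct.mk 𝕜 H H).flip c ∘ₗ LinearMap.mul' 𝕜 H))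
      (a ⊗ₜ b)

/-- The deformed multiplication `m_σ = σ * m * σ⁻¹`, that is
`a ⊗ b ↦ σ(a₁, b₁) a₂ b₂ σ⁻¹(a₃, b₃)`. -/
noncomputable def cocycleMul (σ : (WithConv (H ⊗[𝕜] H →ₗ[𝕜] 𝕜))ˣ) : H ⊗[𝕜] H →ₗ[𝕜] H :=
  (toConv (Algebra.linearMap 𝕜 H ∘ₗ σ.val.ofConv) * toConv (LinearMap.mul' 𝕜 H) *
    toConv (Algebra.linearMap 𝕜 H ∘ₗ σ.inv.ofConv)).ofConv

/-- The deformed antipode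
`S_σ(a) = σ(a₁, S(a₂)) S(a₃) σ⁻¹(S(a₄), a₅)`. -/
noncomputable def cocycleAntipode (σ : (WithConv (H ⊗[𝕜] H →ₗ[𝕜] 𝕜))ˣ) : H →ₗ[𝕜] H :=
  (toConv (Algebra.linearMap 𝕜 H ∘ₗ σ.val.ofConv ∘ₗ
      (HopfAlgebra.antipode 𝕜).lTensor H ∘ₗ Coalgebra.comul) *
    toConv (HopfAlgebra.antipode 𝕜) *
    toConv (Algebra.linearMap 𝕜 H ∘ₗ σ.inv.ofConv ∘ₗ
      (HopfAlgebra.antipode 𝕜).rTensor H ∘ₗ Coalgebra.comul)).ofConv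

/-- `H'` is isomorphic, as a Hopf algebra, to the deformation `H_σ`: the coalgebra `H` with the
same unit, with multiplication `m_σ` and with antipode `S_σ`. -/
def IsCocycleDeformation (H' : Type*) [Ring H'] [HopfAlgebra 𝕜 H']
    (σ : (WithConv (H ⊗[𝕜] H →ₗ[𝕜] 𝕜))ˣ) : Prop :=
  ∃ φ : H' ≃ₗc[𝕜] H, φ 1 = 1 ∧ (∀ x y, φ (x * y) = cocycleMul σ (φ x ⊗ₜ φ y)) ∧
    ∀ x, φ (HopfAlgebra.antipode 𝕜 x) = cocycleAntipode σ (φ x)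

variable {G : Type*} [CommGroup G]

/-- The linear form on `𝕜[G] ⊗ 𝕜[G]` with value `χ g h` at `g ⊗ h`, for a bicharacter `χ` of `G`. -/
noncomputable def bicharForm (χ : G →* G →* 𝕜ˣ) :
    MonoidAlgebra 𝕜 G ⊗[𝕜] MonoidAlgebra 𝕜 G →ₗ[𝕜] 𝕜 :=
  ((MonoidAlgebra.basis G 𝕜).tensorProduct (MonoidAlgebra.basis G 𝕜)).constr 𝕜
    fun g ↦ (χ g.1 g.2 : 𝕜)

/-- Given a bialgebra map `p : H → 𝕜[G]`, the Hopf algebra `H'` is isomorphic to `H_σ` for a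
`2`-cocycle `σ = χ ∘ (p ⊗ p)` coming from a bicharacter `χ` of `G`. -/
def IsToralDeformation (p : H →ₐc[𝕜] MonoidAlgebra 𝕜 G) (H' : Type*) [Ring H']
    [HopfAlgebra 𝕜 H'] : Prop :=
  ∃ (χ : G →* G →* 𝕜ˣ) (σ : (WithConv (H ⊗[𝕜] H →ₗ[𝕜] 𝕜))ˣ),
    (∀ x y : H, σ.val (x ⊗ₜ y) = bicharForm χ (p x ⊗ₜ p y)) ∧
      IsHopfTwoCocycle σ ∧ IsCocycleDeformation H' σ

end CocycleDeformation

section MpQUEA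

variable {𝕜 : Type*} [Field 𝕜] {n : ℕ} {A : Matrix (Fin n) (Fin n) ℤ}

namespace MpQUEA

/-- The multiparameter quantum group `U_q`. -/
abbrev U (q : Multiparameter 𝕜 A) : Type _ := PreAlg q.val ⧸ (serreIdeal q).asIdeal

variable (q : Multiparameter 𝕜 A)

/-- A generator of `U_q`. -/
def gen (g : Gen n) : U q := Ideal.Quotient.mk _ (PreAlg.gen q.val g)

lemma comul_gen (g : Gen n) : Coalgebra.comul (R := 𝕜) (gen q g) =
    match g with
    | .e i => gen q (.e i) ⊗ₜ[𝕜] 1 + gen q (.k i) ⊗ₜ gen q (.e i)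
    | .f i => gen q (.f i) ⊗ₜ[𝕜] gen q (.l i) + 1 ⊗ₜ gen q (.f i)
    | .k i => gen q (.k i) ⊗ₜ gen q (.k i)
    | .kInv i => gen q (.kInv i) ⊗ₜ gen q (.kInv i)
    | .l i => gen q (.l i) ⊗ₜ gen q (.l i)
    | .lInv i => gen q (.lInv i) ⊗ₜ gen q (.lInv i) := by
  rw [gen, Bialgebra.Quotient.comul_mk, PreAlg.comul_gen]
  cases g <;> simp [PreAlg.comulGen, gen]

lemma counit_gen (g : Gen n) :
    Coalgebra.counit (R := 𝕜) (gen q g) =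
    match g with
    | .e _ | .f _ => 0
    | .k _ | .kInv _ | .l _ | .lInv _ => 1 := by
  rw [gen, Bialgebra.Quotient.counit_mk, PreAlg.counit_gen]
  cases g <;> rfl

lemma antipode_gen (g : Gen n) :
    HopfAlgebra.antipode 𝕜 (gen q g) =
    match g with
    | .e i => -(gen q (.kInv i) * gen q (.e i))
    | .f i => -(gen q (.f i) * gen q (.lInv i))
    | .k i => gen q (.kInv i)
    | .kInv i => gen q (.k i)
    | .l i => gen q (.lInv i)
    | .lInv i => gen q (.l i) := by
  rw [gen, HopfAlgebra.Quotient.antipode_mk]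
  change Ideal.Quotient.mk _ (PreAlg.antipodeLin q.val _) = _
  rw [PreAlg.antipodeLin_gen]
  cases g <;> simp [PreAlg.antipodeGen, gen]

lemma hom_ext {B : Type*} [Ring B] [Algebra 𝕜 B] {φ ψ : U q →ₐ[𝕜] B}
    (h : ∀ g, φ (gen q g) = ψ (gen q g)) : φ = ψ :=
  Ideal.Quotient.algHom_ext _ (PreAlg.hom_ext h)

/-- The free abelian group `ℤⁿ`, written multiplicatively. -/
abbrev Lattice (n : ℕ) : Type := Multiplicative (Fin n → ℤ)

/-- The image of a generator in the group algebra of `ℤⁿ`. -/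
noncomputable def torusGen : Gen n → MonoidAlgebra 𝕜 (Lattice n)
  | .e _ => 0
  | .f _ => 0
  | .k i => .single (.ofAdd (Pi.single i 1)) 1
  | .kInv i => .single (.ofAdd (-Pi.single i 1)) 1
  | .l i => .single (.ofAdd (Pi.single i 1)) 1
  | .lInv i => .single (.ofAdd (-Pi.single i 1)) 1

private noncomputable def preTorusHom : PreAlg q.val →ₐ[𝕜] MonoidAlgebra 𝕜 (Lattice n) :=
  PreAlg.lift torusGen (by
    intro x y h
    induction h with
    | e_f i j => split_ifs <;> simp [torusGen]
    | _ => simp [torusGen, MonoidAlgebra.single_mul_single, ← ofAdd_add, mul_comm,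
        MonoidAlgebra.one_def])

/-- The projection as a map of algebras. -/
noncomputable def torusAlgHom : U q →ₐ[𝕜] MonoidAlgebra 𝕜 (Lattice n) :=
  Ideal.Quotient.liftₐ _ (preTorusHom q) fun x hx ↦ by
    refine le_ker q (preTorusHom q) ?_ ?_ (TwoSidedIdeal.mem_asIdeal.mp hx)
    · intro i j _
      rw [serreE, map_qSerre]
      simp [qSerre, preTorusHom, torusGen]
    · intro i j _
      rw [serreF, map_qSerre]
      simp [qSerre, preTorusHom, torusGen]

lemma torusAlgHom_gen (g : Gen n) : torusAlgHom q (gen q g) = torusGen g :=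
  PreAlg.lift_gen _ _ g

/-- The projection `p : U_q → 𝕜[ℤⁿ]` with `E_i, F_i ↦ 0` and `K_i^{±1}, L_i^{±1} ↦ G_i^{±1}`,
where the `G_i` are the standard generators of `ℤⁿ`. -/
noncomputable def torusProj : U q →ₐc[𝕜] MonoidAlgebra 𝕜 (Lattice n) :=
  .ofAlgHom (torusAlgHom q)
    (hom_ext q fun g ↦ by
      rw [AlgHom.comp_apply, torusAlgHom_gen, Bialgebra.counitAlgHom_apply,
        Bialgebra.counitAlgHom_apply, counit_gen]
      cases g <;> simp [torusGen])
    (hom_ext q fun g ↦ by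
      rw [AlgHom.comp_apply, AlgHom.comp_apply, torusAlgHom_gen, Bialgebra.comulAlgHom_apply,
        Bialgebra.comulAlgHom_apply, comul_gen]
      cases g <;> simp [torusAlgHom_gen, torusGen])

/-- The quantum Borel subalgebra `U_q^≥`, generated by the `K_i^{±1}` and the `E_i`. -/
def borelPos : Subalgebra 𝕜 (U q) :=
  Algebra.adjoin 𝕜 {x | ∃ i, x = gen q (.k i) ∨ x = gen q (.kInv i) ∨ x = gen q (.e i)}

/-- The quantum Borel subalgebra `U_q^≤`, generated by the `F_i` and the `L_i^{±1}`. -/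
def borelNeg : Subalgebra 𝕜 (U q) :=
  Algebra.adjoin 𝕜 {x | ∃ i, x = gen q (.f i) ∨ x = gen q (.l i) ∨ x = gen q (.lInv i)}

private lemma tmul_mem {B : Subalgebra 𝕜 (U q)} {x y : U q} (hx : x ∈ B) (hy : y ∈ B) :
    x ⊗ₜ[𝕜] y ∈ (Algebra.TensorProduct.map B.val B.val).range :=
  ⟨(⟨x, hx⟩ : B) ⊗ₜ (⟨y, hy⟩ : B), rfl⟩

lemma isHopfSubalgebra_borelPos : IsHopfSubalgebra (borelPos q) := by
  have hk (i) : gen q (.k i) ∈ borelPos q := Algebra.subset_adjoin ⟨i, .inl rfl⟩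
  have hk' (i) : gen q (.kInv i) ∈ borelPos q := Algebra.subset_adjoin ⟨i, .inr (.inl rfl)⟩
  have he (i) : gen q (.e i) ∈ borelPos q := Algebra.subset_adjoin ⟨i, .inr (.inr rfl)⟩
  refine isHopfSubalgebra_adjoin _ ?_ ?_
  · rintro _ ⟨i, rfl | rfl | rfl⟩ <;> rw [comul_gen]
    · exact tmul_mem q (hk i) (hk i)
    · exact tmul_mem q (hk' i) (hk' i)
    · exact add_mem (tmul_mem q (he i) (one_mem _)) (tmul_mem q (hk i) (he i))
  · rintro _ ⟨i, rfl | rfl | rfl⟩ <;> rw [antipode_gen]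
    · exact hk' i
    · exact hk i
    · exact neg_mem (mul_mem (hk' i) (he i))

lemma isHopfSubalgebra_borelNeg : IsHopfSubalgebra (borelNeg q) := by
  have hf (i) : gen q (.f i) ∈ borelNeg q := Algebra.subset_adjoin ⟨i, .inl rfl⟩
  have hl (i) : gen q (.l i) ∈ borelNeg q := Algebra.subset_adjoin ⟨i, .inr (.inl rfl)⟩
  have hl' (i) : gen q (.lInv i) ∈ borelNeg q := Algebra.subset_adjoin ⟨i, .inr (.inr rfl)⟩
  refine isHopfSubalgebra_adjoin _ ?_ ?_
  · rintro _ ⟨i, rfl | rfl | rfl⟩ <;> rw [comul_gen]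
    · exact add_mem (tmul_mem q (hf i) (hl i)) (tmul_mem q (one_mem _) (hf i))
    · exact tmul_mem q (hl i) (hl i)
    · exact tmul_mem q (hl' i) (hl' i)
  · rintro _ ⟨i, rfl | rfl | rfl⟩ <;> rw [antipode_gen]
    · exact neg_mem (mul_mem (hf i) (hl' i))
    · exact hl' i
    · exact hl i

noncomputable instance : HopfAlgebra 𝕜 (borelPos q) := (isHopfSubalgebra_borelPos q).hopfAlgebra

noncomputable instance : HopfAlgebra 𝕜 (borelNeg q) := (isHopfSubalgebra_borelNeg q).hopfAlgebra

/-- The restriction of the projection `p` to `U_q^≥`. -/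
noncomputable def torusProjPos : borelPos q →ₐc[𝕜] MonoidAlgebra 𝕜 (Lattice n) :=
  (torusProj q).comp (isHopfSubalgebra_borelPos q).incl

/-- The restriction of the projection `p` to `U_q^≤`. -/
noncomputable def torusProjNeg : borelNeg q →ₐc[𝕜] MonoidAlgebra 𝕜 (Lattice n) :=
  (torusProj q).comp (isHopfSubalgebra_borelNeg q).incl

end MpQUEA

/-- Twist equivalence of multiparameters: `q'_{ij} q'_{ji} = q''_{ij} q''_{ji}` and
`q'_{ii} = q''_{ii}`. -/
def TwistEquiv (q' q'' : Multiparameter 𝕜 A) : Prop :=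
  (∀ i j, q'.val i j * q'.val j i = q''.val i j * q''.val j i) ∧ ∀ i, q'.val i i = q''.val i i

/-- `A` is a symmetrizable generalized Cartan matrix, symmetrized by `diag(d)`, with positive
integral `d_i`. -/
structure IsSymmetrizedBy (A : Matrix (Fin n) (Fin n) ℤ) (d : Fin n → ℤ) : Prop where
  diag : ∀ i, A i i = 2
  off_diag : ∀ i j, i ≠ j → A i j ≤ 0
  eq_zero : ∀ i j, A i j = 0 → A j i = 0
  pos : ∀ i, 0 < d i
  symm : ∀ i j, d i * A i j = d j * A j i

namespace Multiparameter

/-- The multiparameter `q` is of Cartan type `A`: `q_{ij} q_{ji} = q_{ii}^{a_{ij}}`. -/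
def IsCartanType (q : Multiparameter 𝕜 A) : Prop :=
  ∀ i j, q.val i j * q.val j i = q.val i i ^ A i j

/-- The canonical multiparameter `q̌_{ij} = s^{d_i a_{ij}}`, for `q` with `q_{ii} = s^{2 d_i}`. -/
def canonical (q : Multiparameter 𝕜 A) {d : Fin n → ℤ} (hA : IsSymmetrizedBy A d) (s : 𝕜ˣ)
    (hs : ∀ i, q.val i i = s ^ (2 * d i)) : Multiparameter 𝕜 A where
  val i j := s ^ (d i * A i j)
  pow_ne_one i j k hk hk' := by
    rw [hA.diag, mul_comm, ← hs]
    exact q.pow_ne_one i j k hk hk'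

end Multiparameter

end MpQUEA

/-! Deforming by a toral cocycle only rescales products. Through `p` the group algebra of the
lattice coacts on `U` from the left and from the right, and `U` is spanned by elements homogeneous
for both coactions: with `g_i` the lattice generators, `E_i`, `F_i`, `K_i`, `L_i` have bidegrees
`(g_i, 1)`, `(1, g_i)`, `(g_i, g_i)`, `(g_i, g_i)`. In `m_σ = σ * m * σ⁻¹` the factor `σ` sees only
left degrees and `σ⁻¹` only right degrees, so elements of bidegrees `a`, `b` satisfy `x ·_σ y = τ(a,
b) x y` with `τ(a, b) = χ(a₁, b₁) χ(a₂, b₂)⁻¹` (`cocycleMul_apply`, `twistFactor`). Likewise `S_σ`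
is a rescaled `S` (`cocycleAntipode_apply`).

The toral generators commute as before and `[E_i, F_j]` is unchanged, because the relevant `τ` are
`1`. Conjugating `E_j` by `K_i` in the deformed algebra multiplies the eigenvalue `q'_{ij}` by
`χ(g_i, g_j) χ(g_j, g_i)⁻¹`, with matching changes for `F_j` and `L_i`. If `χ(g_i, g_i) = 1`, the
Serre expressions for the new parameters are scalar multiples of the old ones
(`qSerre_deformation`). Hence the generators of the deformation of `U_{q'}` satisfy the relations of
`U_{q''}`, where `q''_{ij} = q'_{ij} χ(g_i, g_j) χ(g_j, g_i)⁻¹` (`dgen_rel`, `preDeformHom_serreE`,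
`preDeformHom_serreF`), and there is a map `U_{q''} → (U_{q'})_σ` fixing generators. It respects the
Hopf structure because this can be checked on generators. The same construction with `χ⁻¹` gives its
inverse, since the two rescalings cancel (`deformLin_deformLin`).

Twist equivalence is exactly what allows such a `χ` to be chosen (`TwistEquiv.exists_isTwist`): take
`χ(g_i, g_j) = q''_{ij} / q'_{ij}` for `i < j` and `1` otherwise. In Cartan type, `q` is
twist-equivalent to its canonical multiparameter. The Borel cases need no presentation: the
isomorphism and its inverse preserve the Borel subalgebras, and the deformation is natural for Hopf
inclusions (`IsToralDeformation.restrict`). -/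

/-! ### Convolution: antipodes, and evaluation on elements homogeneous for a coaction. -/

section Convolution

open WithConv Coalgebra

variable {𝕜 : Type*} [Field 𝕜]

/-- Bialgebra maps between Hopf algebras commute with the antipodes. -/
lemma BialgHom.map_antipode {H K : Type*} [Ring H] [HopfAlgebra 𝕜 H] [Ring K] [HopfAlgebra 𝕜 K]
    (f : H →ₐc[𝕜] K) (x : H) : f (HopfAlgebra.antipode 𝕜 x) = HopfAlgebra.antipode 𝕜 (f x) := by
  -- In the convolution algebra `Hom(H, K)`, `f ∘ S` is a left inverse of `f` and `S ∘ f` a right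
  -- inverse, so they coincide.
  have hl : toConv ((f : H →ₐ[𝕜] K).toLinearMap ∘ₗ HopfAlgebra.antipode 𝕜) *
      toConv (f : H →ₐ[𝕜] K).toLinearMap = 1 := by
    have h := LinearMap.algHom_comp_convMul_distrib (f : H →ₐ[𝕜] K)
      (toConv (HopfAlgebra.antipode 𝕜 (A := H))) (toConv LinearMap.id)
    rw [LinearMap.antipode_mul_id] at h
    refine WithConv.ext (h.symm.trans ?_)
    ext x
    simpa using AlgHomClass.commutes f _
  have hr : toConv (f : H →ₐ[𝕜] K).toLinearMap *
      toConv (HopfAlgebra.antipode 𝕜 ∘ₗ (f : H →ₐ[𝕜] K).toLinearMap) = 1 := by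
    have h := LinearMap.convMul_comp_coalgHom_distrib (toConv LinearMap.id)
      (toConv (HopfAlgebra.antipode 𝕜 (A := K))) (f : H →ₗc[𝕜] K)
    rw [LinearMap.id_mul_antipode] at h
    refine WithConv.ext (h.symm.trans ?_)
    ext x
    simp
  exact LinearMap.congr_fun (toConv_injective (left_inv_eq_right_inv hl hr)) x

variable {C D B : Type*} [AddCommGroup C] [Module 𝕜 C] [Coalgebra 𝕜 C] [AddCommGroup D]
  [Module 𝕜 D] [Ring B] [Algebra 𝕜 B]

/-- A convolution factor that depends only on `r` sees only the `r`-image of its leg of `comul z`.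
On a homogeneous `z` that image is the single element `d`, so the convolution collapses to one
product. This and its mirror image evaluate all deformed operations below. -/
lemma convMul_apply_of_left (r : C →ₗ[𝕜] D) (f : D →ₗ[𝕜] B) (g : WithConv (C →ₗ[𝕜] B)) {z : C}
    {d : D} (hz : r.rTensor C (comul z) = d ⊗ₜ z) :
    (toConv (f ∘ₗ r) * g) z = f d * g z := by
  have : TensorProduct.map (f ∘ₗ r) g.ofConv =
      TensorProduct.map f g.ofConv ∘ₗ r.rTensor C := by
    ext; simp
  rw [LinearMap.convMul_apply, ofConv_toConv, this, LinearMap.comp_apply, hz]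
  rfl

lemma convMul_apply_of_right (r : C →ₗ[𝕜] D) (f : D →ₗ[𝕜] B) (g : WithConv (C →ₗ[𝕜] B)) {z : C}
    {d : D} (hz : r.lTensor C (comul z) = z ⊗ₜ d) :
    (g * toConv (f ∘ₗ r)) z = g z * f d := by
  have : TensorProduct.map g.ofConv (f ∘ₗ r) =
      TensorProduct.map g.ofConv f ∘ₗ r.lTensor C := by
    ext; simp
  rw [LinearMap.convMul_apply, ofConv_toConv, this, LinearMap.comp_apply, hz]
  rfl

/-- Postcomposing a scalar form with the unit map is multiplicative for convolution. -/
lemma linearMap_comp_convMul (f g : WithConv (C →ₗ[𝕜] 𝕜)) :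
    toConv (Algebra.linearMap 𝕜 B ∘ₗ (f * g).ofConv) =
      toConv (Algebra.linearMap 𝕜 B ∘ₗ f.ofConv) * toConv (Algebra.linearMap 𝕜 B ∘ₗ g.ofConv) :=
  WithConv.ext (LinearMap.algHom_comp_convMul_distrib (Algebra.ofId 𝕜 B) f g)

lemma linearMap_comp_convOne :
    toConv (Algebra.linearMap 𝕜 B ∘ₗ (1 : WithConv (C →ₗ[𝕜] 𝕜)).ofConv) = 1 := by
  ext; simp

end Convolution

/-! ### Compatibility of the deformed product with the undeformed coalgebra structure. -/

section CocycleStructure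

open WithConv Coalgebra

variable {𝕜 : Type*} [Field 𝕜] {H : Type*} [Ring H] [HopfAlgebra 𝕜 H]
  (σ : (WithConv (H ⊗[𝕜] H →ₗ[𝕜] 𝕜))ˣ)

/-- In the convolution algebra `Hom(H ⊗ H, H ⊗ H)`, `Δ ∘ m` is the product of `i₁ ∘ m` and `i₂ ∘ m`,
while scalar-valued factors are unaffected by algebra maps. Inserting `σ⁻¹ * σ = 1` in the middle of
`σ * (i₁ m) * (i₂ m) * σ⁻¹` splits it into the two deformed products. Only invertibility of `σ`
enters, not the cocycle identity. -/
lemma comul_comp_cocycleMul :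
    comul ∘ₗ cocycleMul σ = TensorProduct.map (cocycleMul σ) (cocycleMul σ) ∘ₗ comul := by
  let i₁ : H →ₐ[𝕜] H ⊗[𝕜] H := Algebra.TensorProduct.includeLeft
  let i₂ : H →ₐ[𝕜] H ⊗[𝕜] H := Algebra.TensorProduct.includeRight
  have key (f : H ⊗[𝕜] H →ₗ[𝕜] H) : toConv (TensorProduct.map f f ∘ₗ comul) =
      toConv (i₁.toLinearMap ∘ₗ f) * toConv (i₂.toLinearMap ∘ₗ f) := by
    rw [LinearMap.convMul_def, ← LinearMap.comp_assoc]
    congr 2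
    ext
    simp [i₁, i₂]
  have hΔ : toConv (comul ∘ₗ LinearMap.mul' 𝕜 H) = toConv (i₁.toLinearMap ∘ₗ LinearMap.mul' 𝕜 H) *
      toConv (i₂.toLinearMap ∘ₗ LinearMap.mul' 𝕜 H) := by
    rw [← key]
    congr 1
    refine TensorProduct.ext' fun x y ↦ ?_
    simp only [LinearMap.comp_apply, LinearMap.mul'_apply, Bialgebra.comul_mul,
      TensorProduct.comul_tmul]
    induction comul (R := 𝕜) x with
    | zero => simp
    | add u v hu hv => simp only [add_mul, TensorProduct.add_tmul, map_add, hu, hv]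
    | tmul a b =>
      induction comul (R := 𝕜) y with
      | zero => simp
      | add u v hu hv => simp only [mul_add, TensorProduct.tmul_add, map_add, hu, hv]
      | tmul c d => simp
  have hη (i : H →ₐ[𝕜] H ⊗[𝕜] H) (f : H ⊗[𝕜] H →ₗ[𝕜] 𝕜) :
      i.toLinearMap ∘ₗ Algebra.linearMap 𝕜 H ∘ₗ f = Algebra.linearMap 𝕜 (H ⊗[𝕜] H) ∘ₗ f := by
    ext; simp
  have hm (i : H →ₐ[𝕜] H ⊗[𝕜] H) : toConv (i.toLinearMap ∘ₗ cocycleMul σ) =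
      toConv (Algebra.linearMap 𝕜 (H ⊗[𝕜] H) ∘ₗ σ.val.ofConv) *
        toConv (i.toLinearMap ∘ₗ LinearMap.mul' 𝕜 H) *
        toConv (Algebra.linearMap 𝕜 (H ⊗[𝕜] H) ∘ₗ σ.inv.ofConv) := by
    rw [cocycleMul, LinearMap.algHom_comp_convMul_distrib, toConv_ofConv]
    congr 1
    · refine (congrArg toConv (LinearMap.algHom_comp_convMul_distrib i _ _)).trans ?_
      rw [toConv_ofConv]
      simp only [hη]
    · simp only [hη]
  have hcancel : toConv (Algebra.linearMap 𝕜 (H ⊗[𝕜] H) ∘ₗ σ.inv.ofConv) *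
      toConv (Algebra.linearMap 𝕜 (H ⊗[𝕜] H) ∘ₗ σ.val.ofConv) = 1 := by
    rw [← linearMap_comp_convMul, σ.inv_val, linearMap_comp_convOne]
  apply toConv_injective
  have hassoc {M : Type _} [Monoid M] {s t : M} (a b : M) (h : t * s = 1) :
      s * (a * b) * t = s * a * t * (s * b * t) := by
    simp only [mul_assoc]
    rw [← mul_assoc t s, h, one_mul]
  rw [key, hm, hm]
  refine (hm (Bialgebra.comulAlgHom 𝕜 H)).trans ?_
  change _ * toConv (comul ∘ₗ LinearMap.mul' 𝕜 H) * _ = _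
  rw [hΔ]
  exact hassoc _ _ hcancel

/-- Since `ε ∘ m` is the convolution unit on `H ⊗ H`, applying `ε` to `σ * m * σ⁻¹` leaves `σ * σ⁻¹
= 1`. -/
lemma counit_comp_cocycleMul :
    counit ∘ₗ cocycleMul σ = (counit : H ⊗[𝕜] H →ₗ[𝕜] 𝕜) := by
  have hη (f : H ⊗[𝕜] H →ₗ[𝕜] 𝕜) :
      (Bialgebra.counitAlgHom 𝕜 H).toLinearMap ∘ₗ Algebra.linearMap 𝕜 H ∘ₗ f = f := by
    ext; simp
  have h1 : toConv ((Bialgebra.counitAlgHom 𝕜 H).toLinearMap ∘ₗ LinearMap.mul' 𝕜 H) = 1 := by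
    ext; simp [mul_comm]
  have hm : toConv ((Bialgebra.counitAlgHom 𝕜 H).toLinearMap ∘ₗ cocycleMul σ) =
      σ.val * toConv ((Bialgebra.counitAlgHom 𝕜 H).toLinearMap ∘ₗ LinearMap.mul' 𝕜 H) * σ.inv := by
    rw [cocycleMul, LinearMap.algHom_comp_convMul_distrib, toConv_ofConv]
    congr 1
    · refine (congrArg toConv (LinearMap.algHom_comp_convMul_distrib _ _ _)).trans ?_
      rw [toConv_ofConv]
      simp only [hη]
    · simp only [hη]
  rw [h1, mul_one, σ.val_inv] at hm
  have := congrArg ofConv hm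
  refine this.trans ?_
  ext
  simp

section Naturality

variable {B : Type*} [Ring B] [HopfAlgebra 𝕜 B]

/-- `f ⊗ f`, as a map of coalgebras. -/
noncomputable abbrev BialgHom.tensorSq (f : B →ₐc[𝕜] H) : B ⊗[𝕜] B →ₗc[𝕜] H ⊗[𝕜] H :=
  Coalgebra.TensorProduct.map (f : B →ₗc[𝕜] H) (f : B →ₗc[𝕜] H)

/-- Precomposition with the coalgebra map `f ⊗ f` is multiplicative for convolution, so it carries
inverses to inverses, and these are unique. -/
lemma inv_comp_tensorSq {f : B →ₐc[𝕜] H} {σ : (WithConv (H ⊗[𝕜] H →ₗ[𝕜] 𝕜))ˣ}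
    {τ : (WithConv (B ⊗[𝕜] B →ₗ[𝕜] 𝕜))ˣ}
    (h : τ.val = toConv (σ.val.ofConv ∘ₗ f.tensorSq.toLinearMap)) :
    τ.inv = toConv (σ.inv.ofConv ∘ₗ f.tensorSq.toLinearMap) := by
  refine left_inv_eq_right_inv τ.inv_val ?_
  rw [h]
  refine (WithConv.ext (LinearMap.convMul_comp_coalgHom_distrib σ.val σ.inv f.tensorSq)).symm.trans ?_
  rw [σ.val_inv]
  ext
  simp

end Naturality

end CocycleStructure

/-! ### Naturality of the deformed product and antipode. -/

section Naturality

open WithConv Coalgebra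

variable {𝕜 : Type*} [Field 𝕜] {H : Type*} [Ring H] [HopfAlgebra 𝕜 H] {B : Type*} [Ring B]
  [HopfAlgebra 𝕜 B] {f : B →ₐc[𝕜] H} {σ : (WithConv (H ⊗[𝕜] H →ₗ[𝕜] 𝕜))ˣ}
  {τ : (WithConv (B ⊗[𝕜] B →ₗ[𝕜] 𝕜))ˣ}

/-- The deformed multiplication is natural in the Hopf algebra. -/
lemma map_cocycleMul (h : τ.val = toConv (σ.val.ofConv ∘ₗ f.tensorSq.toLinearMap))
    (t : B ⊗[𝕜] B) : f (cocycleMul τ t) = cocycleMul σ (f.tensorSq t) := by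
  have h' := inv_comp_tensorSq h
  have hη (g : B ⊗[𝕜] B →ₗ[𝕜] 𝕜) :
      (f : B →ₐ[𝕜] H).toLinearMap ∘ₗ Algebra.linearMap 𝕜 B ∘ₗ g = Algebra.linearMap 𝕜 H ∘ₗ g := by
    ext; simpa using AlgHomClass.commutes f _
  -- Postcomposition with an algebra map and precomposition with a coalgebra map both distribute
  -- over convolution. Both sides thus become triple convolution products, which agree factor by
  -- factor.
  have hl := LinearMap.algHom_comp_convMul_distrib (f : B →ₐ[𝕜] H)
    (toConv (Algebra.linearMap 𝕜 B ∘ₗ τ.val.ofConv)) (toConv (LinearMap.mul' 𝕜 B))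
  have hl' := LinearMap.algHom_comp_convMul_distrib (f : B →ₐ[𝕜] H)
    (toConv (Algebra.linearMap 𝕜 B ∘ₗ τ.val.ofConv) * toConv (LinearMap.mul' 𝕜 B))
    (toConv (Algebra.linearMap 𝕜 B ∘ₗ τ.inv.ofConv))
  have hr := LinearMap.convMul_comp_coalgHom_distrib
    (toConv (Algebra.linearMap 𝕜 H ∘ₗ σ.val.ofConv)) (toConv (LinearMap.mul' 𝕜 H)) f.tensorSq
  have hr' := LinearMap.convMul_comp_coalgHom_distrib
    (toConv (Algebra.linearMap 𝕜 H ∘ₗ σ.val.ofConv) * toConv (LinearMap.mul' 𝕜 H))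
    (toConv (Algebra.linearMap 𝕜 H ∘ₗ σ.inv.ofConv)) f.tensorSq
  have hm : (f : B →ₐ[𝕜] H).toLinearMap ∘ₗ LinearMap.mul' 𝕜 B =
      LinearMap.mul' 𝕜 H ∘ₗ f.tensorSq.toLinearMap := by
    ext; simp
  refine LinearMap.congr_fun (f := (f : B →ₐ[𝕜] H).toLinearMap ∘ₗ cocycleMul τ)
    (g := cocycleMul σ ∘ₗ f.tensorSq.toLinearMap) ?_ t
  rw [cocycleMul, cocycleMul, hl', hr', hl, hr]
  simp only [hη, hm, h, h', LinearMap.comp_assoc]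

/-- The deformed antipode is natural in the Hopf algebra. -/
lemma map_cocycleAntipode (h : τ.val = toConv (σ.val.ofConv ∘ₗ f.tensorSq.toLinearMap)) (x : B) :
    f (cocycleAntipode τ x) = cocycleAntipode σ (f x) := by
  have h' := inv_comp_tensorSq h
  have hη (g : B →ₗ[𝕜] 𝕜) :
      (f : B →ₐ[𝕜] H).toLinearMap ∘ₗ Algebra.linearMap 𝕜 B ∘ₗ g = Algebra.linearMap 𝕜 H ∘ₗ g := by
    ext; simpa using AlgHomClass.commutes f _
  have hS : (f : B →ₐ[𝕜] H).toLinearMap ∘ₗ HopfAlgebra.antipode 𝕜 =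
      HopfAlgebra.antipode 𝕜 ∘ₗ (f : B →ₗc[𝕜] H).toLinearMap := by
    ext; exact f.map_antipode _
  have hΔ : comul ∘ₗ (f : B →ₗc[𝕜] H).toLinearMap = f.tensorSq.toLinearMap ∘ₗ comul := by
    ext; exact (CoalgHomClass.map_comp_comul_apply f _).symm
  have hl : f.tensorSq.toLinearMap ∘ₗ (HopfAlgebra.antipode 𝕜).lTensor B =
      (HopfAlgebra.antipode 𝕜).lTensor H ∘ₗ f.tensorSq.toLinearMap := by
    ext; simp [f.map_antipode]
  have hr : f.tensorSq.toLinearMap ∘ₗ (HopfAlgebra.antipode 𝕜).rTensor B =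
      (HopfAlgebra.antipode 𝕜).rTensor H ∘ₗ f.tensorSq.toLinearMap := by
    ext; simp [f.map_antipode]
  refine LinearMap.congr_fun (f := (f : B →ₐ[𝕜] H).toLinearMap ∘ₗ cocycleAntipode τ)
    (g := cocycleAntipode σ ∘ₗ (f : B →ₗc[𝕜] H).toLinearMap) ?_ x
  rw [cocycleAntipode, cocycleAntipode]
  refine (LinearMap.algHom_comp_convMul_distrib (f : B →ₐ[𝕜] H) _ _).trans ?_
  refine Eq.trans ?_ (LinearMap.convMul_comp_coalgHom_distrib _ _ (f : B →ₗc[𝕜] H)).symm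
  refine congrArg ofConv (congrArg₂ (· * ·) (congrArg toConv ?_) (congrArg toConv ?_))
  · refine (LinearMap.algHom_comp_convMul_distrib (f : B →ₐ[𝕜] H) _ _).trans ?_
    refine Eq.trans ?_ (LinearMap.convMul_comp_coalgHom_distrib _ _ (f : B →ₗc[𝕜] H)).symm
    refine congrArg ofConv (congrArg₂ (· * ·) (congrArg toConv ?_) (congrArg toConv ?_))
    · refine (hη _).trans ?_
      simp only [LinearMap.comp_assoc, hΔ, h]
      rw [← LinearMap.comp_assoc _ _ (f.tensorSq.toLinearMap), hl, LinearMap.comp_assoc]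
    · exact hS
  · refine (hη _).trans ?_
    simp only [LinearMap.comp_assoc, hΔ, h']
    rw [← LinearMap.comp_assoc _ _ (f.tensorSq.toLinearMap), hr, LinearMap.comp_assoc]

end Naturality

/-! ### Bicharacters give normalized Hopf 2-cocycles. -/

section ToralCocycle

open WithConv Coalgebra

variable {𝕜 : Type*} [Field 𝕜] {G : Type*} [CommGroup G]

@[simp] lemma bicharForm_single (χ : G →* G →* 𝕜ˣ) (g h : G) :
    bicharForm χ (MonoidAlgebra.single g (1 : 𝕜) ⊗ₜ MonoidAlgebra.single h 1) = χ g h := by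
  have := ((MonoidAlgebra.basis G 𝕜).tensorProduct (MonoidAlgebra.basis G 𝕜)).constr_basis 𝕜
    (fun g ↦ (χ g.1 g.2 : 𝕜)) (g, h)
  simpa [bicharForm] using this

/-- Group elements are group-like, so on the basis convolution is pointwise multiplication. -/
lemma bicharForm_mul_inv (χ : G →* G →* 𝕜ˣ) :
    toConv (bicharForm χ) * toConv (bicharForm χ⁻¹) = 1 := by
  refine WithConv.ext (TensorProduct.ext ?_)
  refine (MonoidAlgebra.basis G 𝕜).ext fun g ↦ (MonoidAlgebra.basis G 𝕜).ext fun h ↦ ?_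
  change (toConv (bicharForm χ) * toConv (bicharForm χ⁻¹)) _ =
    (1 : WithConv (MonoidAlgebra 𝕜 G ⊗[𝕜] MonoidAlgebra 𝕜 G →ₗ[𝕜] 𝕜)) _
  simp

variable {H : Type*} [Ring H] [HopfAlgebra 𝕜 H] (p : H →ₐc[𝕜] MonoidAlgebra 𝕜 G)

/-- The linear form `χ ∘ (p ⊗ p)`. -/
noncomputable abbrev toralForm (χ : G →* G →* 𝕜ˣ) : H ⊗[𝕜] H →ₗ[𝕜] 𝕜 :=
  bicharForm χ ∘ₗ (BialgHom.tensorSq p).toLinearMap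

lemma toralForm_mul_inv (χ : G →* G →* 𝕜ˣ) :
    toConv (toralForm p χ) * toConv (toralForm p χ⁻¹) = 1 := by
  refine (WithConv.ext (LinearMap.convMul_comp_coalgHom_distrib (toConv (bicharForm χ))
    (toConv (bicharForm χ⁻¹)) p.tensorSq)).symm.trans ?_
  rw [bicharForm_mul_inv]
  ext
  simp

/-- The toral cocycle `χ ∘ (p ⊗ p)`. -/
noncomputable def toralCocycle (χ : G →* G →* 𝕜ˣ) : (WithConv (H ⊗[𝕜] H →ₗ[𝕜] 𝕜))ˣ where
  val := toConv (toralForm p χ)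
  inv := toConv (toralForm p χ⁻¹)
  val_inv := toralForm_mul_inv p χ
  inv_val := by simpa using toralForm_mul_inv p χ⁻¹

lemma toralCocycle_tmul (χ : G →* G →* 𝕜ˣ) (x y : H) :
    (toralCocycle p χ).val (x ⊗ₜ y) = bicharForm χ (p x ⊗ₜ p y) := rfl

/-- This is the hypothesis of the naturality lemmas, so toral deformations can be compared along any
bialgebra map, in particular along the Borel inclusions. -/
lemma toralCocycle_comp {B : Type*} [Ring B] [HopfAlgebra 𝕜 B] (f : B →ₐc[𝕜] H)
    (χ : G →* G →* 𝕜ˣ) : (toralCocycle (p.comp f) χ).val =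
      toConv ((toralCocycle p χ).val.ofConv ∘ₗ f.tensorSq.toLinearMap) := by
  refine WithConv.ext (TensorProduct.ext' fun x y ↦ rfl)

/-- Both sides are trilinear, and on group elements `g`, `h`, `k` they read `χ(h, k) χ(g, hk) = χ(g,
h) χ(gh, k)`, which is bimultiplicativity. -/
lemma bicharForm_cocycle (χ : G →* G →* 𝕜ˣ) (a b c : MonoidAlgebra 𝕜 G) :
    (toConv (bicharForm χ) * toConv (bicharForm χ ∘ₗ TensorProduct.mk 𝕜 _ _ a ∘ₗ
      LinearMap.mul' 𝕜 (MonoidAlgebra 𝕜 G))) (b ⊗ₜ c) =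
    (toConv (bicharForm χ) * toConv (bicharForm χ ∘ₗ (TensorProduct.mk 𝕜 _ _).flip c ∘ₗ
      LinearMap.mul' 𝕜 (MonoidAlgebra 𝕜 G))) (a ⊗ₜ b) := by
  -- `a` and `c` occur inside a convolution factor; bundling the two sides as linear maps in `a` and
  -- in `c` makes induction on the span available.
  let l : MonoidAlgebra 𝕜 G →ₗ[𝕜] WithConv (MonoidAlgebra 𝕜 G ⊗[𝕜] MonoidAlgebra 𝕜 G →ₗ[𝕜] 𝕜) :=
    LinearMap.mulLeft 𝕜 (toConv (bicharForm χ)) ∘ₗ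
      { toFun a := toConv (bicharForm χ ∘ₗ TensorProduct.mk 𝕜 _ _ a ∘ₗ LinearMap.mul' 𝕜 (MonoidAlgebra 𝕜 G))
        map_add' _ _ := by ext; simp
        map_smul' _ _ := by ext; simp }
  let r : MonoidAlgebra 𝕜 G →ₗ[𝕜] WithConv (MonoidAlgebra 𝕜 G ⊗[𝕜] MonoidAlgebra 𝕜 G →ₗ[𝕜] 𝕜) :=
    LinearMap.mulLeft 𝕜 (toConv (bicharForm χ)) ∘ₗ
      { toFun c := toConv (bicharForm χ ∘ₗ (TensorProduct.mk 𝕜 _ _).flip c ∘ₗ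
          LinearMap.mul' 𝕜 (MonoidAlgebra 𝕜 G))
        map_add' _ _ := by ext; simp
        map_smul' _ _ := by ext; simp }
  change l a (b ⊗ₜ c) = r c (a ⊗ₜ b)
  have hspan (x : MonoidAlgebra 𝕜 G) : x ∈ Submodule.span 𝕜 (Set.range fun g ↦ MonoidAlgebra.single g (1 : 𝕜)) := by
    have h := (MonoidAlgebra.basis G 𝕜).mem_span x
    rwa [show ⇑(MonoidAlgebra.basis G 𝕜) = fun g ↦ MonoidAlgebra.single g (1 : 𝕜) by
      ext1; simp] at h
  induction hspan a using Submodule.span_induction with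
  | zero => simp
  | add x y _ _ hx hy => simp [TensorProduct.add_tmul, hx, hy]
  | smul t x _ hx => simp [← TensorProduct.smul_tmul', hx]
  | mem x hx =>
  obtain ⟨g, rfl⟩ := hx
  induction hspan b using Submodule.span_induction with
  | zero => simp
  | add x y _ _ hx hy => simp [TensorProduct.add_tmul, TensorProduct.tmul_add, hx, hy]
  | smul t x _ hx => simp [← TensorProduct.smul_tmul', hx]
  | mem x hx =>
  obtain ⟨h, rfl⟩ := hx
  induction hspan c using Submodule.span_induction with
  | zero => simp
  | add x y _ _ hx hy => simp [TensorProduct.tmul_add, hx, hy]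
  | smul t x _ hx => simp [hx]
  | mem x hx =>
  obtain ⟨k, rfl⟩ := hx
  simp [l, r, MonoidAlgebra.single_mul_single]
  ring

/-- The identities hold in the group algebra and are pulled back along `p ⊗ p`, using that `p`
respects both coproducts and products. -/
lemma isHopfTwoCocycle_toralCocycle (χ : G →* G →* 𝕜ˣ) :
    IsHopfTwoCocycle (toralCocycle p χ) where
  map_tmul_one a := by
    have h : bicharForm χ ∘ₗ (TensorProduct.mk 𝕜 (MonoidAlgebra 𝕜 G) (MonoidAlgebra 𝕜 G)).flip 1 = counit :=
      (MonoidAlgebra.basis G 𝕜).ext fun g ↦ by simp [MonoidAlgebra.one_def]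
    rw [toralCocycle_tmul, map_one]
    exact (LinearMap.congr_fun h (p a)).trans (by simp)
  map_one_tmul a := by
    have h : bicharForm χ ∘ₗ TensorProduct.mk 𝕜 (MonoidAlgebra 𝕜 G) (MonoidAlgebra 𝕜 G) 1 = counit :=
      (MonoidAlgebra.basis G 𝕜).ext fun g ↦ by simp [MonoidAlgebra.one_def]
    rw [toralCocycle_tmul, map_one]
    exact (LinearMap.congr_fun h (p a)).trans (by simp)
  cocycle a b c := by
    have hp : LinearMap.mul' 𝕜 (MonoidAlgebra 𝕜 G) ∘ₗ p.tensorSq.toLinearMap =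
        (p : H →ₐ[𝕜] MonoidAlgebra 𝕜 G).toLinearMap ∘ₗ LinearMap.mul' 𝕜 H := by
      ext; simp
    have hl := LinearMap.convMul_comp_coalgHom_distrib (toConv (bicharForm χ))
      (toConv (bicharForm χ ∘ₗ TensorProduct.mk 𝕜 _ _ (p a) ∘ₗ LinearMap.mul' 𝕜 (MonoidAlgebra 𝕜 G))) p.tensorSq
    have hr := LinearMap.convMul_comp_coalgHom_distrib (toConv (bicharForm χ))
      (toConv (bicharForm χ ∘ₗ (TensorProduct.mk 𝕜 _ _).flip (p c) ∘ₗ LinearMap.mul' 𝕜 (MonoidAlgebra 𝕜 G)))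
      p.tensorSq
    simp only [LinearMap.comp_assoc, hp] at hl hr
    exact ((LinearMap.congr_fun hl (b ⊗ₜ c)).symm.trans
      (bicharForm_cocycle χ (p a) (p b) (p c))).trans (LinearMap.congr_fun hr (a ⊗ₜ b))

end ToralCocycle

/-! ### Bidegrees from the two toral coactions; deformed operations on homogeneous elements. -/

section Bidegree

open WithConv Coalgebra

variable {𝕜 : Type*} [Field 𝕜] {G : Type*} [CommGroup G] {H : Type*} [Ring H] [HopfAlgebra 𝕜 H]
  (p : H →ₐc[𝕜] MonoidAlgebra 𝕜 G)

/-- The elements of `H` of degree `a.1` for the left coaction `(p ⊗ id) Δ` and of degree `a.2` for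
the right coaction `(id ⊗ p) Δ` of the group algebra. -/
noncomputable def bihomogeneous (a : G × G) : Submodule 𝕜 H :=
  LinearMap.eqLocus ((p : H →ₐ[𝕜] MonoidAlgebra 𝕜 G).toLinearMap.rTensor H ∘ₗ comul)
      (TensorProduct.mk 𝕜 _ _ (MonoidAlgebra.single a.1 1)) ⊓
    LinearMap.eqLocus ((p : H →ₐ[𝕜] MonoidAlgebra 𝕜 G).toLinearMap.lTensor H ∘ₗ comul)
      ((TensorProduct.mk 𝕜 _ _).flip (MonoidAlgebra.single a.2 1))

variable {p}

lemma mem_bihomogeneous {a : G × G} {x : H} : x ∈ bihomogeneous p a ↔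
    (p : H →ₐ[𝕜] MonoidAlgebra 𝕜 G).toLinearMap.rTensor H (comul x) =
        MonoidAlgebra.single a.1 1 ⊗ₜ x ∧
      (p : H →ₐ[𝕜] MonoidAlgebra 𝕜 G).toLinearMap.lTensor H (comul x) =
        x ⊗ₜ MonoidAlgebra.single a.2 1 := Iff.rfl

lemma one_mem_bihomogeneous : (1 : H) ∈ bihomogeneous p (1, 1) := by
  simp [mem_bihomogeneous, Algebra.TensorProduct.one_def, MonoidAlgebra.one_def]

/-- The coactions `(p ⊗ id) Δ` and `(id ⊗ p) Δ` are algebra maps, so degrees multiply. -/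
lemma mul_mem_bihomogeneous {a b : G × G} {x y : H} (hx : x ∈ bihomogeneous p a)
    (hy : y ∈ bihomogeneous p b) : x * y ∈ bihomogeneous p (a * b) := by
  rw [mem_bihomogeneous] at hx hy ⊢
  have hl := map_mul (Algebra.TensorProduct.map (p : H →ₐ[𝕜] MonoidAlgebra 𝕜 G) (.id 𝕜 H))
    (comul (R := 𝕜) x) (comul (R := 𝕜) y)
  have hr := map_mul (Algebra.TensorProduct.map (.id 𝕜 H) (p : H →ₐ[𝕜] MonoidAlgebra 𝕜 G))
    (comul (R := 𝕜) x) (comul (R := 𝕜) y)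
  rw [← Bialgebra.comul_mul] at hl hr
  refine ⟨hl.trans ((congrArg₂ (· * ·) hx.1 hy.1).trans ?_),
    hr.trans ((congrArg₂ (· * ·) hx.2 hy.2).trans ?_)⟩ <;>
  simp [MonoidAlgebra.single_mul_single]

/-- The bidegree of the antipode of a homogeneous element. -/
abbrev dualBidegree (a : G × G) : G × G := (a.2⁻¹, a.1⁻¹)

variable (p) in
/-- The elements of bidegree `a` whose antipode has the dual bidegree. -/
noncomputable def bidegree (a : G × G) : Submodule 𝕜 H :=
  bihomogeneous p a ⊓ (bihomogeneous p (dualBidegree a)).comap (HopfAlgebra.antipode 𝕜)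

lemma one_mem_bidegree : (1 : H) ∈ bidegree p 1 := by
  refine ⟨one_mem_bihomogeneous, ?_⟩
  simpa [dualBidegree] using one_mem_bihomogeneous (p := p)

/-- The antipode reverses products, which does no harm to degrees because `G` is commutative. The
antipode condition is carried along because antimultiplicativity of `S_σ` requires the twist factor
of `S(y)` and `S(x)`. -/
lemma mul_mem_bidegree {a b : G × G} {x y : H} (hx : x ∈ bidegree p a) (hy : y ∈ bidegree p b) :
    x * y ∈ bidegree p (a * b) := by
  refine ⟨mul_mem_bihomogeneous hx.1 hy.1, ?_⟩
  have h := mul_mem_bihomogeneous (Submodule.mem_comap.mp hy.2) (Submodule.mem_comap.mp hx.2)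
  rw [← HopfAlgebra.antipode_mul_antidistrib] at h
  simpa [dualBidegree] using h

lemma algebraMap_mul_mul_algebraMap {B : Type*} [Ring B] [Algebra 𝕜 B] (r s : 𝕜) (x : B) :
    algebraMap 𝕜 B r * x * algebraMap 𝕜 B s = (r * s) • x := by
  rw [mul_assoc, ← Algebra.commutes, ← mul_assoc, ← map_mul, Algebra.smul_def]

/-- The factor `χ(a, a') χ(b, b')⁻¹` by which the product of elements of bidegrees `(a, b)` and
`(a', b')` is deformed. -/
def twistFactor (χ : G →* G →* 𝕜ˣ) (a b : G × G) : 𝕜ˣ := χ a.1 b.1 * (χ a.2 b.2)⁻¹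

/-- In `σ * m * σ⁻¹` the left factor depends on the outer left legs only through `p`, hence gives
`χ` of the left degrees; the right factor gives `χ⁻¹` of the right degrees. -/
lemma cocycleMul_apply {χ : G →* G →* 𝕜ˣ} {a b : G × G} {x y : H} (hx : x ∈ bihomogeneous p a)
    (hy : y ∈ bihomogeneous p b) : cocycleMul (toralCocycle p χ) (x ⊗ₜ y) =
      (twistFactor χ a b : 𝕜) • (x * y) := by
  rw [mem_bihomogeneous] at hx hy
  -- The coproduct of `H ⊗ H` is the two coproducts followed by a shuffle of the middle legs, so the
  -- pair `x ⊗ y` is homogeneous for `p ⊗ p` as soon as `x` and `y` are homogeneous for `p`.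
  have hl : p.tensorSq.toLinearMap.rTensor (H ⊗[𝕜] H) (comul (x ⊗ₜ[𝕜] y)) =
      (MonoidAlgebra.single a.1 1 ⊗ₜ MonoidAlgebra.single b.1 1) ⊗ₜ (x ⊗ₜ y) := by
    have key : p.tensorSq.toLinearMap.rTensor (H ⊗[𝕜] H) ∘ₗ
        (TensorProduct.tensorTensorTensorComm 𝕜 H H H H).toLinearMap =
        (TensorProduct.tensorTensorTensorComm 𝕜 _ H _ H).toLinearMap ∘ₗ
          TensorProduct.map ((p : H →ₐ[𝕜] MonoidAlgebra 𝕜 G).toLinearMap.rTensor H)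
            ((p : H →ₐ[𝕜] MonoidAlgebra 𝕜 G).toLinearMap.rTensor H) := by
      ext; simp
    refine (LinearMap.congr_fun key (comul x ⊗ₜ comul y)).trans ?_
    simp [hx.1, hy.1]
  have hr : p.tensorSq.toLinearMap.lTensor (H ⊗[𝕜] H) (comul (x ⊗ₜ[𝕜] y)) =
      (x ⊗ₜ y) ⊗ₜ (MonoidAlgebra.single a.2 1 ⊗ₜ MonoidAlgebra.single b.2 1) := by
    have key : p.tensorSq.toLinearMap.lTensor (H ⊗[𝕜] H) ∘ₗ
        (TensorProduct.tensorTensorTensorComm 𝕜 H H H H).toLinearMap =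
        (TensorProduct.tensorTensorTensorComm 𝕜 H _ H _).toLinearMap ∘ₗ
          TensorProduct.map ((p : H →ₐ[𝕜] MonoidAlgebra 𝕜 G).toLinearMap.lTensor H)
            ((p : H →ₐ[𝕜] MonoidAlgebra 𝕜 G).toLinearMap.lTensor H) := by
      ext; simp
    refine (LinearMap.congr_fun key (comul x ⊗ₜ comul y)).trans ?_
    simp [hx.2, hy.2]
  refine (convMul_apply_of_right p.tensorSq.toLinearMap
    (Algebra.linearMap 𝕜 H ∘ₗ bicharForm χ⁻¹) _ hr).trans ?_
  refine (congrArg (· * _) (convMul_apply_of_left p.tensorSq.toLinearMap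
    (Algebra.linearMap 𝕜 H ∘ₗ bicharForm χ) _ hl)).trans ?_
  refine (algebraMap_mul_mul_algebraMap _ _ _).trans ?_
  simp [twistFactor]

/-- On a group element `g`, the outer factors are `χ(g, g⁻¹) = χ(g, g)⁻¹` and `χ⁻¹(g⁻¹, g) = χ(g,
g)`; they are evaluated at the left and right degree respectively. -/
lemma cocycleAntipode_apply {χ : G →* G →* 𝕜ˣ} {a : G × G} {x : H}
    (hx : x ∈ bihomogeneous p a) : cocycleAntipode (toralCocycle p χ) x =
      (((χ a.1 a.1)⁻¹ * χ a.2 a.2 : 𝕜ˣ) : 𝕜) • HopfAlgebra.antipode 𝕜 x := by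
  rw [mem_bihomogeneous] at hx
  have hΔ : comul ∘ₗ (p : H →ₐ[𝕜] MonoidAlgebra 𝕜 G).toLinearMap =
      p.tensorSq.toLinearMap ∘ₗ comul := by
    ext; exact (CoalgHomClass.map_comp_comul_apply p _).symm
  have hl : (toralForm p χ ∘ₗ (HopfAlgebra.antipode 𝕜).lTensor H) ∘ₗ comul =
      (bicharForm χ ∘ₗ (HopfAlgebra.antipode 𝕜).lTensor _ ∘ₗ comul) ∘ₗ
        (p : H →ₐ[𝕜] MonoidAlgebra 𝕜 G).toLinearMap := by
    simp only [LinearMap.comp_assoc, hΔ]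
    simp only [← LinearMap.comp_assoc]
    congr 1
    ext
    simp [p.map_antipode]
  have hr : (toralForm p χ⁻¹ ∘ₗ (HopfAlgebra.antipode 𝕜).rTensor H) ∘ₗ comul =
      (bicharForm χ⁻¹ ∘ₗ (HopfAlgebra.antipode 𝕜).rTensor _ ∘ₗ comul) ∘ₗ
        (p : H →ₐ[𝕜] MonoidAlgebra 𝕜 G).toLinearMap := by
    simp only [LinearMap.comp_assoc, hΔ]
    simp only [← LinearMap.comp_assoc]
    congr 1
    ext
    simp [p.map_antipode]
  refine Eq.trans ?_ ((convMul_apply_of_right _ (Algebra.linearMap 𝕜 H ∘ₗ bicharForm χ⁻¹ ∘ₗ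
    (HopfAlgebra.antipode 𝕜).rTensor _ ∘ₗ comul) (toConv (Algebra.linearMap 𝕜 H ∘ₗ
      (toralForm p χ ∘ₗ (HopfAlgebra.antipode 𝕜).lTensor H) ∘ₗ comul) *
        toConv (HopfAlgebra.antipode 𝕜)) hx.2).trans ?_)
  · rw [LinearMap.comp_assoc _ _ (Algebra.linearMap 𝕜 H), ← hr]
    rfl
  rw [hl]
  refine (congrArg (· * _) (convMul_apply_of_left _ (Algebra.linearMap 𝕜 H ∘ₗ bicharForm χ ∘ₗ
    (HopfAlgebra.antipode 𝕜).lTensor _ ∘ₗ comul) _ hx.1)).trans ?_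
  refine (algebraMap_mul_mul_algebraMap _ _ _).trans ?_
  simp

end Bidegree

/-! ### The deformed algebra and its Hopf structure maps. -/

section ToralDeformation

open WithConv Coalgebra

variable {𝕜 : Type*} [Field 𝕜] {G : Type*} [CommGroup G] {H : Type*} [Ring H] [HopfAlgebra 𝕜 H]
  (p : H →ₐc[𝕜] MonoidAlgebra 𝕜 G)

/-- The Hopf algebra `H` is spanned by elements that are homogeneous for both coactions. -/
class IsBigraded : Prop where
  iSup_eq_top : ⨆ a, bidegree p a = ⊤

/-- Spanning suffices for verifying linear identities on homogeneous elements; directness of the sum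
is not required. -/
lemma bidegree_induction [IsBigraded p] {P : H → Prop} (mem : ∀ a, ∀ x ∈ bidegree p a, P x)
    (zero : P 0) (add : ∀ x y, P x → P y → P (x + y)) (x : H) : P x :=
  Submodule.iSup_induction (bidegree p) (motive := P)
    (IsBigraded.iSup_eq_top (p := p) ▸ Submodule.mem_top : x ∈ ⨆ a, bidegree p a) mem zero add

lemma twistFactor_mul_left (χ : G →* G →* 𝕜ˣ) (a b c : G × G) :
    twistFactor χ (a * b) c = twistFactor χ a c * twistFactor χ b c := by
  simp [twistFactor, mul_mul_mul_comm, mul_comm]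

lemma twistFactor_mul_right (χ : G →* G →* 𝕜ˣ) (a b c : G × G) :
    twistFactor χ a (b * c) = twistFactor χ a b * twistFactor χ a c := by
  simp [twistFactor, mul_mul_mul_comm, mul_comm]

/-- The algebra `H_σ`, for the toral cocycle `σ = χ ∘ (p ⊗ p)`. -/
def ToralDeformation (_ : H →ₐc[𝕜] MonoidAlgebra 𝕜 G) (_ : G →* G →* 𝕜ˣ) : Type _ := H

namespace ToralDeformation

variable (χ : G →* G →* 𝕜ˣ)

instance : AddCommGroup (ToralDeformation p χ) := inferInstanceAs (AddCommGroup H)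

instance : Module 𝕜 (ToralDeformation p χ) := inferInstanceAs (Module 𝕜 H)

/-- The identity map, from `H` to `H_σ`. -/
def of : H ≃ₗ[𝕜] ToralDeformation p χ := LinearEquiv.refl 𝕜 H

instance : One (ToralDeformation p χ) := ⟨of p χ 1⟩

noncomputable instance : Mul (ToralDeformation p χ) :=
  ⟨fun x y ↦ of p χ (cocycleMul (toralCocycle p χ) ((of p χ).symm x ⊗ₜ (of p χ).symm y))⟩

lemma of_one : of p χ 1 = 1 := rfl

lemma of_mul_of (x y : H) :
    of p χ x * of p χ y = of p χ (cocycleMul (toralCocycle p χ) (x ⊗ₜ y)) := rfl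

variable {p χ}

/-- The weaker hypothesis matters for products of antipodes: membership in `bidegree` says of `S(x)`
only that it is bihomogeneous. -/
lemma of_mul_of_bihomogeneous {a b : G × G} {x y : H} (hx : x ∈ bihomogeneous p a)
    (hy : y ∈ bihomogeneous p b) :
    of p χ x * of p χ y = (twistFactor χ a b : 𝕜) • of p χ (x * y) := by
  rw [of_mul_of, cocycleMul_apply hx hy, map_smul]

lemma of_mul_of_mem {a b : G × G} {x y : H} (hx : x ∈ bidegree p a) (hy : y ∈ bidegree p b) :
    of p χ x * of p χ y = (twistFactor χ a b : 𝕜) • of p χ (x * y) :=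
  of_mul_of_bihomogeneous hx.1 hy.1

lemma induction [IsBigraded p] {P : ToralDeformation p χ → Prop}
    (mem : ∀ a, ∀ x ∈ bidegree p a, P (of p χ x))
    (zero : P 0) (add : ∀ x y, P x → P y → P (x + y)) (x : ToralDeformation p χ) : P x := by
  obtain ⟨x, rfl⟩ := (of p χ).surjective x
  exact bidegree_induction p (P := fun x ↦ P (of p χ x)) mem (by simpa using zero)
    (fun x y hx hy ↦ by simpa using add _ _ hx hy) x

protected lemma add_mul (x y z : ToralDeformation p χ) : (x + y) * z = x * z + y * z := by
  obtain ⟨x, rfl⟩ := (of p χ).surjective x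
  obtain ⟨y, rfl⟩ := (of p χ).surjective y
  obtain ⟨z, rfl⟩ := (of p χ).surjective z
  rw [← map_add, of_mul_of, of_mul_of, of_mul_of, TensorProduct.add_tmul, map_add, map_add]

protected lemma mul_add (x y z : ToralDeformation p χ) : x * (y + z) = x * y + x * z := by
  obtain ⟨x, rfl⟩ := (of p χ).surjective x
  obtain ⟨y, rfl⟩ := (of p χ).surjective y
  obtain ⟨z, rfl⟩ := (of p χ).surjective z
  rw [← map_add, of_mul_of, of_mul_of, of_mul_of, TensorProduct.tmul_add, map_add, map_add]

protected lemma smul_mul (r : 𝕜) (x y : ToralDeformation p χ) : r • x * y = r • (x * y) := by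
  obtain ⟨x, rfl⟩ := (of p χ).surjective x
  obtain ⟨y, rfl⟩ := (of p χ).surjective y
  rw [← map_smul, of_mul_of, of_mul_of, ← TensorProduct.smul_tmul', map_smul, map_smul]

protected lemma mul_smul (r : 𝕜) (x y : ToralDeformation p χ) : x * r • y = r • (x * y) := by
  obtain ⟨x, rfl⟩ := (of p χ).surjective x
  obtain ⟨y, rfl⟩ := (of p χ).surjective y
  rw [← map_smul, of_mul_of, of_mul_of, TensorProduct.tmul_smul, map_smul, map_smul]

protected lemma zero_mul (x : ToralDeformation p χ) : 0 * x = 0 := by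
  simpa using ToralDeformation.smul_mul (0 : 𝕜) 0 x

protected lemma mul_zero (x : ToralDeformation p χ) : x * 0 = 0 := by
  simpa using ToralDeformation.mul_smul (0 : 𝕜) x 0

variable [IsBigraded p]

/-- On homogeneous elements both bracketings rescale the undeformed triple product by the same three
pairwise factors, since `twistFactor` is bimultiplicative. -/
protected lemma mul_assoc (x y z : ToralDeformation p χ) : x * y * z = x * (y * z) := by
  induction x using induction with
  | zero => simp only [ToralDeformation.zero_mul]
  | add x x' hx hx' => simp only [ToralDeformation.add_mul, hx, hx']
  | mem a x hx =>
  induction y using induction with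
  | zero => simp only [ToralDeformation.zero_mul, ToralDeformation.mul_zero]
  | add y y' hy hy' => simp only [ToralDeformation.add_mul, ToralDeformation.mul_add, hy, hy']
  | mem b y hy =>
  induction z using induction with
  | zero => simp only [ToralDeformation.mul_zero]
  | add z z' hz hz' => simp only [ToralDeformation.mul_add, hz, hz']
  | mem c z hz =>
  rw [of_mul_of_mem hx hy, of_mul_of_mem hy hz, ToralDeformation.smul_mul,
    ToralDeformation.mul_smul, of_mul_of_mem (mul_mem_bidegree hx hy) hz,
    of_mul_of_mem hx (mul_mem_bidegree hy hz), twistFactor_mul_left, twistFactor_mul_right,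
    smul_smul, smul_smul, mul_assoc x]
  congr 1
  push_cast
  ring

noncomputable instance : Ring (ToralDeformation p χ) where
  __ := (inferInstance : AddCommGroup (ToralDeformation p χ))
  mul_assoc := ToralDeformation.mul_assoc
  one_mul x := by
    induction x using induction with
    | zero => exact ToralDeformation.mul_zero _
    | add x y hx hy => rw [ToralDeformation.mul_add, hx, hy]
    | mem a x hx =>
      rw [← of_one, of_mul_of_mem one_mem_bidegree hx]
      simp [twistFactor]
  mul_one x := by
    induction x using induction with
    | zero => exact ToralDeformation.zero_mul _
    | add x y hx hy => rw [ToralDeformation.add_mul, hx, hy]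
    | mem a x hx =>
      rw [← of_one, of_mul_of_mem hx one_mem_bidegree]
      simp [twistFactor]
  left_distrib := ToralDeformation.mul_add
  right_distrib := ToralDeformation.add_mul
  zero_mul := ToralDeformation.zero_mul
  mul_zero := ToralDeformation.mul_zero

noncomputable instance : Algebra 𝕜 (ToralDeformation p χ) :=
  .ofModule ToralDeformation.smul_mul ToralDeformation.mul_smul

variable (p χ)

/-- The coproduct of `H` is multiplicative for the deformed product. -/
noncomputable def comulHom :
    ToralDeformation p χ →ₐ[𝕜] ToralDeformation p χ ⊗[𝕜] ToralDeformation p χ :=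
  .ofLinearMap (TensorProduct.map (of p χ).toLinearMap (of p χ).toLinearMap ∘ₗ comul ∘ₗ
      (of p χ).symm.toLinearMap)
    (by simp [← of_one, Algebra.TensorProduct.one_def])
    (fun x y ↦ by
      obtain ⟨x, rfl⟩ := (of p χ).surjective x
      obtain ⟨y, rfl⟩ := (of p χ).surjective y
      have h := LinearMap.congr_fun (comul_comp_cocycleMul (toralCocycle p χ)) (x ⊗ₜ y)
      simp only [LinearMap.comp_apply, TensorProduct.comul_tmul] at h
      simp only [of_mul_of, LinearMap.comp_apply, LinearEquiv.coe_coe,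
        LinearEquiv.symm_apply_apply, h]
      induction comul (R := 𝕜) x with
      | zero => simp
      | add u v hu hv => simp only [add_mul, TensorProduct.add_tmul, map_add, hu, hv]
      | tmul a b =>
        induction comul (R := 𝕜) y with
        | zero => simp
        | add u v hu hv => simp only [mul_add, TensorProduct.tmul_add, map_add, hu, hv]
        | tmul c d => simp [of_mul_of])

lemma comulHom_of (x : H) : comulHom p χ (of p χ x) =
    TensorProduct.map (of p χ).toLinearMap (of p χ).toLinearMap (comul x) := rfl

/-- The counit of `H` is multiplicative for the deformed product. -/
noncomputable def counitHom : ToralDeformation p χ →ₐ[𝕜] 𝕜 :=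
  .ofLinearMap (counit ∘ₗ (of p χ).symm.toLinearMap) (by simp [← of_one])
    (fun x y ↦ by
      obtain ⟨x, rfl⟩ := (of p χ).surjective x
      obtain ⟨y, rfl⟩ := (of p χ).surjective y
      have h := LinearMap.congr_fun (counit_comp_cocycleMul (toralCocycle p χ)) (x ⊗ₜ y)
      simpa [of_mul_of, mul_comm] using h)

lemma counitHom_of (x : H) : counitHom p χ (of p χ x) = counit (R := 𝕜) x := rfl

/-- The deformed antipode is antimultiplicative for the deformed product. -/
noncomputable def antipodeHom : ToralDeformation p χ →ₐ[𝕜] (ToralDeformation p χ)ᵐᵒᵖ :=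
  .ofLinearMap ((MulOpposite.opLinearEquiv 𝕜).toLinearMap ∘ₗ (of p χ).toLinearMap ∘ₗ
      cocycleAntipode (toralCocycle p χ) ∘ₗ (of p χ).symm.toLinearMap)
    (by
      apply MulOpposite.unop_injective
      simp [← of_one, cocycleAntipode_apply one_mem_bihomogeneous])
    (fun x y ↦ by
      apply MulOpposite.unop_injective
      induction x using induction with
      | zero => simp
      | add x x' hx hx' =>
        simp only [add_mul, map_add, MulOpposite.unop_add, MulOpposite.unop_mul, hx, hx']
      | mem a x hx =>
      induction y using induction with
      | zero => simp
      | add y y' hy hy' =>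
        simp only [mul_add, map_add, MulOpposite.unop_add, MulOpposite.unop_mul, hy, hy']
      | mem b y hy =>
      have hSx := cocycleAntipode_apply (χ := χ) hx.1
      have hSy := cocycleAntipode_apply (χ := χ) hy.1
      have hSxy := cocycleAntipode_apply (χ := χ) (mul_mem_bidegree hx hy).1
      simp only [of_mul_of_mem hx hy, map_smul, LinearMap.comp_apply, LinearEquiv.coe_coe,
        LinearEquiv.symm_apply_apply, hSx, hSy, hSxy, MulOpposite.coe_opLinearEquiv,
        MulOpposite.unop_smul, MulOpposite.unop_op, MulOpposite.unop_mul, smul_mul_assoc,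
        mul_smul_comm, of_mul_of_bihomogeneous hy.2 hx.2, HopfAlgebra.antipode_mul_antidistrib,
        smul_smul, ← Units.val_mul]
      -- The scalars match because expanding `χ` at the product of the bidegrees `a`, `b` produces
      -- cross terms in both orders. One order cancels `twistFactor χ a b`; the other is the twist
      -- factor of the dual bidegrees of `b` and `a`.
      congr 2
      simp only [twistFactor, Prod.fst_mul, Prod.snd_mul, map_mul, map_inv, MonoidHom.mul_apply,
        MonoidHom.inv_apply, inv_inv]
      ext
      push_cast
      field_simp)

lemma antipodeHom_of (x : H) : antipodeHom p χ (of p χ x) =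
    MulOpposite.op (of p χ (cocycleAntipode (toralCocycle p χ) x)) := rfl

end ToralDeformation

end ToralDeformation

/-! ### Quantum Serre expressions under deformation. -/

section QSerreDeformation

variable {𝕜 : Type*} [Field 𝕜] {G : Type*} [CommGroup G] {H : Type*} [Ring H] [HopfAlgebra 𝕜 H]
  {p : H →ₐc[𝕜] MonoidAlgebra 𝕜 G} {χ : G →* G →* 𝕜ˣ} {a b : G × G} {x y : H}

lemma smul_mem_bidegree (r : 𝕜) (hx : x ∈ bidegree p a) : r • x ∈ bidegree p a :=
  Submodule.smul_mem _ r hx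

lemma qSerre_mem_bidegree (hx : x ∈ bidegree p a) (hy : y ∈ bidegree p b) (q c : 𝕜) (m : ℕ) :
    qSerre q c m x y ∈ bidegree p (a ^ m * b) := by
  induction m with
  | zero => simpa [qSerre_zero] using hy
  | succ m ih =>
    rw [qSerre_succ]
    refine sub_mem ?_ (smul_mem_bidegree _ ?_)
    · have h := mul_mem_bidegree hx ih
      rwa [← mul_assoc, ← pow_succ'] at h
    · have h := mul_mem_bidegree ih hx
      rwa [mul_right_comm, ← pow_succ] at h

/-- By `qSerre_succ` a Serre expression is an iterated skew commutator with `x`. Deformation scales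
left multiplication by `x` by `twistFactor χ a b` and right multiplication by `twistFactor χ b a`;
`hc` makes the deformed skew commutator a multiple of the original one with `c'` in place of `c`. -/
lemma qSerre_deformation [IsBigraded p] (hx : x ∈ bidegree p a) (hy : y ∈ bidegree p b)
    (haa : twistFactor χ a a = 1) (q : 𝕜) {c c' : 𝕜}
    (hc : c * twistFactor χ b a = twistFactor χ a b * c') (m : ℕ) :
    qSerre q c m (ToralDeformation.of p χ x) (ToralDeformation.of p χ y) =
      (twistFactor χ a b : 𝕜) ^ m • ToralDeformation.of p χ (qSerre q c' m x y) := by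
  -- Because `twistFactor χ a a = 1`, the factors `x` already accumulated contribute nothing, so
  -- every step of the recursion has the same scalars.
  have hr (m : ℕ) : twistFactor χ a (a ^ m * b) = twistFactor χ a b := by
    induction m with
    | zero => simp
    | succ m ih => rw [pow_succ', mul_assoc, twistFactor_mul_right, haa, one_mul, ih]
  have hl (m : ℕ) : twistFactor χ (a ^ m * b) a = twistFactor χ b a := by
    induction m with
    | zero => simp
    | succ m ih => rw [pow_succ', mul_assoc, twistFactor_mul_left, haa, one_mul, ih]
  induction m with
  | zero => simp [qSerre_zero]
  | succ m ih =>
    have hS := qSerre_mem_bidegree hx hy q c' m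
    rw [qSerre_succ, ih, qSerre_succ, mul_smul_comm, smul_mul_assoc,
      ToralDeformation.of_mul_of_mem hx hS, ToralDeformation.of_mul_of_mem hS hx, hr, hl, map_sub,
      map_smul, smul_sub, smul_smul, smul_smul, smul_smul, smul_smul, pow_succ]
    congr 2
    linear_combination (q ^ m * (twistFactor χ a b : 𝕜) ^ m) * hc

end QSerreDeformation

/-! ### Bidegrees in the quantum group, and relations among the deformed generators. -/

section MpQUEA

variable {𝕜 : Type*} [Field 𝕜] {n : ℕ} {A : Matrix (Fin n) (Fin n) ℤ}

namespace MpQUEA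

/-- The standard generators of the lattice. -/
def latticeGen (i : Fin n) : Lattice n := .ofAdd (Pi.single i 1)

/-- The bidegrees of the generators. -/
def genBidegree : Gen n → Lattice n × Lattice n
  | .e i => (latticeGen i, 1)
  | .f i => (1, latticeGen i)
  | .k i => (latticeGen i, latticeGen i)
  | .kInv i => ((latticeGen i)⁻¹, (latticeGen i)⁻¹)
  | .l i => (latticeGen i, latticeGen i)
  | .lInv i => ((latticeGen i)⁻¹, (latticeGen i)⁻¹)

variable (q : Multiparameter 𝕜 A)

lemma gen_mem_bihomogeneous (g : Gen n) :
    gen q g ∈ bihomogeneous (torusProj q) (genBidegree g) := by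
  have hp (g : Gen n) : torusProj q (gen q g) = torusGen g := torusAlgHom_gen q g
  have hp1 : torusProj q 1 = 1 := map_one _
  rw [mem_bihomogeneous, comul_gen]
  cases g <;>
    simp [hp, hp1, torusGen, genBidegree, latticeGen, MonoidAlgebra.one_def, ofAdd_neg]

lemma gen_mem_bidegree (g : Gen n) : gen q g ∈ bidegree (torusProj q) (genBidegree g) := by
  have h (g : Gen n) := gen_mem_bihomogeneous q g
  refine ⟨h g, ?_⟩
  change HopfAlgebra.antipode 𝕜 _ ∈ bihomogeneous _ _
  rw [antipode_gen]
  cases g with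
  | e i =>
    exact neg_mem (by
      simpa [genBidegree, dualBidegree] using mul_mem_bihomogeneous (h (.kInv i)) (h (.e i)))
  | f i =>
    exact neg_mem (by
      simpa [genBidegree, dualBidegree] using mul_mem_bihomogeneous (h (.f i)) (h (.lInv i)))
  | k i => exact h (.kInv i)
  | kInv i => simpa [genBidegree, dualBidegree] using h (.k i)
  | l i => exact h (.lInv i)
  | lInv i => simpa [genBidegree, dualBidegree] using h (.l i)

lemma gen_induction {P : U q → Prop}
    (algebraMap : ∀ r : 𝕜, P (algebraMap 𝕜 (U q) r)) (gen : ∀ g, P (gen q g))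
    (mul : ∀ a b, P a → P b → P (a * b)) (add : ∀ a b, P a → P b → P (a + b)) (x : U q) : P x := by
  obtain ⟨x, rfl⟩ := Ideal.Quotient.mk_surjective x
  induction x using PreAlg.induction with
  | algebraMap r => exact algebraMap r
  | gen g => exact gen g
  | mul a b ha hb => rw [map_mul]; exact mul _ _ ha hb
  | add a b ha hb => rw [map_add]; exact add _ _ ha hb

/-- The sum of a multiplicative family of submodules is a subalgebra, so containing the generators
forces it to be everything. The family is left general because it is used again with extra
conditions in `deformLin_deformLin`. -/
lemma iSup_eq_top_of_gen_mem {M : Type*} [Monoid M] (𝒜 : M → Submodule 𝕜 (U q))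
    (one_mem : 1 ∈ 𝒜 1) (mul_mem : ∀ {a b x y}, x ∈ 𝒜 a → y ∈ 𝒜 b → x * y ∈ 𝒜 (a * b))
    (gen_mem : ∀ g, ∃ a, gen q g ∈ 𝒜 a) : ⨆ a, 𝒜 a = ⊤ := by
  have hle (a : M) : 𝒜 a ≤ ⨆ a, 𝒜 a := le_iSup _ a
  rw [Submodule.eq_top_iff']
  intro x
  induction x using gen_induction with
  | algebraMap r =>
    rw [Algebra.algebraMap_eq_smul_one]
    exact Submodule.smul_mem _ _ (hle _ one_mem)
  | gen g => exact (gen_mem g).elim fun a ha ↦ hle _ ha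
  | add a b ha hb => exact add_mem ha hb
  | mul a b ha hb =>
    refine Submodule.iSup_induction 𝒜 (motive := fun a ↦ a * b ∈ ⨆ a, 𝒜 a) ha (fun i x hx ↦ ?_)
      (by simp) (fun x y hx hy ↦ by rw [add_mul]; exact add_mem hx hy)
    refine Submodule.iSup_induction 𝒜 (motive := fun b ↦ x * b ∈ ⨆ a, 𝒜 a) hb (fun j y hy ↦ ?_)
      (by simp) (fun y z hy hz ↦ by rw [mul_add]; exact add_mem hy hz)
    exact hle _ (mul_mem hx hy)

instance : IsBigraded (torusProj q) where
  iSup_eq_top := iSup_eq_top_of_gen_mem q _ one_mem_bidegree mul_mem_bidegree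
    fun g ↦ ⟨_, gen_mem_bidegree q g⟩

/-- The bicharacter `χ` twists the multiparameter `q'` into `q''`. -/
structure IsTwist (χ : Lattice n →* Lattice n →* 𝕜ˣ) (q' q'' : Multiparameter 𝕜 A) : Prop where
  diag : ∀ i, χ (latticeGen i) (latticeGen i) = 1
  val_eq : ∀ i j, q''.val i j =
    q'.val i j * χ (latticeGen i) (latticeGen j) * (χ (latticeGen j) (latticeGen i))⁻¹

variable {χ : Lattice n →* Lattice n →* 𝕜ˣ} {q' q'' : Multiparameter 𝕜 A}

/-- This symmetry supplies the inverse of the comparison map. -/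
lemma IsTwist.inv (h : IsTwist χ q' q'') : IsTwist χ⁻¹ q'' q' where
  diag i := by simp [h.diag]
  val_eq i j := by
    rw [h.val_eq]
    simp only [MonoidHom.inv_apply, inv_inv]
    rw [mul_right_comm _ _⁻¹ _⁻¹, inv_mul_cancel_right, mul_inv_cancel_right]

lemma IsTwist.val_diag (h : IsTwist χ q' q'') (i : Fin n) : q''.val i i = q'.val i i := by
  simp [h.val_eq, h.diag]

open ToralDeformation

/-- A generator of `U_q`, as an element of a toral deformation. -/
noncomputable abbrev dgen (χ : Lattice n →* Lattice n →* 𝕜ˣ) (g : Gen n) : ToralDeformation (torusProj q) χ :=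
  of (torusProj q) χ (gen q g)

lemma dgen_mul (g h : Gen n) : dgen q χ g * dgen q χ h =
    (twistFactor χ (genBidegree g) (genBidegree h) : 𝕜) • of (torusProj q) χ (gen q g * gen q h) :=
  of_mul_of_mem (gen_mem_bidegree q g) (gen_mem_bidegree q h)

lemma dgen_mul_mul (g h k : Gen n) : dgen q χ g * dgen q χ h * dgen q χ k =
    ((twistFactor χ (genBidegree g) (genBidegree h) *
        (twistFactor χ (genBidegree g) (genBidegree k) *
          twistFactor χ (genBidegree h) (genBidegree k)) : 𝕜ˣ) : 𝕜) •
      of (torusProj q) χ (gen q g * gen q h * gen q k) := by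
  rw [dgen_mul, smul_mul_assoc, of_mul_of_mem (mul_mem_bidegree (gen_mem_bidegree q g)
    (gen_mem_bidegree q h)) (gen_mem_bidegree q k), smul_smul, twistFactor_mul_left,
    ← Units.val_mul]

/-- The quotient map. -/
def proj : PreAlg q.val →ₐ[𝕜] U q := Ideal.Quotient.mkₐ 𝕜 (serreIdeal q).asIdeal

lemma proj_gen (g : Gen n) : proj q (PreAlg.gen q.val g) = gen q g := rfl

/-- Each relation of `q''` becomes the corresponding relation of `q'` once its monomials are
rescaled. Toral generators have equal left and right degrees, so their mutual twist factors are `1`;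
only conjugation of `E_j` and `F_j` changes. -/
lemma dgen_rel (h : IsTwist χ q' q'') ⦃x y : FreeAlgebra 𝕜 (Gen n)⦄ (hxy : PreRel q''.val x y) :
    FreeAlgebra.lift 𝕜 (dgen q' χ) x = FreeAlgebra.lift 𝕜 (dgen q' χ) y := by
  induction hxy with
  | k_kInv i =>
    have := congrArg (proj q') (PreAlg.k_kInv (q := q'.val) i)
    simp only [map_mul, map_one, proj_gen] at this
    simp [dgen_mul, genBidegree, twistFactor, this, of_one]
  | kInv_k i =>
    have := congrArg (proj q') (PreAlg.kInv_k (q := q'.val) i)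
    simp only [map_mul, map_one, proj_gen] at this
    simp [dgen_mul, genBidegree, twistFactor, this, of_one]
  | l_lInv i =>
    have := congrArg (proj q') (PreAlg.l_lInv (q := q'.val) i)
    simp only [map_mul, map_one, proj_gen] at this
    simp [dgen_mul, genBidegree, twistFactor, this, of_one]
  | lInv_l i =>
    have := congrArg (proj q') (PreAlg.lInv_l (q := q'.val) i)
    simp only [map_mul, map_one, proj_gen] at this
    simp [dgen_mul, genBidegree, twistFactor, this, of_one]
  | k_l i j =>
    have := congrArg (proj q') (PreAlg.k_l (q := q'.val) i j)
    simp only [map_mul, proj_gen] at this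
    simp [dgen_mul, genBidegree, twistFactor, this]
  | k_k i j =>
    have := congrArg (proj q') (PreAlg.k_k (q := q'.val) i j)
    simp only [map_mul, proj_gen] at this
    simp [dgen_mul, genBidegree, twistFactor, this]
  | l_l i j =>
    have := congrArg (proj q') (PreAlg.l_l (q := q'.val) i j)
    simp only [map_mul, proj_gen] at this
    simp [dgen_mul, genBidegree, twistFactor, this]
  | k_e i j =>
    have := congrArg (proj q') (PreAlg.k_e' (q := q'.val) i j)
    simp only [map_mul, map_smul, proj_gen] at this
    -- The twist factors of the pairs `K_i, E_j` and `E_j, K_i⁻¹` multiply to `χ(g_i, g_j) χ(g_j,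
    -- g_i)⁻¹`, the ratio of `q''_{ij}` to `q'_{ij}`.
    simp only [map_mul, map_smul, FreeAlgebra.lift_ι_apply, dgen_mul_mul, this, smul_smul,
      h.val_eq, ← Units.val_mul]
    congr 2
    simp [genBidegree, twistFactor, h.diag]
    ext
    push_cast
    field_simp
  | l_e i j =>
    have := congrArg (proj q') (PreAlg.l_e' (q := q'.val) i j)
    simp only [map_mul, map_smul, proj_gen] at this
    simp only [map_mul, map_smul, FreeAlgebra.lift_ι_apply, dgen_mul_mul, this, smul_smul,
      h.val_eq, ← Units.val_mul, ← Units.val_inv_eq_inv_val]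
    congr 2
    simp [genBidegree, twistFactor, h.diag]
    ext
    push_cast
    field_simp
  | k_f i j =>
    have := congrArg (proj q') (PreAlg.k_f' (q := q'.val) i j)
    simp only [map_mul, map_smul, proj_gen] at this
    simp only [map_mul, map_smul, FreeAlgebra.lift_ι_apply, dgen_mul_mul, this, smul_smul,
      h.val_eq, ← Units.val_mul, ← Units.val_inv_eq_inv_val]
    congr 2
    simp [genBidegree, twistFactor, h.diag]
    ext
    push_cast
    field_simp
  | l_f i j =>
    have := congrArg (proj q') (PreAlg.l_f' (q := q'.val) i j)
    simp only [map_mul, map_smul, proj_gen] at this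
    simp only [map_mul, map_smul, FreeAlgebra.lift_ι_apply, dgen_mul_mul, this, smul_smul,
      h.val_eq, ← Units.val_mul]
    congr 2
    simp [genBidegree, twistFactor, h.diag]
    ext
    push_cast
    field_simp
  | e_f i j =>
    have := congrArg (proj q') (PreAlg.e_f (q := q'.val) i j)
    simp only [map_sub, map_mul, proj_gen] at this
    -- The bidegrees `(g_i, 1)` and `(1, g_j)` have no component in common, so both orders have
    -- twist factor `1`; the coefficient is unchanged because the diagonal parameters are.
    simp only [map_sub, map_mul, FreeAlgebra.lift_ι_apply, dgen_mul, genBidegree, twistFactor,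
      map_one, MonoidHom.one_apply, inv_one, mul_one, Units.val_one, one_smul]
    rw [← map_sub, this, h.val_diag]
    split_ifs <;> simp [proj_gen]

end MpQUEA

end MpQUEA

/-! ### The comparison isomorphism with the deformed quantum group. -/

section MpQUEA

variable {𝕜 : Type*} [Field 𝕜] {n : ℕ} {A : Matrix (Fin n) (Fin n) ℤ}

namespace MpQUEA

open ToralDeformation Coalgebra

variable {χ : Lattice n →* Lattice n →* 𝕜ˣ} {q' q'' : Multiparameter 𝕜 A}

/-- The map from `PreAlg q''` to the deformation of `U_{q'}` that fixes the generators. -/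
noncomputable def preDeformHom (h : IsTwist χ q' q'') :
    PreAlg q''.val →ₐ[𝕜] ToralDeformation (torusProj q') χ :=
  PreAlg.lift (dgen q' χ) (dgen_rel h)

/-- The normalization `χ(g_i, g_i) = 1` makes `qSerre_deformation` applicable, and its scalar
condition is the equation `q''_{ij} χ(g_j, g_i) = χ(g_i, g_j) q'_{ij}` defining a twist. -/
lemma preDeformHom_serreE (h : IsTwist χ q' q'') {i j : Fin n} (hij : i ≠ j) :
    preDeformHom h (serreE q'' i j) = 0 := by
  rw [serreE, map_qSerre, preDeformHom, PreAlg.lift_gen, PreAlg.lift_gen,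
    qSerre_deformation (gen_mem_bidegree q' _) (gen_mem_bidegree q' _)
      (by simp [twistFactor, genBidegree, h.diag]) _ (c' := (q'.val i j : 𝕜))
      (by simp [twistFactor, genBidegree, h.val_eq]; field_simp), h.val_diag,
    ← proj_gen, ← proj_gen, ← map_qSerre]
  have h0 : proj q' (serreE q' i j) = 0 :=
    Ideal.Quotient.eq_zero_iff_mem.mpr (TwoSidedIdeal.mem_asIdeal.mpr (serreE_mem q' hij))
  rw [serreE] at h0
  rw [h0, map_zero, smul_zero]

/-- The `F`'s have only right degrees, so twist factors are inverted; this matches the transposed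
parameter `q_{ji}` in their Serre relation. -/
lemma preDeformHom_serreF (h : IsTwist χ q' q'') {i j : Fin n} (hij : i ≠ j) :
    preDeformHom h (serreF q'' i j) = 0 := by
  rw [serreF, map_qSerre, preDeformHom, PreAlg.lift_gen, PreAlg.lift_gen,
    qSerre_deformation (gen_mem_bidegree q' _) (gen_mem_bidegree q' _)
      (by simp [twistFactor, genBidegree, h.diag]) _ (c' := (q'.val j i : 𝕜))
      (by simp [twistFactor, genBidegree, h.val_eq]; field_simp), h.val_diag,
    ← proj_gen, ← proj_gen, ← map_qSerre]
  have h0 : proj q' (serreF q' i j) = 0 :=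
    Ideal.Quotient.eq_zero_iff_mem.mpr (TwoSidedIdeal.mem_asIdeal.mpr (serreF_mem q' hij))
  rw [serreF] at h0
  rw [h0, map_zero, smul_zero]

/-- The map from `U_{q''}` to the deformation of `U_{q'}` that fixes the generators. -/
noncomputable def deformHom (h : IsTwist χ q' q'') :
    U q'' →ₐ[𝕜] ToralDeformation (torusProj q') χ :=
  Ideal.Quotient.liftₐ _ (preDeformHom h) fun x hx ↦ by
    have hle : serreIdeal q'' ≤ TwoSidedIdeal.ker (preDeformHom h) := by
      refine TwoSidedIdeal.span_le.mpr ?_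
      rintro _ ⟨i, j, hij, rfl | rfl⟩
      · exact (TwoSidedIdeal.mem_ker _).mpr (preDeformHom_serreE h hij)
      · exact (TwoSidedIdeal.mem_ker _).mpr (preDeformHom_serreF h hij)
    exact (TwoSidedIdeal.mem_ker _).mp (hle (TwoSidedIdeal.mem_asIdeal.mp hx))

lemma deformHom_gen (h : IsTwist χ q' q'') (g : Gen n) :
    deformHom h (gen q'' g) = of (torusProj q') χ (gen q' g) :=
  PreAlg.lift_gen _ _ g

/-- The linear map underlying `deformHom`. -/
noncomputable def deformLin (h : IsTwist χ q' q'') : U q'' →ₗ[𝕜] U q' :=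
  (of (torusProj q') χ).symm.toLinearMap ∘ₗ (deformHom h).toLinearMap

lemma of_deformLin (h : IsTwist χ q' q'') (x : U q'') :
    of (torusProj q') χ (deformLin h x) = deformHom h x := rfl

lemma deformLin_gen (h : IsTwist χ q' q'') (g : Gen n) : deformLin h (gen q'' g) = gen q' g := by
  rw [← (of (torusProj q') χ).injective.eq_iff, of_deformLin, deformHom_gen]

lemma deformLin_one (h : IsTwist χ q' q'') : deformLin h 1 = 1 :=
  map_one (deformHom h)

lemma deformLin_mul (h : IsTwist χ q' q'') (x y : U q'') : deformLin h (x * y) =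
    cocycleMul (toralCocycle (torusProj q') χ) (deformLin h x ⊗ₜ deformLin h y) :=
  map_mul (deformHom h) x y

/-- Both sides are algebra maps into the opposite of the deformed algebra, so comparison on
generators is enough. -/
lemma deformLin_antipode (h : IsTwist χ q' q'') (x : U q'') :
    deformLin h (HopfAlgebra.antipode 𝕜 x) =
      cocycleAntipode (toralCocycle (torusProj q') χ) (deformLin h x) := by
  have key : (AlgHom.op (deformHom h)).comp (HopfAlgebra.antipodeAlgHomOp 𝕜 (U q'')) =
      (antipodeHom (torusProj q') χ).comp (deformHom h) := by
    refine hom_ext q'' fun g ↦ MulOpposite.unop_injective ?_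
    rw [AlgHom.comp_apply, AlgHom.comp_apply, deformHom_gen, antipodeHom_of,
      cocycleAntipode_apply (gen_mem_bihomogeneous q' g), antipode_gen]
    change deformHom h (HopfAlgebra.antipode 𝕜 (gen q'' g)) = _
    rw [antipode_gen]
    cases g <;> simp [deformHom_gen, dgen_mul, genBidegree, twistFactor, h.diag]
  exact congrArg MulOpposite.unop (DFunLike.congr_fun key x)

lemma counit_deformLin (h : IsTwist χ q' q'') (x : U q'') :
    counit (R := 𝕜) (deformLin h x) = counit (R := 𝕜) x := by
  have key : (counitHom (torusProj q') χ).comp (deformHom h) = Bialgebra.counitAlgHom 𝕜 _ := by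
    refine hom_ext q'' fun g ↦ ?_
    rw [AlgHom.comp_apply, deformHom_gen, counitHom_of, Bialgebra.counitAlgHom_apply, counit_gen,
      counit_gen]
  exact DFunLike.congr_fun key x

lemma comul_deformLin (h : IsTwist χ q' q'') (x : U q'') :
    comul (deformLin h x) = TensorProduct.map (deformLin h) (deformLin h) (comul (R := 𝕜) x) := by
  have key : (ToralDeformation.comulHom (torusProj q') χ).comp (deformHom h) =
      (Algebra.TensorProduct.map (deformHom h) (deformHom h)).comp
        (Bialgebra.comulAlgHom 𝕜 _) := by
    refine hom_ext q'' fun g ↦ ?_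
    rw [AlgHom.comp_apply, AlgHom.comp_apply, deformHom_gen, comulHom_of,
      Bialgebra.comulAlgHom_apply, comul_gen, comul_gen]
    cases g <;> simp [deformHom_gen, of_one]
  apply (TensorProduct.congr (of (torusProj q') χ) (of (torusProj q') χ)).injective
  refine (DFunLike.congr_fun key x).trans ?_
  have h2 := TensorProduct.map_comp (of (torusProj q') χ).toLinearMap
    (of (torusProj q') χ).toLinearMap (deformLin h) (deformLin h)
  exact LinearMap.congr_fun h2 (comul (R := 𝕜) x)

variable {χ' : Lattice n →* Lattice n →* 𝕜ˣ}

/-- Each map is multiplicative only up to deformation, so the composite is not visibly an algebra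
map. The argument follows elements that have the same bidegree in both algebras and are fixed by the
composite: these are closed under products, contain the generators, and hence span. -/
lemma deformLin_deformLin (hχ : χ * χ' = 1) (h : IsTwist χ q' q'') (h' : IsTwist χ' q'' q')
    (x : U q'') : deformLin h' (deformLin h x) = x := by
  have htop := iSup_eq_top_of_gen_mem q''
    (fun a ↦ bidegree (torusProj q'') a ⊓ (bidegree (torusProj q') a).comap (deformLin h) ⊓
      LinearMap.eqLocus (deformLin h' ∘ₗ deformLin h) LinearMap.id)
    ⟨⟨one_mem_bidegree, by
      change deformLin h 1 ∈ bidegree (torusProj q') 1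
      rw [deformLin_one]; exact one_mem_bidegree⟩, by
      change deformLin h' (deformLin h 1) = 1
      rw [deformLin_one, deformLin_one]⟩
    (fun {a b x y} hx hy ↦ by
      obtain ⟨⟨hx1, hx2⟩, hx3⟩ := hx
      obtain ⟨⟨hy1, hy2⟩, hy3⟩ := hy
      change deformLin h x ∈ bidegree (torusProj q') a at hx2
      change deformLin h y ∈ bidegree (torusProj q') b at hy2
      change deformLin h' (deformLin h x) = x at hx3
      change deformLin h' (deformLin h y) = y at hy3
      have hm := deformLin_mul h x y
      rw [cocycleMul_apply hx2.1 hy2.1] at hm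
      refine ⟨⟨mul_mem_bidegree hx1 hy1, ?_⟩, ?_⟩
      · change deformLin h (x * y) ∈ bidegree (torusProj q') (a * b)
        rw [hm]
        exact smul_mem_bidegree _ (mul_mem_bidegree hx2 hy2)
      · change deformLin h' (deformLin h (x * y)) = x * y
        -- A product is rescaled once by `χ` and once by `χ' = χ⁻¹`, at the same bidegrees.
        have hf : twistFactor χ a b * twistFactor χ' a b = 1 := by
          obtain rfl : χ' = χ⁻¹ := (inv_eq_of_mul_eq_one_right hχ).symm
          simp [twistFactor, mul_mul_mul_comm]
        rw [hm, map_smul, deformLin_mul, hx3, hy3, cocycleMul_apply hx1.1 hy1.1, smul_smul,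
          ← Units.val_mul, hf, Units.val_one, one_smul])
    (fun g ↦ ⟨genBidegree g, ⟨gen_mem_bidegree q'' g, by
      change deformLin h _ ∈ bidegree (torusProj q') (genBidegree g)
      rw [deformLin_gen]; exact gen_mem_bidegree q' g⟩, by
      change deformLin h' (deformLin h _) = _
      rw [deformLin_gen, deformLin_gen]; rfl⟩)
  have hx : x ∈ LinearMap.eqLocus (deformLin h' ∘ₗ deformLin h) LinearMap.id := by
    have hle := iSup_le fun a ↦ inf_le_right (a := bidegree (torusProj q'') a ⊓
      (bidegree (torusProj q') a).comap (deformLin h))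
      (b := LinearMap.eqLocus (deformLin h' ∘ₗ deformLin h) LinearMap.id)
    rw [htop] at hle
    exact hle trivial
  exact hx

/-- The isomorphism of coalgebras from `U_{q''}` to `U_{q'}` that fixes the generators. -/
noncomputable def deformEquiv (h : IsTwist χ q' q'') : U q'' ≃ₗc[𝕜] U q' where
  toLinearMap := deformLin h
  counit_comp := LinearMap.ext (counit_deformLin h)
  map_comp_comul := LinearMap.ext fun x ↦ (comul_deformLin h x).symm
  invFun := deformLin h.inv
  left_inv := deformLin_deformLin (mul_inv_cancel χ) h h.inv
  right_inv := deformLin_deformLin (inv_mul_cancel χ) h.inv h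

lemma isToralDeformation_torusProj (h : IsTwist χ q' q'') :
    IsToralDeformation (torusProj q') (U q'') :=
  ⟨χ, toralCocycle _ χ, toralCocycle_tmul _ χ, isHopfTwoCocycle_toralCocycle _ χ,
    deformEquiv h, deformLin_one h, deformLin_mul h, deformLin_antipode h⟩

end MpQUEA

end MpQUEA

/-! ### Restricting toral deformations to Hopf subalgebras. -/

section Restriction

variable {𝕜 : Type*} [Field 𝕜] {G : Type*} [CommGroup G] {H : Type*} [Ring H] [HopfAlgebra 𝕜 H]
  (p : H →ₐc[𝕜] MonoidAlgebra 𝕜 G) {B : Type*} [Ring B] [HopfAlgebra 𝕜 B] (f : B →ₐc[𝕜] H)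
  (χ : G →* G →* 𝕜ˣ)

lemma cocycleMul_toralCocycle_comp (x y : B) :
    f (cocycleMul (toralCocycle (p.comp f) χ) (x ⊗ₜ y)) =
      cocycleMul (toralCocycle p χ) (f x ⊗ₜ f y) :=
  map_cocycleMul (toralCocycle_comp p f χ) _

/-- A toral deformation restricts to Hopf subalgebras that correspond to each other. -/
lemma IsToralDeformation.restrict {H' : Type*} [Ring H'] [HopfAlgebra 𝕜 H'] {B' : Type*} [Ring B']
    [HopfAlgebra 𝕜 B'] (f' : B' →ₐc[𝕜] H') (hf : Function.Injective f)
    (hf' : Function.Injective f') (φ : H' ≃ₗc[𝕜] H) (h1 : φ 1 = 1)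
    (hmul : ∀ x y, φ (x * y) = cocycleMul (toralCocycle p χ) (φ x ⊗ₜ φ y))
    (hS : ∀ x, φ (HopfAlgebra.antipode 𝕜 x) = cocycleAntipode (toralCocycle p χ) (φ x))
    (hle : ∀ b', ∃ b, f b = φ (f' b')) (hge : ∀ b, ∃ b', φ (f' b') = f b) :
    IsToralDeformation (p.comp f) B' := by
  -- Injectivity of `f` makes the chosen preimage unique, hence linear in `b'`; all further
  -- identities are likewise checked after applying `f`.
  choose e he using hle
  let E : B' →ₗ[𝕜] B :=
    { toFun := e
      map_add' x y := hf (by simp [he])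
      map_smul' r x := hf (by simp [he]) }
  have hE (x : B') : f (E x) = φ (f' x) := he x
  have hbij : Function.Bijective E := by
    refine ⟨fun x y hxy ↦ hf' (φ.injective ?_), fun b ↦ ?_⟩
    · exact (hE x).symm.trans ((congrArg f hxy).trans (hE y))
    · obtain ⟨b', hb'⟩ := hge b
      exact ⟨b', hf (by rw [hE, hb'])⟩
  -- Over a field `f ⊗ f` stays injective, so compatibility with coproducts can be checked in `H ⊗
  -- H`.
  have hff : Function.Injective (TensorProduct.map (f : B →ₐ[𝕜] H).toLinearMap
      (f : B →ₐ[𝕜] H).toLinearMap) := TensorProduct.map_injective_of_flat_flat _ _ hf hf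
  let Ec : B' →ₗc[𝕜] B :=
    { E with
      counit_comp := by
        ext x
        have h := CoalgHomClass.counit_comp_apply f (E x)
        rw [hE, CoalgHomClass.counit_comp_apply, CoalgHomClass.counit_comp_apply] at h
        exact h.symm
      map_comp_comul := by
        ext x
        apply hff
        have h2 : (f : B →ₐ[𝕜] H).toLinearMap ∘ₗ E =
            (φ : H' →ₗc[𝕜] H).toLinearMap ∘ₗ (f' : B' →ₐ[𝕜] H').toLinearMap :=
          LinearMap.ext hE
        have h3 := CoalgHomClass.map_comp_comul_apply f (E x)
        rw [hE, ← CoalgHomClass.map_comp_comul_apply φ, ← CoalgHomClass.map_comp_comul_apply f']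
          at h3
        refine Eq.trans ?_ h3.symm
        have h4 := TensorProduct.map_comp (f : B →ₐ[𝕜] H).toLinearMap
          (f : B →ₐ[𝕜] H).toLinearMap E E
        rw [h2, TensorProduct.map_comp] at h4
        exact (LinearMap.congr_fun h4 _).symm }
  refine ⟨χ, toralCocycle _ χ, toralCocycle_tmul _ χ, isHopfTwoCocycle_toralCocycle _ χ,
    { Ec, LinearEquiv.ofBijective E hbij with }, hf ?_, fun x y ↦ hf ?_, fun x ↦ hf ?_⟩
  · exact (hE 1).trans (by rw [map_one f', h1, map_one f])
  · refine (hE _).trans ?_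
    rw [map_mul, hmul, ← hE, ← hE, cocycleMul_toralCocycle_comp]
    rfl
  · refine (hE _).trans ?_
    rw [f'.map_antipode, hS, ← hE, map_cocycleAntipode (toralCocycle_comp p f χ)]
    rfl

end Restriction

/-! ### Borel subalgebras, and the bicharacter attached to a twist equivalence. -/

section MpQUEA

variable {𝕜 : Type*} [Field 𝕜] {n : ℕ} {A : Matrix (Fin n) (Fin n) ℤ}

namespace MpQUEA

variable {χ : Lattice n →* Lattice n →* 𝕜ˣ} {q' q'' : Multiparameter 𝕜 A}

/-- The inclusion of the positive quantum Borel subalgebra. -/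
noncomputable abbrev inclPos (q : Multiparameter 𝕜 A) : borelPos q →ₐc[𝕜] U q :=
  (isHopfSubalgebra_borelPos q).incl

/-- The inclusion of the negative quantum Borel subalgebra. -/
noncomputable abbrev inclNeg (q : Multiparameter 𝕜 A) : borelNeg q →ₐc[𝕜] U q :=
  (isHopfSubalgebra_borelNeg q).incl

lemma deformLin_algebraMap (h : IsTwist χ q' q'') (r : 𝕜) :
    deformLin h (algebraMap 𝕜 _ r) = algebraMap 𝕜 _ r := by
  rw [Algebra.algebraMap_eq_smul_one, map_smul, deformLin_one, ← Algebra.algebraMap_eq_smul_one]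

lemma deformLin_mem_borelPos (h : IsTwist χ q' q'') {x : U q''} (hx : x ∈ borelPos q'') :
    deformLin h x ∈ borelPos q' := by
  induction hx using Algebra.adjoin_induction with
  | mem x hx =>
    obtain ⟨i, rfl | rfl | rfl⟩ := hx <;> rw [deformLin_gen] <;>
      refine Algebra.subset_adjoin ⟨i, ?_⟩ <;> simp
  | algebraMap r => rw [deformLin_algebraMap]; exact Subalgebra.algebraMap_mem _ r
  | add x y _ _ hx hy => rw [map_add]; exact add_mem hx hy
  | mul x y _ _ hx hy =>
    rw [deformLin_mul]
    -- By naturality the deformed product of two Borel elements is the image of a deformed product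
    -- formed inside the Borel subalgebra, so it stays there.
    exact cocycleMul_toralCocycle_comp (torusProj q') (inclPos q') χ ⟨_, hx⟩ ⟨_, hy⟩ ▸
      Subtype.property (p := (· ∈ borelPos q')) _

lemma deformLin_mem_borelNeg (h : IsTwist χ q' q'') {x : U q''} (hx : x ∈ borelNeg q'') :
    deformLin h x ∈ borelNeg q' := by
  induction hx using Algebra.adjoin_induction with
  | mem x hx =>
    obtain ⟨i, rfl | rfl | rfl⟩ := hx <;> rw [deformLin_gen] <;>
      refine Algebra.subset_adjoin ⟨i, ?_⟩ <;> simp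
  | algebraMap r => rw [deformLin_algebraMap]; exact Subalgebra.algebraMap_mem _ r
  | add x y _ _ hx hy => rw [map_add]; exact add_mem hx hy
  | mul x y _ _ hx hy =>
    rw [deformLin_mul]
    exact cocycleMul_toralCocycle_comp (torusProj q') (inclNeg q') χ ⟨_, hx⟩ ⟨_, hy⟩ ▸
      Subtype.property (p := (· ∈ borelNeg q')) _

lemma deformEquiv_symm_apply (h : IsTwist χ q' q'') (x : U q') :
    deformEquiv h (deformLin h.inv x) = x :=
  (deformEquiv h).toLinearEquiv.right_inv x

/-- Preservation of the Borel subalgebra by the inverse twist supplies surjectivity of the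
restricted map. -/
lemma isToralDeformation_torusProjPos (h : IsTwist χ q' q'') :
    IsToralDeformation (torusProjPos q') (borelPos q'') :=
  IsToralDeformation.restrict (torusProj q') (inclPos q') χ (inclPos q'') Subtype.val_injective
    Subtype.val_injective (deformEquiv h) (deformLin_one h) (deformLin_mul h) (deformLin_antipode h)
    (fun b ↦ ⟨⟨_, deformLin_mem_borelPos h b.2⟩, rfl⟩)
    (fun b ↦ ⟨⟨_, deformLin_mem_borelPos h.inv b.2⟩, deformEquiv_symm_apply h _⟩)

lemma isToralDeformation_torusProjNeg (h : IsTwist χ q' q'') :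
    IsToralDeformation (torusProjNeg q') (borelNeg q'') :=
  IsToralDeformation.restrict (torusProj q') (inclNeg q') χ (inclNeg q'') Subtype.val_injective
    Subtype.val_injective (deformEquiv h) (deformLin_one h) (deformLin_mul h) (deformLin_antipode h)
    (fun b ↦ ⟨⟨_, deformLin_mem_borelNeg h b.2⟩, rfl⟩)
    (fun b ↦ ⟨⟨_, deformLin_mem_borelNeg h.inv b.2⟩, deformEquiv_symm_apply h _⟩)

/-- The homomorphism from the lattice with prescribed values on the generators. -/
def latticeHom {M : Type*} [CommGroup M] (t : Fin n → M) : Lattice n →* M where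
  toFun x := ∏ i, t i ^ x.toAdd i
  map_one' := by simp
  map_mul' x y := by simp [zpow_add, Finset.prod_mul_distrib]

lemma latticeHom_gen {M : Type*} [CommGroup M] (t : Fin n → M) (i : Fin n) :
    latticeHom t (latticeGen i) = t i := by
  change ∏ j, t j ^ (Pi.single i 1 : Fin n → ℤ) j = t i
  rw [Finset.prod_eq_single i (fun j _ hj ↦ by simp [hj]) (by simp)]
  simp

/-- Only the ratio `χ(g_i, g_j) / χ(g_j, g_i)` is prescribed, so the whole correction can be placed
on the entries `i < j`, with no square roots. For `i < j` the twist equation is then immediate, on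
the diagonal it is `q'_{ii} = q''_{ii}`, and for `i > j` it follows from the equality of the
products `q_{ij} q_{ji}`. -/
lemma _root_.TwistEquiv.exists_isTwist (h : TwistEquiv q' q'') :
    ∃ χ : Lattice n →* Lattice n →* 𝕜ˣ, IsTwist χ q' q'' := by
  let t (i j : Fin n) : 𝕜ˣ := if i < j then q''.val i j / q'.val i j else 1
  have ht (i j : Fin n) : latticeHom (fun i ↦ latticeHom (t i)) (latticeGen i) (latticeGen j) =
      t i j := by
    rw [latticeHom_gen, latticeHom_gen]
  refine ⟨latticeHom fun i ↦ latticeHom (t i), fun i ↦ ?_, fun i j ↦ ?_⟩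
  · simp [ht, t]
  · rw [ht, ht]
    rcases lt_trichotomy i j with hij | rfl | hij
    · simp [t, hij, hij.not_gt]
    · simp [t, h.2]
    · simp only [t, hij, hij.not_gt, if_true, if_false, mul_one, inv_div]
      rw [← mul_div_assoc, eq_div_iff_mul_eq', mul_comm, h.1 i j, mul_comm]

end MpQUEA

/-- Symmetrizability gives `s^{d_i a_{ij} + d_j a_{ji}} = s^{2 d_i a_{ij}} = q_{ii}^{a_{ij}}`, and
`a_{ii} = 2` handles the diagonal. -/
lemma Multiparameter.IsCartanType.twistEquiv_canonical {q : Multiparameter 𝕜 A}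
    (hq : q.IsCartanType) {d : Fin n → ℤ} (hA : IsSymmetrizedBy A d) (s : 𝕜ˣ)
    (hs : ∀ i, q.val i i = s ^ (2 * d i)) : TwistEquiv (q.canonical hA s hs) q := by
  refine ⟨fun i j ↦ ?_, fun i ↦ ?_⟩
  · change s ^ (d i * A i j) * s ^ (d j * A j i) = _
    rw [hq, hs, ← zpow_add, ← zpow_mul, ← hA.symm i j]
    congr 1
    ring
  · change s ^ (d i * A i i) = _
    rw [hA.diag, hs, mul_comm]

end MpQUEA

theorem mainTheorem5 {𝕜 : Type*} [Field 𝕜] [CharZero 𝕜] {n : ℕ} (A : Matrix (Fin n) (Fin n) ℤ)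
    (d : Fin n → ℤ) (hA : IsSymmetrizedBy A d) :
    (∀ q' q'' : Multiparameter 𝕜 A, TwistEquiv q' q'' →
      IsToralDeformation (MpQUEA.torusProj q') (MpQUEA.U q'') ∧
      IsToralDeformation (MpQUEA.torusProjPos q') (MpQUEA.borelPos q'') ∧
      IsToralDeformation (MpQUEA.torusProjNeg q') (MpQUEA.borelNeg q'')) ∧
    (∀ q : Multiparameter 𝕜 A, q.IsCartanType →
      ∀ (s : 𝕜ˣ) (hs : ∀ i, q.val i i = s ^ (2 * d i)),
        IsToralDeformation (MpQUEA.torusProj (q.canonical hA s hs)) (MpQUEA.U q) ∧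
        IsToralDeformation (MpQUEA.torusProjPos (q.canonical hA s hs)) (MpQUEA.borelPos q) ∧
        IsToralDeformation (MpQUEA.torusProjNeg (q.canonical hA s hs)) (MpQUEA.borelNeg q)) := by
  have key (q' q'' : Multiparameter 𝕜 A) (h : TwistEquiv q' q'') :
      IsToralDeformation (MpQUEA.torusProj q') (MpQUEA.U q'') ∧
      IsToralDeformation (MpQUEA.torusProjPos q') (MpQUEA.borelPos q'') ∧
      IsToralDeformation (MpQUEA.torusProjNeg q') (MpQUEA.borelNeg q'') := by
    obtain ⟨χ, hχ⟩ := h.exists_isTwist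
    exact ⟨MpQUEA.isToralDeformation_torusProj hχ, MpQUEA.isToralDeformation_torusProjPos hχ,
      MpQUEA.isToralDeformation_torusProjNeg hχ⟩
  -- The Cartan-type statement is the twist-equivalence statement with the canonical multiparameter
  -- as `q'`.
  exact ⟨key, fun q hq s hs ↦ key _ _ (hq.twistEquiv_canonical hA s hs)⟩
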